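/- Let $G$ be a finite group, $p$ a prime number and $K$ a finite extension of $\mathbb{Q}_p$ such that the group algebra $KH$ is split for every subgroup $H$ of $G$. Let $\mathcal{O}$ be the integral closure of $\mathbb{Z}_p$ in $K$, $\mathfrak{p}$ its maximal ideal and $k=\mathcal{O}/\mathfrak{p}$. A block idempotent of a ring is a primitive idempotent of its center. For $g\in G$ write $g=g_pg_{p'}=g_{p'}g_p$ with $g_p$ a $p$-element and $g_{p'}$ a $p'$-element. Let $\mathcal{M}(G)$ be the set of $G$-orbits (under conjugation) of pairs $(g,\gamma)$ with $g\in G$ and $\gamma$ an irreducible character of $C_G(g)$ over $K$, and let $\mathcal{M}^p(G)$ be the set of $G$-orbits of pairs $(s,e)$ with $s$ a $p'$-element of $G$ and $e$ a block idempotent of $\mathcal{O}C_G(s)$. Let $\mathbf{K}_G(G)$ be the Grothendieck ring of the category of $G$-equivariant finite-dimensional $K$-vector bundles on $G$ (for the conjugation action), with the product induced by convolution, $(V * W)_z=\bigoplus_{xy=z}V_x\otimes W_y$. For $h\in G$ and an irreducible character $\eta$ of $C_G(h)$, afforded by $E$, let $V_{h,\eta}$ be the class of the bundle $G\times_{C_G(h)}E\to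 G$, $(x,v)\mapsto xhx^{-1}$. The $K$-algebra morphisms $K\otimes_{\mathbb{Z}}\mathbf{K}_G(G)\to K$ are parametrized by $\mathcal{M}(G)$: for each pair $(g,\gamma)$ there is exactly one such morphism $\Psi_{g,\gamma}$ with $$\Psi_{g,\gamma}(V_{h,\eta})=\frac{|C_G(g)|}{\gamma(1)}\cdot\frac{1}{|C_G(g)|\,|C_G(h)|}\sum_{\substack{x\in G\\ xgx^{-1}\in C_G(h)}}\eta(xgx^{-1})\,\gamma(x^{-1}hx)$$ for all $(h,\eta)$; every morphism is of this form, and $\Psi_{g,\gamma}=\Psi_{g',\gamma'}$ if and only if $(g,\gamma)$ and $(g',\gamma')$ are $G$-conjugate. A $p$-block of $\mathcal{M}(G)$ is a subset of the form $\{(g,\gamma)\in\mathcal{M}(G)\mid \Psi_{g,\gamma}(b)=1\}$ for some block idempotent $b$ of $\mathcal{O}\otimes_{\mathbb{Z}}\mathbf{K}_G(G)$. For $g\in G$ with $g_{p'}=s$, let $\mathrm{Br}_g:kC_G(s)\to kC_G(g)$ be the $k$-linear map with $c\mapsto c$ if $c\in C_G(g)$ and $c\mapsto 0$ if $c\in C_G(s)\setminus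 C_G(g)$. If $e$ is a block idempotent of $\mathcal{O}C_G(s)$ with reduction $\bar e\in kC_G(s)$, then $\mathrm{Br}_g(\bar e)$ is a (possibly empty) sum of distinct block idempotents of $kC_G(g)$; let $\beta_g^{\mathcal{O}}(e)$ be the sum of the block idempotents of $\mathcal{O}C_G(g)$ that lift them. Let $\mathfrak{B}_G(s,e)\subseteq\mathcal{M}(G)$ be the set of orbits of the pairs $(g,\gamma)$ such that $g_{p'}=s$ and $\gamma\in\mathrm{Irr}(KC_G(g)\beta_g^{\mathcal{O}}(e))$, i.e. $\beta_g^{\mathcal{O}}(e)$ acts as the identity on the simple $KC_G(g)$-module with character $\gamma$. Then $\mathfrak{B}_G(s,e)$ depends only on the $G$-orbit of $(s,e)$, and the map $(s,e)\mapsto\mathfrak{B}_G(s,e)$ induces a bijection from $\mathcal{M}^p(G)$ onto the set of $p$-blocks of $\mathcal{M}(G)$. -/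

import Mathlib

open scoped TensorProduct DirectSum

universe u v

set_option linter.unusedSectionVars false

noncomputable section

/-! ### Equivariant vector bundles on a finite group -/

/-- A `G`-equivariant finite-dimensional `K`-vector bundle on the (discrete) group `G`, for the
action of `G` on itself by conjugation: a finite-dimensional fibre over each point `x`, and linear
maps `act g : V_x → V_{g x g⁻¹}` that compose as the elements of `G` do.  The target of `act` is
written as `V_y` with `g x g⁻¹ = y`. -/
structure EqBundle (G : Type u) (K : Type v) [Group G] [Field K] where
  fibre : G → Type (max u v)
  [addCommGroup : ∀ x, AddCommGroup (fibre x)]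
  [module : ∀ x, Module K (fibre x)]
  [finite : ∀ x, Module.Finite K (fibre x)]
  act : ∀ (g : G) {x y : G}, g * x * g⁻¹ = y → (fibre x →ₗ[K] fibre y)
  act_one : ∀ {x : G} (h : 1 * x * 1⁻¹ = x) (v : fibre x), act 1 h v = v
  act_mul : ∀ {g g' x y z : G} (h : g' * x * g'⁻¹ = y) (h' : g * y * g⁻¹ = z)
    (h'' : g * g' * x * (g * g')⁻¹ = z) (v : fibre x), act (g * g') h'' v = act g h' (act g' h v)

attribute [instance] EqBundle.addCommGroup EqBundle.module EqBundle.finite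

namespace EqBundle

variable {G : Type u} {K : Type v} [Group G] [Field K]

/-- Morphisms of equivariant bundles: families of linear maps on fibres commuting with `G`. -/
structure Hom (V W : EqBundle G K) where
  map : ∀ x, V.fibre x →ₗ[K] W.fibre x
  comm : ∀ (g : G) {x y : G} (h : g * x * g⁻¹ = y) (v : V.fibre x),
    map y (V.act g h v) = W.act g h (map x v)

/-- Two bundles are isomorphic. -/
def Iso (V W : EqBundle G K) : Prop :=
  ∃ (f : Hom V W) (f' : Hom W V),
    (∀ x v, f'.map x (f.map x v) = v) ∧ (∀ x w, f.map x (f'.map x w) = w)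

theorem Iso.refl (V : EqBundle G K) : Iso V V :=
  ⟨⟨fun _ => LinearMap.id, fun _ _ _ _ _ => rfl⟩, ⟨fun _ => LinearMap.id, fun _ _ _ _ _ => rfl⟩,
    fun _ _ => rfl, fun _ _ => rfl⟩

theorem Iso.symm {V W : EqBundle G K} : Iso V W → Iso W V :=
  fun ⟨f, f', h, h'⟩ => ⟨f', f, h', h⟩

theorem Iso.trans {V W U : EqBundle G K} : Iso V W → Iso W U → Iso V U := by
  rintro ⟨f, f', h, h'⟩ ⟨k, k', l, l'⟩
  refine ⟨⟨fun x => k.map x ∘ₗ f.map x, ?_⟩, ⟨fun x => f'.map x ∘ₗ k'.map x, ?_⟩, ?_, ?_⟩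
  · intro g x y e v; simp [f.comm, k.comm]
  · intro g x y e v; simp [f'.comm, k'.comm]
  · intro x v; simp [h, l]
  · intro x v; simp [h', l']

instance isoSetoid (G : Type u) (K : Type v) [Group G] [Field K] : Setoid (EqBundle G K) where
  r := Iso
  iseqv := ⟨Iso.refl, Iso.symm, Iso.trans⟩

/-- A short exact sequence `0 → V' → V → V'' → 0` of equivariant bundles. -/
def ShortExact (V' V V'' : EqBundle G K) : Prop :=
  ∃ (i : Hom V' V) (q : Hom V V''), ∀ x,
    Function.Injective (i.map x) ∧ Function.Surjective (q.map x) ∧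
      LinearMap.range (i.map x) = LinearMap.ker (q.map x)

section Conv

open scoped Classical

/-- The fibre at `z` of the convolution product of `V` and `W`: the direct sum of the
`V_x ⊗ W_y` over the pairs `(x, y)` with `x y = z`. -/
abbrev ConvFibre (V W : EqBundle G K) (z : G) : Type (max u v) :=
  ⨁ i : {i : G × G // i.1 * i.2 = z}, V.fibre i.1.1 ⊗[K] W.fibre i.1.2

/-- The element `v ⊗ w` of the summand `V_x ⊗ W_y` of the fibre at `z = x y`. -/
def cmk (V W : EqBundle G K) {x y z : G} (h : x * y = z) :
    V.fibre x →ₗ[K] W.fibre y →ₗ[K] ConvFibre V W z :=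
  (TensorProduct.mk K (V.fibre x) (W.fibre y)).compr₂
    (DirectSum.lof K {i : G × G // i.1 * i.2 = z}
      (fun i => V.fibre i.1.1 ⊗[K] W.fibre i.1.2) ⟨(x, y), h⟩)

/-- Linear maps out of a fibre of a convolution product. -/
def clift (V W : EqBundle G K) {z : G} {M : Type*} [AddCommGroup M] [Module K M]
    (φ : ∀ x y : G, x * y = z → (V.fibre x →ₗ[K] W.fibre y →ₗ[K] M)) :
    ConvFibre V W z →ₗ[K] M :=
  DirectSum.toModule K _ M fun i => TensorProduct.lift (φ i.1.1 i.1.2 i.2)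

theorem clift_cmk (V W : EqBundle G K) {z : G} {M : Type*} [AddCommGroup M] [Module K M]
    (φ : ∀ x y : G, x * y = z → (V.fibre x →ₗ[K] W.fibre y →ₗ[K] M)) {x y : G} (h : x * y = z)
    (v : V.fibre x) (w : W.fibre y) : clift V W φ (cmk V W h v w) = φ x y h v w := by
  simp [clift, cmk]

theorem conv_ext (V W : EqBundle G K) {z : G} {M : Type*} [AddCommGroup M] [Module K M]
    {a b : ConvFibre V W z →ₗ[K] M}
    (H : ∀ (x y : G) (h : x * y = z) (v : V.fibre x) (w : W.fibre y),
      a (cmk V W h v w) = b (cmk V W h v w)) (t : ConvFibre V W z) : a t = b t := by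
  suffices a = b by rw [this]
  refine DirectSum.linearMap_ext K fun i => TensorProduct.ext' fun v w => ?_
  obtain ⟨⟨x, y⟩, h⟩ := i
  exact H x y h v w

theorem conj_mul_conj {g x y z z' : G} (h : x * y = z) (h' : g * z * g⁻¹ = z') :
    g * x * g⁻¹ * (g * y * g⁻¹) = z' := by
  subst h h'; group

/-- The action on the convolution product: `g (v ⊗ w) = g v ⊗ g w`. -/
def convAct (V W : EqBundle G K) (g : G) {z z' : G} (h : g * z * g⁻¹ = z') :
    ConvFibre V W z →ₗ[K] ConvFibre V W z' :=
  clift V W fun _ _ hxy => (cmk V W (conj_mul_conj hxy h)).compl₁₂ (V.act g rfl) (W.act g rfl)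

theorem convAct_cmk (V W : EqBundle G K) (g : G) {x y z x' y' z' : G} (h : g * z * g⁻¹ = z')
    (hxy : x * y = z) (hx : g * x * g⁻¹ = x') (hy : g * y * g⁻¹ = y') (hxy' : x' * y' = z')
    (v : V.fibre x) (w : W.fibre y) :
    convAct V W g h (cmk V W hxy v w) = cmk V W hxy' (V.act g hx v) (W.act g hy w) := by
  subst hx hy
  rw [convAct, clift_cmk]
  rfl

variable [Finite G]

/-- The convolution product of two equivariant bundles, that is, the direct image of the external
tensor product by the multiplication `G × G → G`. -/
def conv (V W : EqBundle G K) : EqBundle G K where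
  fibre := ConvFibre V W
  finite _ := Module.Finite.instDirectSum _
  act := convAct V W
  act_one {z} h t := by
    refine conv_ext V W (b := LinearMap.id) (fun x y hxy v w => ?_) t
    have hx : 1 * x * 1⁻¹ = x := by group
    have hy : 1 * y * 1⁻¹ = y := by group
    rw [convAct_cmk V W 1 h hxy hx hy hxy, V.act_one, W.act_one]; rfl
  act_mul {g g' a b c} h h' h'' t := by
    refine conv_ext V W (b := convAct V W g h' ∘ₗ convAct V W g' h) (fun x y hxy v w => ?_) t
    have e : ∀ x, g * g' * x * (g * g')⁻¹ = g * (g' * x * g'⁻¹) * g⁻¹ := fun x => by group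
    rw [LinearMap.comp_apply, convAct_cmk V W g' h hxy rfl rfl (conj_mul_conj hxy h),
      convAct_cmk V W g h' _ rfl rfl (conj_mul_conj (conj_mul_conj hxy h) h'),
      convAct_cmk V W (g * g') h'' hxy (e x) (e y), V.act_mul rfl rfl, W.act_mul rfl rfl]

/-- The pure tensors `v ⊗ w`, with `v ∈ V_x` and `w ∈ W_y`, in the fibre at `z = x y`. -/
def tmk (V W : EqBundle G K) {x y z : G} (h : x * y = z) :
    V.fibre x →ₗ[K] W.fibre y →ₗ[K] (conv V W).fibre z := cmk V W h

/-- Linear maps out of a fibre of a convolution product. -/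
def lift (V W : EqBundle G K) {z : G} {M : Type*} [AddCommGroup M] [Module K M]
    (φ : ∀ x y : G, x * y = z → (V.fibre x →ₗ[K] W.fibre y →ₗ[K] M)) :
    (conv V W).fibre z →ₗ[K] M := clift V W φ

theorem lift_mk (V W : EqBundle G K) {z : G} {M : Type*} [AddCommGroup M] [Module K M]
    (φ : ∀ x y : G, x * y = z → (V.fibre x →ₗ[K] W.fibre y →ₗ[K] M)) {x y : G} (h : x * y = z)
    (v : V.fibre x) (w : W.fibre y) : lift V W φ (tmk V W h v w) = φ x y h v w :=
  clift_cmk V W φ h v w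

theorem hom_ext {V W : EqBundle G K} {z : G} {M : Type*} [AddCommGroup M] [Module K M]
    {a b : (conv V W).fibre z →ₗ[K] M}
    (H : ∀ (x y : G) (h : x * y = z) (v : V.fibre x) (w : W.fibre y),
      a (tmk V W h v w) = b (tmk V W h v w)) (t : (conv V W).fibre z) : a t = b t :=
  conv_ext V W (a := a) (b := b) H t

theorem act_mk (V W : EqBundle G K) (g : G) {x y z x' y' z' : G} (h : g * z * g⁻¹ = z')
    (hxy : x * y = z) (hx : g * x * g⁻¹ = x') (hy : g * y * g⁻¹ = y') (hxy' : x' * y' = z')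
    (v : V.fibre x) (w : W.fibre y) :
    (conv V W).act g h (tmk V W hxy v w) = tmk V W hxy' (V.act g hx v) (W.act g hy w) :=
  convAct_cmk V W g h hxy hx hy hxy' v w

theorem act_eq_self (V : EqBundle G K) {g x : G} (hg : g = 1) (h : g * x * g⁻¹ = x)
    (v : V.fibre x) : V.act g h v = v := by
  subst hg; exact V.act_one h v

theorem conv_congr {V V' W W' : EqBundle G K} (hV : Iso V V') (hW : Iso W W') :
    Iso (conv V W) (conv V' W') := by
  obtain ⟨f, f', h, h'⟩ := hV
  obtain ⟨k, k', l, l'⟩ := hW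
  have key : ∀ {V V' W W' : EqBundle G K} (f : Hom V V') (k : Hom W W'),
      ∃ F : Hom (conv V W) (conv V' W'), ∀ {x y z : G} (h : x * y = z) v w,
        F.map z (tmk V W h v w) = tmk V' W' h (f.map x v) (k.map y w) := by
    intro V V' W W' f k
    let F : ∀ z, (conv V W).fibre z →ₗ[K] (conv V' W').fibre z := fun z =>
      lift V W fun x y hxy => (tmk V' W' hxy).compl₁₂ (f.map x) (k.map y)
    have hF : ∀ {x y z : G} (h : x * y = z) v w,
        F z (tmk V W h v w) = tmk V' W' h (f.map x v) (k.map y w) := by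
      intro x y z h v w
      exact lift_mk V W _ h v w
    refine ⟨⟨F, ?_⟩, hF⟩
    intro g a b e t
    refine hom_ext (a := F b ∘ₗ (conv V W).act g e) (b := (conv V' W').act g e ∘ₗ F a) ?_ t
    intro x y hxy v w
    rw [LinearMap.comp_apply, LinearMap.comp_apply, hF,
      act_mk V W g e hxy rfl rfl (conj_mul_conj hxy e), hF,
      act_mk V' W' g e hxy rfl rfl (conj_mul_conj hxy e), f.comm, k.comm]
  obtain ⟨F, hF⟩ := key f k
  obtain ⟨F', hF'⟩ := key f' k'
  refine ⟨F, F', fun z t => ?_, fun z t => ?_⟩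
  · refine hom_ext (a := F'.map z ∘ₗ F.map z) (b := LinearMap.id) ?_ t
    intro x y hxy v w
    rw [LinearMap.comp_apply, hF]
    exact (hF' _ _ _).trans (by rw [h, l]; rfl)
  · refine hom_ext (a := F.map z ∘ₗ F'.map z) (b := LinearMap.id) ?_ t
    intro x y hxy v w
    rw [LinearMap.comp_apply, hF']
    exact (hF _ _ _).trans (by rw [h', l']; rfl)

theorem conv_comm (V W : EqBundle G K) : Iso (conv V W) (conv W V) := by
  have e₁ : ∀ {x y z : G}, x * y = z → x * y * x⁻¹ * x = z := fun h => by simpa using h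
  have e₂ : ∀ {x y z : G}, x * y = z → y * (y⁻¹ * x * y) = z := fun h => by
    rw [← h]; group
  let F : ∀ z, (conv V W).fibre z →ₗ[K] (conv W V).fibre z := fun z =>
    lift V W fun x y hxy => ((tmk W V (e₁ hxy)).comp (W.act x rfl)).flip
  have e₃ : ∀ {x y : G}, y⁻¹ * x * y⁻¹⁻¹ = y⁻¹ * x * y := fun {x y} => by simp
  let F' : ∀ z, (conv W V).fibre z →ₗ[K] (conv V W).fibre z := fun z =>
    lift W V fun x y hxy => ((tmk V W (e₂ hxy)).flip.comp (W.act y⁻¹ e₃))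
  have hF : ∀ {x y z y' : G} (h : x * y = z) (hy : x * y * x⁻¹ = y') (h' : y' * x = z) v w,
      F z (tmk V W h v w) = tmk W V h' (W.act x hy w) v := by
    intro x y z y' h hy h' v w
    subst hy
    exact lift_mk V W _ h v w
  have hF' : ∀ {x y z x' : G} (h : x * y = z) (hx : y⁻¹ * x * y⁻¹⁻¹ = x') (h' : y * x' = z) w v,
      F' z (tmk W V h w v) = tmk V W h' v (W.act y⁻¹ hx w) := by
    intro x y z x' h hx h' w v
    have hx' : x' = y⁻¹ * x * y := by rw [← hx]; simp
    subst hx'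
    exact lift_mk W V _ h w v
  refine ⟨⟨F, ?_⟩, ⟨F', ?_⟩, ?_, ?_⟩
  · intro g a b e t
    refine hom_ext (a := F b ∘ₗ (conv V W).act g e) (b := (conv W V).act g e ∘ₗ F a) ?_ t
    intro x y hxy v w
    have e₄ : g * x * g⁻¹ * (g * y * g⁻¹) * (g * x * g⁻¹)⁻¹ = g * (x * y * x⁻¹) * g⁻¹ := by group
    rw [LinearMap.comp_apply, LinearMap.comp_apply, hF hxy rfl (e₁ hxy),
      act_mk V W g e hxy rfl rfl (conj_mul_conj hxy e),
      act_mk W V g e _ rfl rfl (conj_mul_conj (e₁ hxy) e),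
      hF _ e₄ (conj_mul_conj (e₁ hxy) e)]
    congr 2
    rw [← W.act_mul (g := g * x * g⁻¹) (g' := g) rfl e₄ (by group),
      ← W.act_mul (g := g) (g' := x) rfl rfl (by group)]
    congr 2
    group
  · intro g a b e t
    refine hom_ext (a := F' b ∘ₗ (conv W V).act g e) (b := (conv V W).act g e ∘ₗ F' a) ?_ t
    intro x y hxy w v
    have e₄ : (g * y * g⁻¹)⁻¹ * (g * x * g⁻¹) * (g * y * g⁻¹)⁻¹⁻¹ =
      g * (y⁻¹ * x * y⁻¹⁻¹) * g⁻¹ := by group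
    have e₅ : y * (y⁻¹ * x * y⁻¹⁻¹) = a := by rw [← hxy]; group
    rw [LinearMap.comp_apply, LinearMap.comp_apply, hF' hxy rfl e₅,
      act_mk W V g e hxy rfl rfl (conj_mul_conj hxy e),
      act_mk V W g e _ rfl rfl (conj_mul_conj e₅ e),
      hF' _ e₄ (conj_mul_conj e₅ e)]
    congr 1
    rw [← W.act_mul (g := (g * y * g⁻¹)⁻¹) (g' := g) rfl e₄ (by group),
      ← W.act_mul (g := g) (g' := y⁻¹) rfl rfl (by group)]
    congr 2
    group
  · intro z t
    refine hom_ext (a := F' z ∘ₗ F z) (b := LinearMap.id) ?_ t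
    intro x y hxy v w
    have e₄ : x⁻¹ * (x * y * x⁻¹) * x⁻¹⁻¹ = y := by group
    rw [LinearMap.comp_apply, hF hxy rfl (e₁ hxy), hF' (e₁ hxy) e₄ hxy,
      ← W.act_mul (g := x⁻¹) (g' := x) rfl e₄ (by group)]
    rw [W.act_eq_self (by group)]; rfl
  · intro z t
    refine hom_ext (a := F z ∘ₗ F' z) (b := LinearMap.id) ?_ t
    intro x y hxy w v
    have e₅ : y * (y⁻¹ * x * y⁻¹⁻¹) = z := by rw [← hxy]; group
    have e₄ : y * (y⁻¹ * x * y⁻¹⁻¹) * y⁻¹ = x := by group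
    rw [LinearMap.comp_apply, hF' hxy rfl e₅, hF e₅ e₄ hxy,
      ← W.act_mul (g := y) (g' := y⁻¹) rfl e₄ (by group)]
    rw [W.act_eq_self (by group)]; rfl

theorem conv_assoc (V W U : EqBundle G K) :
    Iso (conv (conv V W) U) (conv V (conv W U)) := by
  let F : ∀ z, (conv (conv V W) U).fibre z →ₗ[K] (conv V (conv W U)).fibre z := fun z =>
    lift (conv V W) U fun a c hac => lift V W fun x y hxy =>
      LinearMap.mk₂ K (fun v w => (tmk V (conv W U) (y := y * c) (z := z)
          (by rw [← hac, ← hxy, mul_assoc]) v) ∘ₗ tmk W U rfl w)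
        (fun _ _ _ => LinearMap.ext fun _ => by simp) (fun _ _ _ => LinearMap.ext fun _ => by simp)
        (fun _ _ _ => LinearMap.ext fun _ => by simp) (fun _ _ _ => LinearMap.ext fun _ => by simp)
  let F' : ∀ z, (conv V (conv W U)).fibre z →ₗ[K] (conv (conv V W) U).fibre z := fun z =>
    lift V (conv W U) fun x b hxb => LinearMap.flip <| lift W U fun y c hyc =>
      LinearMap.mk₂ K (fun w t => ((tmk (conv V W) U (x := x * y) (z := z)
          (by rw [← hxb, ← hyc, mul_assoc])).flip t) ∘ₗ (tmk V W rfl).flip w)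
        (fun _ _ _ => LinearMap.ext fun _ => by simp) (fun _ _ _ => LinearMap.ext fun _ => by simp)
        (fun _ _ _ => LinearMap.ext fun _ => by simp) (fun _ _ _ => LinearMap.ext fun _ => by simp)
  have hF : ∀ {x y c a b z : G} (hxy : x * y = a) (hac : a * c = z) (hyc : y * c = b)
      (hxb : x * b = z) v w t,
      F z (tmk (conv V W) U hac (tmk V W hxy v w) t) =
        tmk V (conv W U) hxb v (tmk W U hyc w t) := by
    intro x y c a b z hxy hac hyc hxb v w t
    subst hyc
    simp only [F, lift_mk, LinearMap.mk₂_apply, LinearMap.comp_apply]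
  have hF' : ∀ {x y c a b z : G} (hxy : x * y = a) (hac : a * c = z) (hyc : y * c = b)
      (hxb : x * b = z) v w t,
      F' z (tmk V (conv W U) hxb v (tmk W U hyc w t)) =
        tmk (conv V W) U hac (tmk V W hxy v w) t := by
    intro x y c a b z hxy hac hyc hxb v w t
    subst hxy
    simp only [F', lift_mk, LinearMap.mk₂_apply, LinearMap.comp_apply, LinearMap.flip_apply]
  have ext₁ : ∀ {z : G} {M : Type (max u v)} [AddCommGroup M] [Module K M]
      {α β : (conv (conv V W) U).fibre z →ₗ[K] M},
      (∀ (x y c a b : G) (hxy : x * y = a) (hac : a * c = z) (_ : y * c = b) (_ : x * b = z) v w t,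
        α (tmk (conv V W) U hac (tmk V W hxy v w) t) = β (tmk (conv V W) U hac (tmk V W hxy v w) t)) →
      ∀ t, α t = β t := by
    intro z M _ _ α β H t
    refine hom_ext (fun a c hac s t => ?_) t
    refine hom_ext (a := α ∘ₗ (tmk (conv V W) U hac).flip t)
      (b := β ∘ₗ (tmk (conv V W) U hac).flip t) (fun x y hxy v w => ?_) s
    exact H x y c a _ hxy hac rfl (by rw [← hac, ← hxy, mul_assoc]) v w t
  have ext₂ : ∀ {z : G} {M : Type (max u v)} [AddCommGroup M] [Module K M]
      {α β : (conv V (conv W U)).fibre z →ₗ[K] M},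
      (∀ (x y c a b : G) (_ : x * y = a) (_ : a * c = z) (hyc : y * c = b) (hxb : x * b = z) v w t,
        α (tmk V (conv W U) hxb v (tmk W U hyc w t)) = β (tmk V (conv W U) hxb v (tmk W U hyc w t))) →
      ∀ t, α t = β t := by
    intro z M _ _ α β H t
    refine hom_ext (fun x b hxb v s => ?_) t
    refine hom_ext (a := α ∘ₗ tmk V (conv W U) hxb v)
      (b := β ∘ₗ tmk V (conv W U) hxb v) (fun y c hyc w t => ?_) s
    exact H x y c _ b rfl (by rw [← hxb, ← hyc, mul_assoc]) hyc hxb v w t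
  refine ⟨⟨F, ?_⟩, ⟨F', ?_⟩, ?_, ?_⟩
  · intro g z z' e t
    refine ext₁ (α := F z' ∘ₗ (conv (conv V W) U).act g e)
      (β := (conv V (conv W U)).act g e ∘ₗ F z) ?_ t
    intro x y c a b hxy hac hyc hxb v w t
    rw [LinearMap.comp_apply, LinearMap.comp_apply, hF hxy hac hyc hxb,
      act_mk _ _ g e hac rfl rfl (conj_mul_conj hac e),
      act_mk _ _ g _ hxy rfl rfl (conj_mul_conj hxy rfl),
      act_mk _ _ g e hxb rfl rfl (conj_mul_conj hxb e),
      act_mk _ _ g _ hyc rfl rfl (conj_mul_conj hyc rfl),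
      hF _ _ (conj_mul_conj hyc rfl) (conj_mul_conj hxb e)]
  · intro g z z' e t
    refine ext₂ (α := F' z' ∘ₗ (conv V (conv W U)).act g e)
      (β := (conv (conv V W) U).act g e ∘ₗ F' z) ?_ t
    intro x y c a b hxy hac hyc hxb v w t
    rw [LinearMap.comp_apply, LinearMap.comp_apply, hF' hxy hac hyc hxb,
      act_mk _ _ g e hac rfl rfl (conj_mul_conj hac e),
      act_mk _ _ g _ hxy rfl rfl (conj_mul_conj hxy rfl),
      act_mk _ _ g e hxb rfl rfl (conj_mul_conj hxb e),
      act_mk _ _ g _ hyc rfl rfl (conj_mul_conj hyc rfl),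
      hF' (conj_mul_conj hxy rfl) (conj_mul_conj hac e)]
  · intro z t
    refine ext₁ (α := F' z ∘ₗ F z) (β := LinearMap.id) ?_ t
    intro x y c a b hxy hac hyc hxb v w t
    rw [LinearMap.comp_apply, hF hxy hac hyc hxb, hF' hxy hac hyc hxb]; rfl
  · intro z t
    refine ext₂ (α := F z ∘ₗ F' z) (β := LinearMap.id) ?_ t
    intro x y c a b hxy hac hyc hxb v w t
    rw [LinearMap.comp_apply, hF' hxy hac hyc hxb, hF hxy hac hyc hxb]; rfl

/-- The unit for convolution: the trivial line bundle at `1`, extended by `0`. -/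
def unit (G : Type u) (K : Type v) [Group G] [Field K] : EqBundle G K where
  fibre x := ULift.{u} (PLift (x = 1)) → K
  act g {x y} h :=
    { toFun := fun f i => f ⟨⟨by have := i.down.down; subst this; simpa using h⟩⟩
      map_add' := fun _ _ => rfl
      map_smul' := fun _ _ => rfl }
  act_one _ _ := rfl
  act_mul _ _ _ _ := rfl

/-- The basis vector of the fibre at `1` of the unit bundle. -/
def unitOne (G : Type u) (K : Type v) [Group G] [Field K] : (unit G K).fibre 1 := fun _ => (1 : K)

/-- The coordinate on the fibre at `1` of the unit bundle. -/
def unitEval (G : Type u) (K : Type v) [Group G] [Field K] {x : G} (hx : x = 1) :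
    (unit G K).fibre x →ₗ[K] K where
  toFun f := f ⟨⟨hx⟩⟩
  map_add' _ _ := rfl
  map_smul' _ _ := rfl

theorem unitEval_one (hx : (1 : G) = 1) : unitEval G K hx (unitOne G K) = 1 := rfl

theorem unitEval_smul (f : (unit G K).fibre 1) : unitEval G K rfl f • unitOne G K = f :=
  funext fun _ => mul_one (f ⟨⟨rfl⟩⟩)

theorem unit_eq_zero {x : G} (hx : x ≠ 1) (f : (unit G K).fibre x) : f = 0 :=
  funext fun i => absurd i.down.down hx

theorem unit_act (g : G) (h : g * 1 * g⁻¹ = 1) :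
    (unit G K).act g h (unitOne G K) = unitOne G K := rfl

theorem unit_conv (V : EqBundle G K) : Iso (conv (unit G K) V) V := by
  let φ : ∀ x y z : G, x * y = z → ((unit G K).fibre x →ₗ[K] V.fibre y →ₗ[K] V.fibre z) :=
    fun x y z hxy => if hx : x = 1 then
        LinearMap.smulRight (unitEval G K hx) (V.act 1 (x := y) (y := z) (by rw [← hxy, hx]; group))
      else 0
  have hφ : ∀ (y z : G) (h : 1 * y = z) (h' : 1 * y * 1⁻¹ = z),
      φ 1 y z h = LinearMap.smulRight (unitEval G K rfl) (V.act 1 h') :=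
    fun y z h h' => dif_pos rfl
  let F : ∀ z, (conv (unit G K) V).fibre z →ₗ[K] V.fibre z := fun z =>
    lift (unit G K) V fun x y hxy => φ x y z hxy
  have hF : ∀ {z : G} (h : 1 * z = z) (f : (unit G K).fibre 1) v,
      F z (tmk (unit G K) V h f v) = unitEval G K rfl f • v := by
    intro z h f v
    simp only [F, lift_mk]
    rw [hφ z z h (by group), LinearMap.smulRight_apply, LinearMap.smul_apply, V.act_one]
  let F' : ∀ z, V.fibre z →ₗ[K] (conv (unit G K) V).fibre z := fun z =>
    tmk (unit G K) V (one_mul z) (unitOne G K)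
  have e : ∀ {z : G} (v : V.fibre z), F z (F' z v) = v := by
    intro z v
    simp only [F']
    rw [hF, unitEval_one, one_smul]
  have e' : ∀ {z : G} t, F' z (F z t) = t := by
    intro z t
    refine hom_ext (a := F' z ∘ₗ F z) (b := LinearMap.id) ?_ t
    intro x y h f v
    by_cases hx : x = 1
    · subst hx
      have hy : y = z := by simpa using h
      subst hy
      rw [LinearMap.comp_apply, hF, map_smul, ← LinearMap.smul_apply]
      simp only [F']
      rw [← map_smul, unitEval_smul]
      rfl
    · rw [unit_eq_zero hx f, map_zero, LinearMap.zero_apply, map_zero, map_zero]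
  have c' : ∀ (g : G) {x y : G} (h : g * x * g⁻¹ = y) v,
      F' y (V.act g h v) = (conv (unit G K) V).act g h (F' x v) := by
    intro g x y h v
    simp only [F']
    rw [act_mk (unit G K) V g h (one_mul x) (by group) h (one_mul y), unit_act]
  refine ⟨⟨F, ?_⟩, ⟨F', c'⟩, fun _ _ => e' _, fun _ _ => e _⟩
  intro g x y h t
  rw [← e' t, ← c', e, e]

/-- Isomorphism classes of equivariant bundles, a commutative monoid under convolution. -/
def IsoClass (G : Type u) (K : Type v) [Group G] [Field K] : Type (max u v + 1) :=
  Quotient (isoSetoid G K)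

instance : CommMonoid (IsoClass G K) where
  mul := Quotient.map₂ conv fun _ _ h _ _ h' => conv_congr h h'
  one := Quotient.mk _ (unit G K)
  mul_assoc := by
    rintro ⟨a⟩ ⟨b⟩ ⟨c⟩; exact Quotient.sound (conv_assoc a b c)
  mul_comm := by
    rintro ⟨a⟩ ⟨b⟩; exact Quotient.sound (conv_comm a b)
  one_mul := by
    rintro ⟨a⟩; exact Quotient.sound (unit_conv a)
  mul_one := by
    rintro ⟨a⟩; exact Quotient.sound ((conv_comm a _).trans (unit_conv a))

end Conv
end EqBundle

/-! ### The Grothendieck ring -/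

section Grothendieck

variable (G : Type u) (K : Type v) [Group G] [Finite G] [Field K]

/-- The relations `[V] = [V'] + [V'']` for short exact sequences `0 → V' → V → V'' → 0`.
(Convolution being exact, these relations already span an ideal as an additive group.) -/
def exactRelations : Ideal (FreeAbelianGroup (EqBundle.IsoClass G K)) :=
  Ideal.span {r | ∃ V' V V'' : EqBundle G K, EqBundle.ShortExact V' V V'' ∧
    r = FreeAbelianGroup.of (Quotient.mk _ V : EqBundle.IsoClass G K) -
      FreeAbelianGroup.of (Quotient.mk _ V' : EqBundle.IsoClass G K) -
      FreeAbelianGroup.of (Quotient.mk _ V'' : EqBundle.IsoClass G K)}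

/-- The Grothendieck ring `K_G(G)` of the category of `G`-equivariant `K`-vector bundles on `G`,
with the product induced by convolution. -/
abbrev KGG : Type (max u v + 1) := FreeAbelianGroup (EqBundle.IsoClass G K) ⧸ exactRelations G K

variable {G K}

/-- The class of a bundle in the Grothendieck ring. -/
def EqBundle.cls (V : EqBundle G K) : KGG G K :=
  Ideal.Quotient.mk (exactRelations G K)
    (FreeAbelianGroup.of (Quotient.mk _ V : EqBundle.IsoClass G K))

end Grothendieck

/-! ### Characters, pairs and simple bundles -/

section Pairs

variable {G : Type u} [Group G]

/-- The centralizer `C_G(g)`. -/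
abbrev Cent (g : G) : Subgroup G := Subgroup.centralizer {g}

/-- The bundle on `G` associated with `h ∈ G` and a representation `ρ` of `C_G(h)` on `E`, that is,
`G ×_{C_G(h)} E → G`, `(x, v) ↦ x h x⁻¹`.  Its fibre at `y` is the space of functions `f` from
`{x | x h x⁻¹ = y}` to `E` with `f (x c) = ρ(c)⁻¹ f(x)` for `c ∈ C_G(h)`, and
`(g f)(x) = f (g⁻¹ x)`. -/
def EqBundle.ind [Finite G] {K : Type v} [Field K] (h : G) {E : Type v} [AddCommGroup E]
    [Module K E] [Module.Finite K E] (ρ : Representation K (Cent h) E) : EqBundle G K where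
  fibre y := ({ carrier := {f | ∀ (x x' : {x : G // x * h * x⁻¹ = y}) (c : Cent h),
                  x'.1 = x.1 * c → f x' = ρ c⁻¹ (f x)}
                add_mem' := fun ha hb x x' c e => by simp [ha x x' c e, hb x x' c e]
                zero_mem' := fun x x' c e => by simp
                smul_mem' := fun k f hf x x' c e => by simp [hf x x' c e] } :
              Submodule K ({x : G // x * h * x⁻¹ = y} → E))
  act g {y y'} hy :=
    { toFun := fun f => ⟨fun x => f.1 ⟨g⁻¹ * x.1, by
          have e : g⁻¹ * x.1 * h * (g⁻¹ * x.1)⁻¹ = g⁻¹ * (x.1 * h * x.1⁻¹) * g := by group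
          rw [e, x.2, ← hy]; group⟩, fun x x' c e =>
          f.2 _ _ c (by simp [e, mul_assoc])⟩
      map_add' := fun _ _ => rfl
      map_smul' := fun _ _ => rfl }
  act_one h f := by
    refine Subtype.ext (funext fun x => congrArg f.1 (Subtype.ext ?_))
    simp
  act_mul h h' h'' f := by
    refine Subtype.ext (funext fun x => congrArg f.1 (Subtype.ext ?_))
    simp [mul_assoc]

/-- `γ` is the character of an irreducible representation of `H` over `K`. -/
def IsIrrChar {H : Type*} [Group H] {K : Type v} [Field K] (γ : H → K) : Prop :=
  ∃ (n : ℕ) (ρ : Representation K H (Fin n → K)), ρ.IsIrreducible ∧ ρ.character = γ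

/-- The group algebra `KH` is split: the endomorphisms of every irreducible representation of `H`
over `K` are the scalars. -/
def IsSplitGroupAlgebra (K : Type v) [Field K] (H : Type*) [Group H] : Prop :=
  ∀ (n : ℕ) (ρ : Representation K H (Fin n → K)), ρ.IsIrreducible →
    Function.Bijective (algebraMap K (Representation.IntertwiningMap ρ ρ))

/-- The isomorphism `C_G(g) → C_G(g')`, `c ↦ x c x⁻¹`, for `g' = x g x⁻¹`. -/
def conjCent (x : G) {g g' : G} (h : x * g * x⁻¹ = g') : Cent g →* Cent g' where
  toFun c := ⟨x * c * x⁻¹, by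
    have hc := Subgroup.mem_centralizer_singleton_iff.1 c.2
    rw [Subgroup.mem_centralizer_singleton_iff, ← h]
    calc x * c * x⁻¹ * (x * g * x⁻¹) = x * (c * g) * x⁻¹ := by group
      _ = x * (g * c) * x⁻¹ := by rw [hc]
      _ = x * g * x⁻¹ * (x * c * x⁻¹) := by group⟩
  map_one' := by ext; simp
  map_mul' a b := by ext; simp

theorem conjCent_one {g : G} (h : 1 * g * 1⁻¹ = g) : conjCent 1 h = MonoidHom.id (Cent g) := by
  ext c; simp [conjCent]

theorem conjCent_inv {x g g' : G} (h : x * g * x⁻¹ = g') (h' : x⁻¹ * g' * x⁻¹⁻¹ = g) :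
    (conjCent x⁻¹ h').comp (conjCent x h) = MonoidHom.id (Cent g) := by
  ext c; simp [conjCent, mul_assoc]

theorem conjCent_mul {x y g g' g'' : G} (h : x * g * x⁻¹ = g') (h' : y * g' * y⁻¹ = g'')
    (h'' : y * x * g * (y * x)⁻¹ = g'') :
    (conjCent y h').comp (conjCent x h) = conjCent (y * x) h'' := by
  ext c; simp [conjCent, mul_assoc]

/-- The pairs `(g, γ)` with `g ∈ G` and `γ` an irreducible character of `C_G(g)` over `K`. -/
structure IrrPair (G : Type u) [Group G] (K : Type v) [Field K] where
  g : G
  γ : Cent g → K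
  irr : IsIrrChar γ

/-- Two pairs `(g, γ)` are equivalent if they are conjugate under `G`. -/
instance IrrPair.conjSetoid (G : Type u) [Group G] (K : Type v) [Field K] :
    Setoid (IrrPair G K) where
  r P Q := ∃ (x : G) (h : x * P.g * x⁻¹ = Q.g), ∀ c, Q.γ (conjCent x h c) = P.γ c
  iseqv :=
    { refl := fun P => ⟨1, by group, fun c => by rw [conjCent_one]; rfl⟩
      symm := by
        rintro P Q ⟨x, h, H⟩
        have h' : x⁻¹ * Q.g * x⁻¹⁻¹ = P.g := by rw [← h]; group
        refine ⟨x⁻¹, h', fun c => ?_⟩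
        have h2 : x⁻¹⁻¹ * P.g * x⁻¹⁻¹⁻¹ = Q.g := by simpa using h
        rw [← H]
        congr 1
        ext
        simp [conjCent, mul_assoc]
      trans := by
        rintro P Q R ⟨x, h, H⟩ ⟨y, h', H'⟩
        have h'' : y * x * P.g * (y * x)⁻¹ = R.g := by rw [← h', ← h]; group
        refine ⟨y * x, h'', fun c => ?_⟩
        rw [← conjCent_mul h h' h'', MonoidHom.comp_apply, H', H] }

/-- The set `ℳ(G)` of `G`-orbits of pairs `(g, γ)`. -/
def MSet (G : Type u) [Group G] (K : Type v) [Field K] : Type (max u v) :=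
  Quotient (IrrPair.conjSetoid G K)

/-- The orbit of a pair. -/
def IrrPair.orbit {K : Type v} [Field K] (P : IrrPair G K) : MSet G K := Quotient.mk _ P

open scoped Classical in
/-- Extension by zero of a function on `C_G(g)` to `G`. -/
def extZero {K : Type v} [Field K] {g : G} (γ : Cent g → K) : G → K :=
  fun x => if hx : x ∈ Cent g then γ ⟨x, hx⟩ else 0

open scoped Classical in
/-- The Fourier coefficient
`{(g,γ),(h,η)} = |C_G(g)|⁻¹ |C_G(h)|⁻¹ ∑_{x ∈ G, x h x⁻¹ ∈ C_G(g)} γ(x h x⁻¹) η(x⁻¹ g⁻¹ x)`.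
The functions `γ` on `C_G(g)` and `η` on `C_G(h)` are given by extensions to `G`, the values of
which outside of the centralizers do not matter. -/
def lusztigFourier {K : Type v} [Field K] [Fintype G] (g : G) (γ : G → K) (h : G) (η : G → K) : K :=
  ((Nat.card (Cent g) : K) * (Nat.card (Cent h) : K))⁻¹ *
    ∑ x : G, if x * h * x⁻¹ ∈ Cent g then γ (x * h * x⁻¹) * η (x⁻¹ * g⁻¹ * x) else 0

/-- The morphism of `K`-algebras `Ψ : K ⊗ K_G(G) → K` is the one attached to the pair `(g, γ)`:
`Ψ(V_{h,η}) = |C_G(g)| γ(1)⁻¹ {(h⁻¹,η),(g,γ)}` for all `h` and all irreducible characters `η` of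
`C_G(h)`, where `V_{h,η}` is the bundle associated with `h` and a representation affording `η`. -/
def IsPsi {K : Type v} [Field K] [Fintype G] (P : IrrPair G K) (Ψ : K ⊗[ℤ] KGG G K →ₐ[K] K) :
    Prop :=
  ∀ (h : G) (n : ℕ) (ρ : Representation K (Cent h) (Fin n → K)), ρ.IsIrreducible →
    Ψ (1 ⊗ₜ[ℤ] (EqBundle.ind h ρ).cls) =
      (Nat.card (Cent P.g) : K) / P.γ 1 *
        lusztigFourier h⁻¹ (extZero ρ.character) P.g (extZero P.γ)

end Pairs

/-! ### Blocks -/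

/-- A block idempotent of a ring: a primitive idempotent of its center. -/
def IsBlockIdempotent {A : Type*} [Ring A] (e : A) : Prop :=
  e ∈ Subring.center A ∧ IsIdempotentElem e ∧ e ≠ 0 ∧
    ∀ f ∈ Subring.center A, IsIdempotentElem f → e * f = f → f = 0 ∨ f = e

section Blocks

variable {G : Type u} [Group G]

/-- A `p`-element: its order is a power of `p`. -/
def IsPElement (p : ℕ) (u : G) : Prop := ∃ n : ℕ, orderOf u = p ^ n

/-- A `p'`-element: its order is prime to `p`. -/
def IsPPrimeElement (p : ℕ) (s : G) : Prop := (orderOf s).Coprime p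

/-- `s` is the `p'`-part of `g`: `g = u s = s u` with `u` a `p`-element and `s` a `p'`-element. -/
def IsPPrimePart (p : ℕ) (g s : G) : Prop :=
  ∃ u : G, g = u * s ∧ g = s * u ∧ IsPElement p u ∧ IsPPrimeElement p s

/-- The pairs `(s, e)` with `s` a `p'`-element of `G` and `e` a block idempotent of `R C_G(s)`. -/
structure BlPair (p : ℕ) (R : Type v) [CommRing R] (G : Type u) [Group G] where
  s : G
  e : MonoidAlgebra R (Cent s)
  isPPrime : IsPPrimeElement p s
  isBlock : IsBlockIdempotent e

/-- Two pairs `(s, e)` are equivalent if they are conjugate under `G`. -/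
instance BlPair.conjSetoid (p : ℕ) (R : Type v) [CommRing R] (G : Type u) [Group G] :
    Setoid (BlPair p R G) where
  r P Q := ∃ (x : G) (h : x * P.s * x⁻¹ = Q.s),
    MonoidAlgebra.mapDomainRingHom R (conjCent x h) P.e = Q.e
  iseqv :=
    { refl := fun P => ⟨1, by group, by
        rw [conjCent_one, MonoidAlgebra.mapDomainRingHom_id]; rfl⟩
      symm := by
        rintro P Q ⟨x, h, H⟩
        have h' : x⁻¹ * Q.s * x⁻¹⁻¹ = P.s := by rw [← h]; group
        refine ⟨x⁻¹, h', ?_⟩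
        rw [← H, ← RingHom.comp_apply, ← MonoidAlgebra.mapDomainRingHom_comp, conjCent_inv,
          MonoidAlgebra.mapDomainRingHom_id]
        rfl
      trans := by
        rintro P Q S ⟨x, h, H⟩ ⟨y, h', H'⟩
        have h'' : y * x * P.s * (y * x)⁻¹ = S.s := by rw [← h', ← h]; group
        refine ⟨y * x, h'', ?_⟩
        rw [← conjCent_mul h h' h'', MonoidAlgebra.mapDomainRingHom_comp, RingHom.comp_apply,
          H, H'] }

/-- The set `ℳ^p(G)` of `G`-orbits of pairs `(s, e)`. -/
def MpSet (p : ℕ) (R : Type v) [CommRing R] (G : Type u) [Group G] : Type (max u v) :=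
  Quotient (BlPair.conjSetoid p R G)

/-- The orbit of a pair. -/
def BlPair.orbit {p : ℕ} {R : Type v} [CommRing R] (P : BlPair p R G) : MpSet p R G :=
  Quotient.mk _ P

open scoped Classical in
/-- The Brauer map `Λ C_G(s) → Λ C_G(g)`: the linear map with `c ↦ c` if `c ∈ C_G(g)` and `c ↦ 0`
otherwise.  It is used when `s` is the `p'`-part of `g`. -/
def brauerMap (Λ : Type v) [CommRing Λ] (s g : G) (a : MonoidAlgebra Λ (Cent s)) :
    MonoidAlgebra Λ (Cent g) :=
  a.coeff.sum fun c r => if hc : (c : G) ∈ Cent g then MonoidAlgebra.single ⟨c, hc⟩ r else 0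

/-- Reduction `R H → (R / 𝔭) H` of the coefficients. -/
def reduction {R : Type v} [CommRing R] (𝔭 : Ideal R) (H : Type u) [Group H] :
    MonoidAlgebra R H →+* MonoidAlgebra (R ⧸ 𝔭) H :=
  MonoidAlgebra.mapRingHom H (Ideal.Quotient.mk 𝔭)

/-- The element `β_g(e)` of `R C_G(g)`: the sum of the block idempotents `f` of `R C_G(g)` whose
reductions are constituents of the central idempotent `Br_g(ē)` of `(R / 𝔭) C_G(g)`. -/
def betaIdem {R : Type v} [CommRing R] (𝔭 : Ideal R) (s g : G) (e : MonoidAlgebra R (Cent s)) :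
    MonoidAlgebra R (Cent g) :=
  ∑ᶠ f ∈ {f : MonoidAlgebra R (Cent g) | IsBlockIdempotent f ∧
    brauerMap (R ⧸ 𝔭) s g (reduction 𝔭 (Cent s) e) * reduction 𝔭 (Cent g) f =
      reduction 𝔭 (Cent g) f}, f

/-- `γ ∈ Irr(K H f)`: `γ` is the character of an irreducible representation of `H` over `K` on
which the central idempotent `f` of `R H` acts as the identity. -/
def IsIrrCharOf (K : Type v) [Field K] {R : Type v} [CommRing R] [Algebra R K] {H : Type u}
    [Group H] (f : MonoidAlgebra R H) (γ : H → K) : Prop :=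
  ∃ (n : ℕ) (ρ : Representation K H (Fin n → K)), ρ.IsIrreducible ∧ ρ.character = γ ∧
    ρ.asAlgebraHom (MonoidAlgebra.mapRingHom H (algebraMap R K) f) = 1

/-- The set `𝔅_G(s, e)` of the orbits of pairs `(g, γ)` such that `g_{p'} = s` and
`γ ∈ Irr(K C_G(g) β_g(e))`. -/
def blockOfPair (p : ℕ) {R : Type v} [CommRing R] (𝔭 : Ideal R) (K : Type v) [Field K]
    [Algebra R K] (P : BlPair p R G) : Set (MSet G K) :=
  {q | ∃ Q : IrrPair G K, Q.orbit = q ∧ IsPPrimePart p Q.g P.s ∧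
    IsIrrCharOf K (betaIdem 𝔭 P.s Q.g P.e) Q.γ}

/-- The `p`-blocks of `ℳ(G)`: the subsets formed, for some block idempotent `b` of
`R ⊗ K_G(G)`, by the orbits of the pairs such that `b` acts as the identity on the corresponding
simple (one-dimensional) module of `K ⊗ K_G(G)`. -/
def pBlocks (R : Type v) [CommRing R] (G : Type u) [Group G] [Fintype G] (K : Type v) [Field K]
    [Algebra R K] : Set (Set (MSet G K)) :=
  {B | ∃ b : R ⊗[ℤ] KGG G K, IsBlockIdempotent b ∧
    B = {q | ∃ (Q : IrrPair G K) (Ψ : K ⊗[ℤ] KGG G K →ₐ[K] K), Q.orbit = q ∧ IsPsi Q Ψ ∧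
      Ψ (Algebra.TensorProduct.map ((algebraMap R K).toIntAlgHom) (AlgHom.id ℤ (KGG G K)) b) = 1}}

end Blocks

end

/-! For g in G, sending a bundle V to the sum over x in C_G(g) of Tr(g | V_x) x is a ring
homomorphism from K_G(G) to the group algebra of C_G(g) (`phi`): g permutes the summands of a fibre
of a convolution, and only the summands it preserves contribute to the trace. By conjugation
invariance the image is central. Composing with the central character of γ gives a K-algebra
morphism `psi`, and computing it on an induced bundle yields the Fourier coefficient in the
statement. The maps `phi` together record the character of every C_G(x) on every fibre V_x, so they
are jointly injective. Hence K ⊗ K_G(G) is a product of copies of K indexed by ℳ(G), and its only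
characters are the `psi`.

Character values are integral, so over O the map lands in the centre of O C_G(g) (`phiO`). If s is
the p'-part of g, then Tr(g | V_x) and Tr(s | V_x) are congruent modulo 𝔭. Therefore the reduction
of `phiO` at g is the Brauer map applied to the reduction of `phiO` at s (`reduction_phiO`).
Commuting idempotents of a group algebra over O with the same reduction are equal
(`eq_of_reduction_eq`), so an idempotent b of O ⊗ K_G(G) is determined by its images in the centres
of the O C_G(s), with s running over the p'-elements up to conjugacy.

These images can be prescribed. Modulo 𝔭, every central element of O C_G(s) is the image of an
element of O ⊗ K_G(G) that vanishes at all other p'-classes (`exists_reduction_phiO_eq`). The input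
is an O-combination of irreducible characters that separates p'-classes with a value prime to p; it
comes from column orthogonality averaged over a Sylow subgroup (`exists_integral_combination`).
Since O ⊗ K_G(G) is finite over ℤ_p, idempotents lift (`exists_isIdempotentElem_sub_pow_mem`). So
each block idempotent e of O C_G(s) comes from a unique idempotent b that is e at s and zero at the
other p'-classes; b is primitive, and every block idempotent arises in this way.

Finally the image of this b at g is exactly β_g(e) (`betaIdem_eq`), so the pairs at which b takes
the value 1 are those of 𝔅_G(s, e) (`blockOfPair_eq`). -/

noncomputable section

/-! ### Group algebras -/

namespace MonoidAlgebra

section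

variable {R : Type*} [CommRing R] {H : Type*} [Group H]

theorem coeff_mul_eq_sum [Fintype H] (x y : MonoidAlgebra R H) (m : H) :
    (x * y).coeff m = ∑ a, x.coeff a * y.coeff (a⁻¹ * m) := by
  rw [coeff_mul_apply_left, Finsupp.sum_fintype _ _ (fun _ => by simp)]

theorem mem_center_iff {z : MonoidAlgebra R H} :
    z ∈ Subring.center (MonoidAlgebra R H) ↔ ∀ h x, z.coeff (h * x * h⁻¹) = z.coeff x := by
  rw [Subring.mem_center_iff]
  constructor
  · intro hz h x
    have := congrArg (fun w => w.coeff (h * x)) (hz (single h 1))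
    simp only [coeff_single_mul_apply, coeff_mul_single_apply] at this
    simpa using this.symm
  · intro hz w
    induction w using MonoidAlgebra.induction_linear with
    | zero => simp
    | add x y hx hy => rw [add_mul, mul_add, hx, hy]
    | single h r =>
      ext x
      rw [coeff_single_mul_apply, coeff_mul_single_apply, mul_comm, ← hz h]
      congr 2
      group

/-- The element of the group algebra of a finite group with given coefficients. -/
def ofFun [Finite H] (f : H → R) : MonoidAlgebra R H :=
  ofCoeff (Finsupp.equivFunOnFinite.symm f)

@[simp] theorem coeff_ofFun [Finite H] (f : H → R) (x : H) : (ofFun f).coeff x = f x := rfl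

end

end MonoidAlgebra

/-! ### Representations of finite groups over splitting fields -/

namespace Representation

variable {K : Type v} [Field K] {H : Type*} [Group H]

theorem asAlgebraHom_eq_sum [Fintype H] {V : Type*} [AddCommGroup V] [Module K V]
    (ρ : Representation K H V) (z : MonoidAlgebra K H) :
    ρ.asAlgebraHom z = ∑ h, z.coeff h • ρ h := by
  conv_lhs => rw [← MonoidAlgebra.sum_coeff_single z, Finsupp.sum_fintype _ _ (by simp)]
  simp

theorem IsIrreducible.of_equiv {V W : Type*} [AddCommGroup V] [Module K V] [AddCommGroup W]
    [Module K W] {ρ : Representation K H V} {σ : Representation K H W} (e : ρ.Equiv σ)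
    (h : ρ.IsIrreducible) : σ.IsIrreducible := by
  have hc : ∀ g v, σ g (e v) = e (ρ g v) :=
    fun g v => (IntertwiningMap.isIntertwining _ _ e.toIntertwiningMap g v).symm
  have hc' : ∀ g v, ρ g (e.symm v) = e.symm (σ g v) :=
    fun g v => (IntertwiningMap.isIntertwining _ _ e.symm.toIntertwiningMap g v).symm
  refine (OrderIso.isSimpleOrder_iff (β := Subrepresentation σ) (α := Subrepresentation ρ) ?_).1 h
  refine
    { toFun := fun S => ⟨S.toSubmodule.comap e.toLinearEquiv.symm.toLinearMap, fun g v hv => ?_⟩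
      invFun := fun S => ⟨S.toSubmodule.comap e.toLinearEquiv.toLinearMap, fun g v hv => ?_⟩
      left_inv := fun S => ?_
      right_inv := fun S => ?_
      map_rel_iff' := ?_ }
  · change e.symm (σ g v) ∈ S.toSubmodule
    rw [← hc']; exact S.apply_mem_toSubmodule g hv
  · change e (ρ g v) ∈ S.toSubmodule
    rw [← hc]; exact S.apply_mem_toSubmodule g hv
  · apply Subrepresentation.toSubmodule_injective
    ext v
    change e.symm (e v) ∈ S.toSubmodule ↔ _
    simp
  · apply Subrepresentation.toSubmodule_injective
    ext v
    change e (e.symm v) ∈ S.toSubmodule ↔ _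
    simp
  · intro S T
    constructor
    · intro hST v hv
      have := hST (x := e v) (show e.symm (e v) ∈ S by simpa using hv)
      have h2 : e.symm (e v) ∈ T := this
      simpa using h2
    · intro hST v hv
      exact hST hv

theorem asAlgebraHom_ofModule' (M : Type*) [AddCommGroup M] [Module K M]
    [Module (MonoidAlgebra K H) M] [IsScalarTower K (MonoidAlgebra K H) M]
    (z : MonoidAlgebra K H) (v : M) :
    (ofModule' (k := K) (G := H) M).asAlgebraHom z v = z • v := by
  rw [asAlgebraHom_def, ofModule', _root_.Equiv.apply_symm_apply]
  rfl

theorem IsIrreducible.ofModule' (M : Type*) [AddCommGroup M] [Module K M]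
    [Module (MonoidAlgebra K H) M] [IsScalarTower K (MonoidAlgebra K H) M]
    (h : IsSimpleModule (MonoidAlgebra K H) M) :
    (ofModule' (k := K) (G := H) M).IsIrreducible := by
  rw [irreducible_iff_isSimpleModule_asModule]
  let e : (Representation.ofModule' (k := K) (G := H) M).asModule ≃ₗ[MonoidAlgebra K H] M :=
    { (Representation.ofModule' (k := K) (G := H) M).asModuleEquiv.toAddEquiv with
      map_smul' := fun z v => asAlgebraHom_ofModule' M z _ }
  exact IsSimpleModule.congr e

/-- Irreducible characters are defined through representations on `Fin n → K`; choosing a basis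
brings abstract simple modules into that form. -/
theorem exists_equiv_fin {V : Type*} [AddCommGroup V] [Module K V] [FiniteDimensional K V]
    (ρ : Representation K H V) :
    ∃ (n : ℕ) (σ : Representation K H (Fin n → K)), Nonempty (ρ.Equiv σ) := by
  let e : V ≃ₗ[K] (Fin (Module.finrank K V) → K) := (Module.finBasis K V).equivFun
  refine ⟨_, ((LinearEquiv.conjRingEquiv e : _ ≃+* _) : _ →* _).comp ρ, ⟨Equiv.mk e fun g => ?_⟩⟩
  ext v
  simp [LinearEquiv.conjRingEquiv]

end Representation

/-! ### Central characters and the orthogonality relations. -/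

section Characters

open Representation MonoidAlgebra

variable {K : Type v} [Field K] {H : Type*} [Group H]

/-- The value at `z` of the central character attached to the character `γ`. -/
def centralChar [Fintype H] (γ : H → K) (z : MonoidAlgebra K H) : K :=
  (∑ x, z.coeff x * γ x) / γ 1

theorem Representation.IsIrreducible.finrank_ne_zero {V : Type*} [AddCommGroup V] [Module K V]
    [FiniteDimensional K V] {ρ : Representation K H V} (h : ρ.IsIrreducible) :
    Module.finrank K V ≠ 0 := by
  have : Nontrivial V := by
    by_contra hV
    rw [not_nontrivial_iff_subsingleton] at hV
    obtain ⟨a, b, hab⟩ := h.exists_pair_ne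
    exact hab (Subrepresentation.toSubmodule_injective (Subsingleton.elim _ _))
  exact Module.finrank_pos.ne'

theorem IsIrrChar.one_ne_zero [CharZero K] {γ : H → K} (h : IsIrrChar γ) : γ 1 ≠ 0 := by
  obtain ⟨n, ρ, hρ, rfl⟩ := h
  rw [char_one]
  exact_mod_cast hρ.finrank_ne_zero

theorem IsIrrChar.conj {γ : H → K} (h : IsIrrChar γ) (x y : H) : γ (x * y * x⁻¹) = γ y := by
  obtain ⟨n, ρ, hρ, rfl⟩ := h
  exact char_conj ρ y x

/-- Schur's lemma: a central element acts by an intertwining map, which is a scalar by splitness.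
Taking traces identifies the scalar, since `ρ.character 1` is nonzero in characteristic zero. -/
theorem asAlgebraHom_of_mem_center [Fintype H] [CharZero K] (hs : IsSplitGroupAlgebra K H) {n : ℕ}
    {ρ : Representation K H (Fin n → K)} (hρ : ρ.IsIrreducible) {z : MonoidAlgebra K H}
    (hz : z ∈ Subring.center (MonoidAlgebra K H)) :
    ρ.asAlgebraHom z = centralChar ρ.character z • 1 := by
  have hz' : z ∈ Submonoid.center (MonoidAlgebra K H) := hz
  obtain ⟨c, hc⟩ := (hs n ρ hρ).2 (IntertwiningMap.centralAlgebraMul ρ hz')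
  have h1 : ρ.asAlgebraHom z = c • 1 := by
    exact LinearMap.ext fun v => (congrArg (fun f => f v) hc).symm
  have h2 : c * ρ.character 1 = ∑ x, z.coeff x * ρ.character x := by
    have := congrArg (LinearMap.trace K _) h1
    rw [asAlgebraHom_eq_sum] at this
    simpa [char_one, character] using this.symm
  rw [h1, centralChar, ← h2, mul_div_cancel_right₀ _ (IsIrrChar.one_ne_zero ⟨n, ρ, hρ, rfl⟩)]

theorem centralChar_mul [Fintype H] [CharZero K] (hs : IsSplitGroupAlgebra K H) {γ : H → K}
    (hγ : IsIrrChar γ) {y z : MonoidAlgebra K H}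
    (hy : y ∈ Subring.center (MonoidAlgebra K H)) (hz : z ∈ Subring.center (MonoidAlgebra K H)) :
    centralChar γ (y * z) = centralChar γ y * centralChar γ z := by
  obtain ⟨n, ρ, hρ, rfl⟩ := hγ
  have hn : n ≠ 0 := by simpa using hρ.finrank_ne_zero
  have := asAlgebraHom_of_mem_center hs hρ (mul_mem hy hz)
  rw [map_mul, asAlgebraHom_of_mem_center hs hρ hy, asAlgebraHom_of_mem_center hs hρ hz,
    smul_mul_smul_comm, mul_one] at this
  -- Two equal scalar operators are compared on one coordinate of the constant vector 1; the
  -- coordinate 0 exists because `n ≠ 0`.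
  have h2 := congrFun (LinearMap.congr_fun this (fun _ => 1)) ⟨0, Nat.pos_of_ne_zero hn⟩
  simpa using h2.symm

theorem centralChar_one [Fintype H] [CharZero K] {γ : H → K} (hγ : IsIrrChar γ) :
    centralChar γ (1 : MonoidAlgebra K H) = 1 := by
  classical
  simp [centralChar, one_def, Finsupp.single_apply, hγ.one_ne_zero]

theorem centralChar_add [Fintype H] (γ : H → K) (y z : MonoidAlgebra K H) :
    centralChar γ (y + z) = centralChar γ y + centralChar γ z := by
  simp [centralChar, add_mul, Finset.sum_add_distrib, add_div]

theorem centralChar_smul [Fintype H] (γ : H → K) (c : K) (z : MonoidAlgebra K H) :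
    centralChar γ (c • z) = c * centralChar γ z := by
  simp [centralChar, mul_assoc, ← Finset.mul_sum, mul_div_assoc]

/-- An element of the group algebra that acts as zero on every irreducible representation is
zero. -/
theorem eq_zero_of_forall_asAlgebraHom [Fintype H] [CharZero K] {z : MonoidAlgebra K H}
    (h : ∀ (n : ℕ) (ρ : Representation K H (Fin n → K)), ρ.IsIrreducible →
      ρ.asAlgebraHom z = 0) : z = 0 := by
  -- With |H| invertible, Maschke's theorem makes the regular module a sum of simple submodules, on
  -- each of which `z` vanishes.
  have : NeZero (Nat.card H : K) := ⟨by exact_mod_cast Nat.card_pos.ne'⟩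
  have : Module.Finite K (MonoidAlgebra K H) :=
    Module.Finite.equiv ((MonoidAlgebra.coeffLinearEquiv K).symm : (H →₀ K) ≃ₗ[K] _)
  have key : ∀ S : Submodule (MonoidAlgebra K H) (MonoidAlgebra K H),
      IsSimpleModule (MonoidAlgebra K H) S → ∀ v : S, z • v = 0 := by
    intro S hS v
    have hirr := IsIrreducible.ofModule' S hS
    have : FiniteDimensional K S := Module.Finite.trans (MonoidAlgebra K H) _
    obtain ⟨n, σ, ⟨e⟩⟩ := exists_equiv_fin (ofModule' (k := K) (G := H) S)
    have h0 := h n σ (hirr.of_equiv e)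
    have h1 : ∀ w, e ((ofModule' (k := K) (G := H) S).asAlgebraHom z w) =
        σ.asAlgebraHom z (e w) := fun w => by
      rw [asAlgebraHom_eq_sum, asAlgebraHom_eq_sum]
      simp only [LinearMap.sum_apply, map_sum, LinearMap.smul_apply, map_smul]
      exact Finset.sum_congr rfl fun g _ => congrArg _
        (IntertwiningMap.isIntertwining _ _ e.toIntertwiningMap g w)
    have h2 := h1 v
    rw [h0, LinearMap.zero_apply, ← map_zero e, asAlgebraHom_ofModule'] at h2
    exact e.toLinearEquiv.injective h2
  have htop := IsSemisimpleModule.sSup_simples_eq_top (MonoidAlgebra K H) (MonoidAlgebra K H)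
  -- The quantifier over `a` makes this annihilation condition stable under left multiplication, so
  -- it passes from the generators to their span.
  have hle : (⊤ : Submodule (MonoidAlgebra K H) (MonoidAlgebra K H)) ≤
      Submodule.span _ {v | ∀ a : MonoidAlgebra K H, z * (a * v) = 0} := by
    rw [← htop]
    refine sSup_le fun S hS v hv => Submodule.subset_span fun a => ?_
    exact congrArg Subtype.val (key S hS ⟨a * v, S.smul_mem a hv⟩)
  have h1 : (1 : MonoidAlgebra K H) ∈ Submodule.span (MonoidAlgebra K H)
      {v | ∀ a : MonoidAlgebra K H, z * (a * v) = 0} := hle trivial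
  have : ∀ v ∈ Submodule.span (MonoidAlgebra K H)
      {v | ∀ a : MonoidAlgebra K H, z * (a * v) = 0}, ∀ a, z * (a * v) = 0 := by
    intro v hv
    induction hv using Submodule.span_induction with
    | mem v hv => exact hv
    | zero => simp
    | add x y _ _ hx hy => intro a; rw [mul_add, mul_add, hx, hy, add_zero]
    | smul b x _ hx => intro a; rw [smul_eq_mul, ← mul_assoc a]; exact hx _
  simpa using this 1 h1 1

theorem eq_zero_of_forall_centralChar [Fintype H] [CharZero K] (hs : IsSplitGroupAlgebra K H)
    {z : MonoidAlgebra K H} (hz : z ∈ Subring.center (MonoidAlgebra K H))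
    (h : ∀ γ : H → K, IsIrrChar γ → centralChar γ z = 0) : z = 0 :=
  eq_zero_of_forall_asAlgebraHom fun n ρ hρ => by
    rw [asAlgebraHom_of_mem_center hs hρ hz, h _ ⟨n, ρ, hρ, rfl⟩, zero_smul]

/-- The dimension of the space of intertwining maps depends only on the characters, so it is the
same from ρ to σ as from ρ to itself, where the identity makes it nonzero. By Schur, inequivalent
irreducibles would give dimension zero. Splitness is not involved. -/
theorem nonempty_equiv_of_character_eq [Fintype H] [CharZero K] {n m : ℕ}
    {ρ : Representation K H (Fin n → K)} {σ : Representation K H (Fin m → K)}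
    (hρ : ρ.IsIrreducible) (hσ : σ.IsIrreducible) (h : ρ.character = σ.character) :
    Nonempty (ρ.Equiv σ) := by
  have : Invertible (Nat.card H : K) :=
    invertibleOfNonzero (by exact_mod_cast Nat.card_pos.ne')
  by_contra h0
  rw [not_nonempty_iff] at h0
  have h1 := card_inv_mul_sum_char_mul_char_eq_finrank ρ σ
  have h2 := card_inv_mul_sum_char_mul_char_eq_finrank ρ ρ
  rw [← h, h2, Module.finrank_zero_of_subsingleton (M := IntertwiningMap ρ σ), Nat.cast_inj] at h1
  have : Nontrivial (IntertwiningMap ρ ρ) := by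
    refine ⟨1, 0, fun h => hρ.finrank_ne_zero ?_⟩
    have : Subsingleton (Fin n → K) := ⟨fun a b => by
      have ha := congrArg (fun f => f a) h
      have hb := congrArg (fun f => f b) h
      exact (show a = 0 from ha).trans (show b = 0 from hb).symm⟩
    exact Module.finrank_zero_of_subsingleton
  exact Module.finrank_pos.ne' h1

/-- The pairing is the dimension of a space of intertwining maps; splitness makes this dimension
exactly 1 on the diagonal. -/
theorem char_inner_eq_ite [Fintype H] [CharZero K] (hs : IsSplitGroupAlgebra K H) {γ η : H → K}
    (hγ : IsIrrChar γ) (hη : IsIrrChar η) [Decidable (γ = η)] :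
    (Nat.card H : K)⁻¹ * ∑ h, γ h * η h⁻¹ = if γ = η then 1 else 0 := by
  have : Invertible (Nat.card H : K) :=
    invertibleOfNonzero (by exact_mod_cast Nat.card_pos.ne')
  obtain ⟨n, ρ, hρ, rfl⟩ := hγ
  obtain ⟨m, σ, hσ, rfl⟩ := hη
  split_ifs with h
  · rw [← h, card_inv_mul_sum_char_mul_char_eq_finrank, LinearEquiv.finrank_eq
      (LinearEquiv.ofBijective (Algebra.linearMap K (IntertwiningMap ρ ρ)) (hs n ρ hρ)).symm,
      Module.finrank_self, Nat.cast_one]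
  · rw [card_inv_mul_sum_char_mul_char_eq_finrank]
    have : IsEmpty (Equiv σ ρ) := ⟨fun e => h (char_iso e).symm⟩
    rw [Module.finrank_zero_of_subsingleton, Nat.cast_zero]

variable (K H) in
/-- The irreducible characters of `H` over `K`. -/
abbrev IrrChar : Type _ := {γ : H → K // IsIrrChar γ}

theorem linearIndependent_irrChar [Fintype H] [CharZero K] (hs : IsSplitGroupAlgebra K H) :
    LinearIndependent K (fun γ : IrrChar K H => γ.1) := by
  classical
  rw [linearIndependent_iff']
  intro s c hc η hη
  have := congrArg (fun f : H → K => (Nat.card H : K)⁻¹ * ∑ h, f h * η.1 h⁻¹) hc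
  simp only [Finset.sum_apply, Pi.smul_apply, smul_eq_mul, Finset.sum_mul, Pi.zero_apply, zero_mul,
    Finset.sum_const_zero, mul_zero] at this
  rw [Finset.sum_comm, Finset.mul_sum] at this
  rw [← this, Finset.sum_eq_single η]
  · simp only [mul_assoc, ← Finset.mul_sum]
    rw [mul_left_comm, char_inner_eq_ite hs η.2 η.2, if_pos rfl, mul_one]
  · intro γ _ hγ
    simp only [mul_assoc, ← Finset.mul_sum]
    rw [mul_left_comm, char_inner_eq_ite hs γ.2 η.2, if_neg (fun h => hγ (Subtype.ext h)), mul_zero]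
  · exact fun h => absurd hη h

theorem finite_irrChar [Fintype H] [CharZero K] (hs : IsSplitGroupAlgebra K H) :
    Finite (IrrChar K H) :=
  (linearIndependent_irrChar hs).finite

/-- A class function is the sum of the irreducible characters weighted by its inner products
with them. -/
theorem class_function_eq_sum [Fintype H] [CharZero K] (hs : IsSplitGroupAlgebra K H)
    [Fintype (IrrChar K H)] {f : H → K} (hf : ∀ x y, f (x * y * x⁻¹) = f y) (y : H) :
    f y = ∑ γ : IrrChar K H, ((Nat.card H : K)⁻¹ * ∑ h, f h * γ.1 h⁻¹) * γ.1 y := by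
  classical
  -- The defect `f'` is a class function orthogonal to every irreducible character; it must be shown
  -- to vanish.
  set f' : H → K := fun y => f y -
    ∑ γ : IrrChar K H, ((Nat.card H : K)⁻¹ * ∑ h, f h * γ.1 h⁻¹) * γ.1 y with hf'
  have hcl : ∀ x y, f' (x * y * x⁻¹) = f' y := fun x y => by
    simp only [hf', hf, fun γ : IrrChar K H => γ.2.conj x y]
  have horth : ∀ η : IrrChar K H, (Nat.card H : K)⁻¹ * ∑ h, f' h * η.1 h⁻¹ = 0 := by
    intro η
    simp only [hf', sub_mul, Finset.sum_sub_distrib, mul_sub, Finset.sum_mul]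
    rw [Finset.sum_comm, Finset.mul_sum (s := Finset.univ) (a := (Nat.card H : K)⁻¹)
      (f := fun γ : IrrChar K H => _), Finset.sum_eq_single η, sub_eq_zero]
    · simp only [mul_assoc, ← Finset.mul_sum]
      rw [mul_left_comm _ (∑ h, f h * η.1 h⁻¹), char_inner_eq_ite hs η.2 η.2, if_pos rfl, mul_one]
    · intro γ _ hγ
      simp only [mul_assoc, ← Finset.mul_sum]
      rw [mul_left_comm _ (∑ h, f h * γ.1 h⁻¹), char_inner_eq_ite hs γ.2 η.2,
        if_neg (fun h => hγ (Subtype.ext h)), mul_zero, mul_zero]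
    · exact fun h => absurd (Finset.mem_univ _) h
  have hcard : (Nat.card H : K) ≠ 0 := by exact_mod_cast Nat.card_pos.ne'
  -- The inversion turns orthogonality to each γ into the vanishing of the corresponding central
  -- character, and central characters separate the centre.
  have hz : (ofFun fun x => f' x⁻¹) = 0 := by
    refine eq_zero_of_forall_centralChar hs (mem_center_iff.2 fun h x => ?_) fun γ hγ => ?_
    · simp only [coeff_ofFun]
      rw [← hcl h x⁻¹]
      congr 1
      group
    · have := (mul_eq_zero.1 (horth ⟨γ, hγ⟩)).resolve_left (inv_ne_zero hcard)
      rw [centralChar, div_eq_zero_iff]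
      left
      rw [← this]
      refine Fintype.sum_equiv (Equiv.inv H) _ _ fun x => ?_
      simp
  have := congrArg (fun z => z.coeff y⁻¹) hz
  simp only [coeff_ofFun, inv_inv, coeff_zero, Finsupp.coe_zero, Pi.zero_apply, hf'] at this
  exact sub_eq_zero.1 this

/-- The solutions form the coset of the centralizer of `a` through the given solution `c`. -/
theorem card_filter_conj_eq [Fintype H] [DecidableEq H] {a b c : H} (hc : c * a * c⁻¹ = b) :
    (Finset.univ.filter fun x : H => x * a * x⁻¹ = b).card =
      Nat.card (Subgroup.centralizer {a}) := by
  classical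
  rw [Nat.card_eq_fintype_card, ← Fintype.card_coe]
  refine Fintype.card_congr
    { toFun := fun x => ⟨c⁻¹ * x.1, ?_⟩
      invFun := fun x => ⟨c * x.1, ?_⟩
      left_inv := fun x => by simp
      right_inv := fun x => by simp }
  · have hx : x.1 * a * x.1⁻¹ = b := (Finset.mem_filter.1 x.2).2
    rw [Subgroup.mem_centralizer_singleton_iff]
    have h3 : x.1 * a = c * a * c⁻¹ * x.1 := by
      rw [hc]
      exact (mul_inv_eq_iff_eq_mul.1 hx)
    rw [mul_assoc, h3]; group
  · have hx := Subgroup.mem_centralizer_singleton_iff.1 x.2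
    simp only [Finset.mem_filter, Finset.mem_univ, true_and]
    rw [mul_assoc c, hx, ← hc]; group

/-- Column orthogonality. -/
theorem sum_irrChar_mul [Fintype H] [CharZero K] (hs : IsSplitGroupAlgebra K H)
    [Fintype (IrrChar K H)] (a b : H) [Decidable (IsConj a b)] :
    ∑ γ : IrrChar K H, γ.1 a⁻¹ * γ.1 b =
      if IsConj a b then (Nat.card (Subgroup.centralizer {a}) : K) else 0 := by
  classical
  have hcard : (Nat.card H : K) ≠ 0 := by exact_mod_cast Nat.card_pos.ne'
  -- The class function to expand counts the x that conjugate a to y; its inner product with γ is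
  -- γ(a⁻¹), so the expansion at b is the wanted sum.
  have h := class_function_eq_sum hs
    (f := fun y => ∑ x : H, if x * a * x⁻¹ = y then (1 : K) else 0) (fun x y => by
      refine Fintype.sum_equiv (Equiv.mulLeft x⁻¹) _ _ fun z => ?_
      have : z * a * z⁻¹ = x * y * x⁻¹ ↔ x⁻¹ * z * a * (x⁻¹ * z)⁻¹ = y := by
        constructor
        · intro h
          calc _ = x⁻¹ * (z * a * z⁻¹) * x := by group
            _ = _ := by rw [h]; group
        · rintro rfl
          group
      simp only [Equiv.coe_mulLeft, this]
      congr) b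
  have h2 : ∀ γ : IrrChar K H, (Nat.card H : K)⁻¹ *
      ∑ h, (∑ x : H, if x * a * x⁻¹ = h then (1 : K) else 0) * γ.1 h⁻¹ = γ.1 a⁻¹ := by
    intro γ
    simp only [Finset.sum_mul, ite_mul, one_mul, zero_mul]
    rw [Finset.sum_comm]
    simp only [Finset.sum_ite_eq, Finset.mem_univ, if_true]
    have : ∀ x, γ.1 (x * a * x⁻¹)⁻¹ = γ.1 a⁻¹ := fun x => by
      rw [← γ.2.conj x a⁻¹]; group
    simp only [this, Finset.sum_const, nsmul_eq_mul, Finset.card_univ, ← Nat.card_eq_fintype_card]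
    rw [← mul_assoc, inv_mul_cancel₀ hcard, one_mul]
  simp only [h2] at h
  rw [← h]
  split_ifs with hab
  · obtain ⟨c, hc⟩ := isConj_iff.1 hab
    rw [Finset.sum_boole, Nat.cast_inj, card_filter_conj_eq hc]
  · refine Finset.sum_eq_zero fun x _ => if_neg fun hx => hab (isConj_iff.2 ⟨x, hx⟩)

end Characters

/-! ### Traces on equivariant bundles -/

section TraceLemmas

variable {K : Type*} [Field K]

/-- Insert the decomposition of the identity into `lof ∘ component` and use the cyclicity of the
trace on each summand. -/
theorem LinearMap.trace_directSum {ι : Type*} [Fintype ι] [DecidableEq ι] (M : ι → Type*)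
    [∀ i, AddCommGroup (M i)] [∀ i, Module K (M i)] [∀ i, Module.Finite K (M i)]
    (T : (⨁ i, M i) →ₗ[K] ⨁ i, M i) :
    trace K _ T = ∑ i, trace K (M i)
      (DirectSum.component K ι M i ∘ₗ T ∘ₗ DirectSum.lof K ι M i) := by
  have hid : (LinearMap.id : (⨁ i, M i) →ₗ[K] ⨁ i, M i) =
      ∑ i, DirectSum.lof K ι M i ∘ₗ DirectSum.component K ι M i := by
    refine DirectSum.linearMap_ext K fun j => LinearMap.ext fun m => ?_
    simp only [LinearMap.comp_apply, LinearMap.id_apply, LinearMap.sum_apply]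
    rw [Finset.sum_eq_single j]
    · rw [DirectSum.component.lof_self]
    · intro i _ hij
      rw [DirectSum.component.of, dif_neg (Ne.symm hij), map_zero]
    · simp
  conv_lhs => rw [← LinearMap.comp_id T, hid]
  have hsum : T ∘ₗ (∑ i, DirectSum.lof K ι M i ∘ₗ DirectSum.component K ι M i) =
      ∑ i, (T ∘ₗ DirectSum.lof K ι M i) ∘ₗ DirectSum.component K ι M i := by
    ext1; ext1; simp
  rw [hsum, map_sum]
  exact Finset.sum_congr rfl fun i _ => LinearMap.trace_comp_comm' _ _

/-- A linear splitting, not required to commute with `T`, writes the identity of V as `i ∘ r + t ∘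
q`; cyclicity moves `r` and `q` to the left, where they turn `T` into `T'` and `T''`. -/
theorem LinearMap.trace_eq_add_of_exact {V' V V'' : Type*} [AddCommGroup V'] [Module K V']
    [AddCommGroup V] [Module K V] [AddCommGroup V''] [Module K V''] [Module.Finite K V']
    [Module.Finite K V] [Module.Finite K V''] {i : V' →ₗ[K] V} {q : V →ₗ[K] V''}
    (hi : Function.Injective i) (hq : Function.Surjective q)
    (hiq : LinearMap.range i = LinearMap.ker q) {T' : V' →ₗ[K] V'} {T : V →ₗ[K] V}
    {T'' : V'' →ₗ[K] V''} (h' : ∀ v, T (i v) = i (T' v)) (h'' : ∀ v, T'' (q v) = q (T v)) :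
    trace K V T = trace K V' T' + trace K V'' T'' := by
  obtain ⟨t, ht⟩ := q.exists_rightInverse_of_surjective (LinearMap.range_eq_top.2 hq)
  obtain ⟨r₀, hr₀⟩ := i.exists_leftInverse_of_injective (LinearMap.ker_eq_bot.2 hi)
  have htq : ∀ v, q (t v) = v := fun v => LinearMap.congr_fun ht v
  have hri : ∀ v, r₀ (i v) = v := fun v => LinearMap.congr_fun hr₀ v
  have hqi : ∀ v, q (i v) = 0 := fun v =>
    LinearMap.mem_ker.1 (hiq ▸ LinearMap.mem_range_self i v)
  -- An arbitrary retraction `r₀` is corrected so as to vanish on the image of `t`; only then does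
  -- `i ∘ r + t ∘ q` equal the identity.
  obtain ⟨r, hr⟩ : ∃ r : V →ₗ[K] V', r = r₀ ∘ₗ (LinearMap.id - t ∘ₗ q) := ⟨_, rfl⟩
  have hri' : ∀ v, r (i v) = v := fun v => by simp [hr, hqi, hri]
  have hid : i ∘ₗ r + t ∘ₗ q = LinearMap.id := by
    ext v
    have : v - t (q v) ∈ LinearMap.range i := by
      rw [hiq, LinearMap.mem_ker, map_sub, htq, sub_self]
    obtain ⟨w, hw⟩ := this
    simp only [hr, LinearMap.add_apply, LinearMap.comp_apply, LinearMap.sub_apply,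
      LinearMap.id_apply, ← hw, hri]
    rw [hw, sub_add_cancel]
  conv_lhs => rw [← LinearMap.comp_id T, ← hid]
  rw [LinearMap.comp_add, map_add, ← LinearMap.comp_assoc, ← LinearMap.comp_assoc,
    LinearMap.trace_comp_comm' r, LinearMap.trace_comp_comm' q]
  congr 2
  · ext v; simp [h', hri']
  · ext v; simp [← h'', htq]

end TraceLemmas

namespace EqBundle

variable {G : Type u} {K : Type v} [Group G] [Field K]

open scoped Classical in
/-- The trace of `g` on the fibre at `x`, defined to be `0` if `g` does not commute with `x`. -/
def tr (V : EqBundle G K) (g x : G) : K :=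
  if h : g * x * g⁻¹ = x then LinearMap.trace K (V.fibre x) (V.act g h) else 0

theorem tr_eq (V : EqBundle G K) {g x : G} (h : g * x * g⁻¹ = x) :
    V.tr g x = LinearMap.trace K (V.fibre x) (V.act g h) := dif_pos h

theorem tr_eq_zero (V : EqBundle G K) {g x : G} (h : ¬ g * x * g⁻¹ = x) : V.tr g x = 0 :=
  dif_neg h

theorem tr_shortExact {V' V V'' : EqBundle G K} (h : ShortExact V' V V'') (g x : G) :
    V.tr g x = V'.tr g x + V''.tr g x := by
  obtain ⟨i, q, H⟩ := h
  by_cases hx : g * x * g⁻¹ = x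
  · rw [tr_eq _ hx, tr_eq _ hx, tr_eq _ hx]
    exact LinearMap.trace_eq_add_of_exact (H x).1 (H x).2.1 (H x).2.2
      (fun v => (i.comm g hx v).symm) (fun v => (q.comm g hx v).symm)
  · simp [tr_eq_zero _ hx]

theorem tr_iso {V W : EqBundle G K} (h : Iso V W) (g x : G) : V.tr g x = W.tr g x := by
  obtain ⟨f, f', h1, h2⟩ := h
  by_cases hx : g * x * g⁻¹ = x
  · rw [tr_eq _ hx, tr_eq _ hx]
    have : V.act g hx = f'.map x ∘ₗ (W.act g hx ∘ₗ f.map x) := by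
      ext v
      simp [← f.comm, h1]
    rw [this, LinearMap.trace_comp_comm', LinearMap.comp_assoc]
    congr 1
    ext w
    simp [h2]
  · simp [tr_eq_zero _ hx]

theorem tr_conj (V : EqBundle G K) (y g x : G) :
    V.tr (y * g * y⁻¹) (y * x * y⁻¹) = V.tr g x := by
  by_cases hx : g * x * g⁻¹ = x
  · have hx' : y * g * y⁻¹ * (y * x * y⁻¹) * (y * g * y⁻¹)⁻¹ = y * x * y⁻¹ := by
      calc _ = y * (g * x * g⁻¹) * y⁻¹ := by group
        _ = _ := by rw [hx]
    rw [tr_eq _ hx, tr_eq _ hx']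
    have e : y⁻¹ * (y * x * y⁻¹) * y⁻¹⁻¹ = x := by group
    have hgy : y * g * x * (y * g)⁻¹ = y * x * y⁻¹ := by
      calc _ = y * (g * x * g⁻¹) * y⁻¹ := by group
        _ = _ := by rw [hx]
    have h1 : V.act (y * g * y⁻¹) hx' = (V.act y rfl ∘ₗ V.act g hx) ∘ₗ V.act y⁻¹ e := by
      ext v
      rw [V.act_mul (g := y * g) (g' := y⁻¹) e hgy, V.act_mul hx rfl]
      rfl
    rw [h1, LinearMap.trace_comp_comm']
    congr 1
    ext v
    simp only [LinearMap.comp_apply]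
    rw [← V.act_mul (g := y⁻¹) (g' := y) rfl e (by group)]
    have : ∀ (t : G) (ht : t = 1) (h : t * x * t⁻¹ = x) (v : V.fibre x), V.act t h v = v := by
      rintro t rfl h v; exact V.act_one h v
    exact this _ (by group) _ _
  · have hx' : ¬ y * g * y⁻¹ * (y * x * y⁻¹) * (y * g * y⁻¹)⁻¹ = y * x * y⁻¹ := by
      intro h
      apply hx
      calc g * x * g⁻¹ = y⁻¹ * (y * g * y⁻¹ * (y * x * y⁻¹) * (y * g * y⁻¹)⁻¹) * y := by group
        _ = x := by rw [h]; group
    rw [tr_eq_zero _ hx, tr_eq_zero _ hx']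

variable [Fintype G]

/-- The element g carries the summand V_x ⊗ W_y to the one at the conjugate pair, so only the pairs
centralized by g give diagonal blocks, and there the trace of a tensor product is the product of the
traces. The convention that `tr` vanishes off the centralizer lets the sum run over all of G. -/
theorem tr_conv (V W : EqBundle G K) (g z : G) :
    (conv V W).tr g z = ∑ x, V.tr g x * W.tr g (x⁻¹ * z) := by
  classical
  by_cases hz : g * z * g⁻¹ = z
  · rw [tr_eq _ hz]
    have h0 := LinearMap.trace_directSum
      (fun i : {i : G × G // i.1 * i.2 = z} => V.fibre i.1.1 ⊗[K] W.fibre i.1.2) (convAct V W g hz)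
    have h1 : LinearMap.trace K _ ((conv V W).act g hz) = LinearMap.trace K
        (⨁ i : {i : G × G // i.1 * i.2 = z}, V.fibre i.1.1 ⊗[K] W.fibre i.1.2)
          (convAct V W g hz) := by
      rfl
    rw [h1]
    have h2 : ∀ i : {i : G × G // i.1 * i.2 = z},
        LinearMap.trace K (V.fibre i.1.1 ⊗[K] W.fibre i.1.2)
          (DirectSum.component K _ (fun i : {i : G × G // i.1 * i.2 = z} =>
              V.fibre i.1.1 ⊗[K] W.fibre i.1.2) i ∘ₗ convAct V W g hz ∘ₗ
            DirectSum.lof K _ (fun i : {i : G × G // i.1 * i.2 = z} =>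
              V.fibre i.1.1 ⊗[K] W.fibre i.1.2) i) =
        V.tr g i.1.1 * W.tr g i.1.2 := by
      rintro ⟨⟨x, y⟩, hxy⟩
      by_cases hx : g * x * g⁻¹ = x
      · have hy : g * y * g⁻¹ = y := by
          have : y = x⁻¹ * z := by rw [← hxy]; group
          rw [this]
          calc g * (x⁻¹ * z) * g⁻¹ = (g * x * g⁻¹)⁻¹ * (g * z * g⁻¹) := by group
            _ = _ := by rw [hx, hz]
        rw [tr_eq _ hx, tr_eq _ hy, ← LinearMap.trace_tensorProduct']
        congr 1
        refine TensorProduct.ext' fun v w => ?_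
        have := convAct_cmk V W g hz hxy hx hy hxy v w
        simp only [LinearMap.comp_apply, TensorProduct.map_tmul]
        refine (congrArg (DirectSum.component K _ _ ⟨(x, y), hxy⟩) this).trans ?_
        exact DirectSum.component.lof_self _ _ _
      · rw [tr_eq_zero _ hx, zero_mul]
        refine (congrArg _ ?_).trans (map_zero (LinearMap.trace K _))
        refine TensorProduct.ext' fun v w => ?_
        have := convAct_cmk V W g hz hxy rfl rfl (conj_mul_conj hxy hz) v w
        simp only [LinearMap.comp_apply, LinearMap.zero_apply]
        refine (congrArg (DirectSum.component K _ _ ⟨(x, y), hxy⟩) this).trans ?_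
        refine (DirectSum.component.of _ _ _ _).trans (dif_neg fun h => hx ?_)
        exact congrArg (fun i => i.1.1) h
    rw [h0, Finset.sum_congr rfl fun i _ => h2 i]
    refine Fintype.sum_equiv
      { toFun := fun i => i.1.1
        invFun := fun x => ⟨(x, x⁻¹ * z), by group⟩
        left_inv := ?_
        right_inv := fun x => rfl } _ _ ?_
    · rintro ⟨⟨x, y⟩, rfl⟩; simp
    · rintro ⟨⟨x, y⟩, rfl⟩; simp
  · rw [tr_eq_zero _ hz]
    -- If g does not centralize z, it cannot centralize both x and x⁻¹ z, so every term has a zero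
    -- factor.
    refine (Finset.sum_eq_zero fun x _ => ?_).symm
    by_cases hx : g * x * g⁻¹ = x
    · rw [tr_eq_zero W, mul_zero]
      intro hy
      apply hz
      calc g * z * g⁻¹ = g * x * g⁻¹ * (g * (x⁻¹ * z) * g⁻¹) := by group
        _ = z := by rw [hx, hy]; group
    · rw [tr_eq_zero V hx, zero_mul]

theorem tr_unit (g x : G) [Decidable (x = 1)] :
    (unit G K).tr g x = if x = 1 then 1 else 0 := by
  split_ifs with hx
  · subst hx
    have h : g * 1 * g⁻¹ = 1 := by group
    rw [tr_eq _ h]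
    have h1 : (unit G K).act g h = LinearMap.id := LinearMap.ext fun f => rfl
    rw [h1, LinearMap.trace_id]
    have : Module.finrank K ((unit G K).fibre 1) = 1 := by
      have : Unique (ULift.{u} (PLift ((1 : G) = 1))) := ⟨⟨⟨⟨rfl⟩⟩⟩, fun _ => rfl⟩
      exact (Module.finrank_fintype_fun_eq_card K).trans (Fintype.card_unique)
    rw [this, Nat.cast_one]
  · by_cases h : g * x * g⁻¹ = x
    · rw [tr_eq _ h]
      refine (congrArg _ (LinearMap.ext fun f => ?_)).trans (map_zero (LinearMap.trace K _))
      exact unit_eq_zero hx _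
    · exact tr_eq_zero _ h

/-! ### Traces on induced bundles. -/

section Ind

variable (h : G) {E : Type v} [AddCommGroup E] [Module K E] [Module.Finite K E]
  (ρ : Representation K (Cent h) E)

/-- Evaluation at `x` identifies the fibre of `ind h ρ` at `x h x⁻¹` with `E`. -/
def indEval (x : G) {y : G} (hx : x * h * x⁻¹ = y) : (ind h ρ).fibre y ≃ₗ[K] E where
  toFun f := f.1 ⟨x, hx⟩
  map_add' _ _ := rfl
  map_smul' _ _ := rfl
  invFun v := ⟨fun x' => ρ ⟨x'.1⁻¹ * x, by
      rw [Subgroup.mem_centralizer_singleton_iff]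
      have h1 := x'.2
      have h2 : x * h = x'.1 * h * x'.1⁻¹ * x := by rw [h1, ← hx]; group
      rw [mul_assoc, h2]; group⟩ v, fun x₁ x₂ c hc => by
      rw [← Module.End.mul_apply, ← map_mul]
      refine congrArg (fun c => ρ c v) (Subtype.ext ?_)
      simp [hc, mul_assoc]⟩
  left_inv f := by
    refine Subtype.ext (funext fun x' => ?_)
    refine (f.2 ⟨x, hx⟩ x' ⟨x⁻¹ * x'.1, ?_⟩ (by simp)).symm ▸ ?_
    · rw [Subgroup.mem_centralizer_singleton_iff]
      have h1 := x'.2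
      have h2 : x'.1 * h = x * h * x⁻¹ * x'.1 := by
        rw [hx]; exact mul_inv_eq_iff_eq_mul.1 h1
      rw [mul_assoc, h2]; group
    · refine congrArg (fun c => ρ c _) (Subtype.ext ?_)
      simp
  right_inv v := by
    have : (⟨x⁻¹ * x, by simp⟩ : Cent h) = 1 := by ext; simp
    change ρ ⟨x⁻¹ * x, _⟩ v = v
    rw [this, map_one]
    rfl

theorem indEval_act (g x : G) {y : G} (hx : x * h * x⁻¹ = y) (hg : g * y * g⁻¹ = y)
    (hc : x⁻¹ * g * x ∈ Cent h) (f : (ind h ρ).fibre y) :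
    indEval h ρ x hx ((ind h ρ).act g hg f) = ρ ⟨x⁻¹ * g * x, hc⟩ (indEval h ρ x hx f) := by
  refine (f.2 ⟨x, hx⟩ _ (⟨x⁻¹ * g * x, hc⟩⁻¹ : Cent h) ?_).trans ?_
  · simp [mul_assoc]
  · rw [inv_inv]; rfl

/-- Each fibre over the class of h is a single copy of E, on which g acts through x⁻¹ g x; hence
there is no sum over cosets as for an ordinary induced character. -/
theorem tr_ind (g x : G) :
    (ind h ρ).tr g (x * h * x⁻¹) = extZero ρ.character (x⁻¹ * g * x) := by
  by_cases hc : x⁻¹ * g * x ∈ Cent h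
  · have hg : g * (x * h * x⁻¹) * g⁻¹ = x * h * x⁻¹ := by
      have := Subgroup.mem_centralizer_singleton_iff.1 hc
      calc _ = x * (x⁻¹ * g * x * h) * (x⁻¹ * g⁻¹ * x) * x⁻¹ := by group
        _ = _ := by rw [this]; group
    rw [tr_eq _ hg, extZero, dif_pos hc, Representation.character,
      ← LinearMap.trace_conj' _ (indEval h ρ x rfl)]
    congr 1
    ext v
    rw [LinearEquiv.conj_apply_apply, indEval_act h ρ g x rfl hg hc, LinearEquiv.apply_symm_apply]
  · rw [extZero, dif_neg hc]
    refine tr_eq_zero _ fun hg => hc ?_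
    rw [Subgroup.mem_centralizer_singleton_iff]
    have : g * (x * h * x⁻¹) = x * h * x⁻¹ * g := mul_inv_eq_iff_eq_mul.1 hg
    calc x⁻¹ * g * x * h = x⁻¹ * (g * (x * h * x⁻¹)) * x := by group
      _ = _ := by rw [this]; group

theorem tr_ind_of_not_isConj (g y : G) (hy : ¬ ∃ x, x * h * x⁻¹ = y) : (ind h ρ).tr g y = 0 := by
  by_cases hg : g * y * g⁻¹ = y
  · rw [tr_eq _ hg]
    refine (congrArg _ (LinearMap.ext fun f => ?_)).trans (map_zero (LinearMap.trace K _))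
    exact Subtype.ext (funext fun x => absurd ⟨x.1, x.2⟩ hy)
  · exact tr_eq_zero _ hg

end Ind

end EqBundle

/-! ### Generators of the Grothendieck ring -/

namespace EqBundle

variable {G : Type u} {K : Type v} [Group G] [Field K]

theorem act_congr (V : EqBundle G K) {g g' x y : G} (hg : g = g') (h : g * x * g⁻¹ = y)
    (h' : g' * x * g'⁻¹ = y) (v : V.fibre x) : V.act g h v = V.act g' h' v := by
  subst hg; rfl

theorem act_inv_act (V : EqBundle G K) {g x y : G} (h : g * x * g⁻¹ = y)
    (h' : g⁻¹ * y * g⁻¹⁻¹ = x) (v : V.fibre x) : V.act g⁻¹ h' (V.act g h v) = v := by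
  rw [← V.act_mul h h' (by group), V.act_congr (inv_mul_cancel g) _ (by group)]
  exact V.act_one _ v

/-- The representation of `C_G(x)` on the fibre at `x`. -/
def fibreRep (V : EqBundle G K) (x : G) : Representation K (Cent x) (V.fibre x) where
  toFun c := V.act c (mul_inv_eq_iff_eq_mul.2 (Subgroup.mem_centralizer_singleton_iff.1 c.2))
  map_one' := LinearMap.ext fun v => V.act_one _ v
  map_mul' _ _ := LinearMap.ext fun v => V.act_mul _ _ _ v

/-- The quotient of a bundle by the image of a morphism. -/
def quot {U V : EqBundle G K} (i : Hom U V) : EqBundle G K where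
  fibre x := V.fibre x ⧸ LinearMap.range (i.map x)
  act g {x y} h := Submodule.mapQ _ _ (V.act g h) (by
    rintro _ ⟨u, rfl⟩
    exact ⟨U.act g h u, i.comm g h u⟩)
  act_one {x} h v := by
    obtain ⟨v, rfl⟩ := Submodule.mkQ_surjective _ v
    exact congrArg _ (V.act_one h v)
  act_mul h h' h'' v := by
    obtain ⟨v, rfl⟩ := Submodule.mkQ_surjective _ v
    exact congrArg _ (V.act_mul h h' h'' v)

theorem shortExact_quot {U V : EqBundle G K} (i : Hom U V)
    (hi : ∀ x, Function.Injective (i.map x)) : ShortExact U V (quot i) :=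
  ⟨i, ⟨fun _ => Submodule.mkQ _, fun _ _ _ _ _ => rfl⟩,
    fun x => ⟨hi x, Submodule.mkQ_surjective _, (Submodule.ker_mkQ _).symm⟩⟩

/-! ### Morphisms out of induced bundles. -/

section Ind

variable [Finite G] {E : Type v} [AddCommGroup E] [Module K E] [Module.Finite K E]
  {E' : Type v} [AddCommGroup E'] [Module K E'] [Module.Finite K E']

/-- The isomorphism is right translation by x followed by T: f is sent to t ↦ T(f(t x)). -/
theorem ind_iso {h h' : G} (x : G) (hx : x * h * x⁻¹ = h') (ρ : Representation K (Cent h) E)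
    (ρ' : Representation K (Cent h') E') (T : E ≃ₗ[K] E')
    (hT : ∀ c v, T (ρ c v) = ρ' (conjCent x hx c) (T v)) : Iso (ind h ρ) (ind h' ρ') := by
  -- One direction is built for an arbitrary intertwining `T`, then applied to `T` and to its
  -- inverse. Describing its values at any `s` with `s = t x` avoids transport along equalities
  -- between group elements.
  have key : ∀ {h h' : G} {E : Type v} [AddCommGroup E] [Module K E] [Module.Finite K E]
      {E' : Type v} [AddCommGroup E'] [Module K E'] [Module.Finite K E']
      (x : G) (hx : x * h * x⁻¹ = h')
      (ρ : Representation K (Cent h) E) (ρ' : Representation K (Cent h') E') (T : E →ₗ[K] E')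
      (_ : ∀ c v, T (ρ c v) = ρ' (conjCent x hx c) (T v)),
      ∃ F : Hom (ind h ρ) (ind h' ρ'), ∀ (y : G) (f : (ind h ρ).fibre y)
        (t : {t : G // t * h' * t⁻¹ = y}) (s : {s : G // s * h * s⁻¹ = y}), s.1 = t.1 * x →
        (F.map y f).1 t = T (f.1 s) := by
    intro h h' E _ _ _ E' _ _ _ x hx ρ ρ' T hT
    have e : ∀ {t y : G}, t * h' * t⁻¹ = y → t * x * h * (t * x)⁻¹ = y := by
      intro t y ht
      rw [← ht, ← hx]; group
    have hm : ∀ c : Cent h', x⁻¹ * c * x ∈ Cent h := fun c => by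
      have hc := Subgroup.mem_centralizer_singleton_iff.1 c.2
      rw [Subgroup.mem_centralizer_singleton_iff]
      calc x⁻¹ * c * x * h = x⁻¹ * (c * (x * h * x⁻¹)) * x := by group
        _ = x⁻¹ * (x * h * x⁻¹ * c) * x := by rw [hx, hc]
        _ = _ := by group
    have hT' : ∀ (c : Cent h') (v : E), T (ρ ⟨x⁻¹ * c * x, hm c⟩ v) = ρ' c (T v) := by
      intro c v
      rw [hT]
      refine congrArg (fun c => ρ' c _) (Subtype.ext ?_)
      simp [conjCent, mul_assoc]
    refine ⟨⟨fun y =>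
      { toFun := fun f => ⟨fun t => T (f.1 ⟨t.1 * x, e t.2⟩), fun t t' c hc => ?_⟩
        map_add' := fun f f' => Subtype.ext (funext fun t => map_add T _ _)
        map_smul' := fun k f => Subtype.ext (funext fun t => map_smul T _ _) }, ?_⟩, ?_⟩
    · rw [← hT' c⁻¹]
      refine congrArg T ((f.2 ⟨t.1 * x, e t.2⟩ ⟨t'.1 * x, e t'.2⟩
        (⟨x⁻¹ * (c⁻¹ : Cent h') * x, hm c⁻¹⟩⁻¹) ?_).trans ?_)
      · simp [hc, mul_assoc]
      · rw [inv_inv]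
    · intro g y y' hy f
      refine Subtype.ext (funext fun t => congrArg T (congrArg f.1 (Subtype.ext ?_)))
      simp [mul_assoc]
    · intro y f t s hs
      exact congrArg T (congrArg f.1 (Subtype.ext hs.symm))
  have hx' : x⁻¹ * h' * x⁻¹⁻¹ = h := by rw [← hx]; group
  obtain ⟨F, hF⟩ := key x hx ρ ρ' T.toLinearMap hT
  obtain ⟨F', hF'⟩ := key x⁻¹ hx' ρ' ρ T.symm.toLinearMap (fun c v => by
    obtain ⟨w, rfl⟩ := T.surjective v
    have : conjCent x hx (conjCent x⁻¹ hx' c) = c := by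
      ext; simp [conjCent, mul_assoc]
    have h2 := hT (conjCent x⁻¹ hx' c) w
    rw [this] at h2
    rw [← h2]; simp)
  refine ⟨F, F', fun y f => Subtype.ext (funext fun t => ?_),
    fun y f => Subtype.ext (funext fun t => ?_)⟩
  · have e : t.1 * x⁻¹ * h' * (t.1 * x⁻¹)⁻¹ = y := by
      rw [← hx]; exact (by group : _ = t.1 * h * t.1⁻¹).trans t.2
    rw [hF' y _ t ⟨t.1 * x⁻¹, e⟩ rfl, hF y f ⟨t.1 * x⁻¹, e⟩ t (by simp)]
    simp
  · have e : t.1 * x * h * (t.1 * x)⁻¹ = y := by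
      refine ((by group : _ = t.1 * (x * h * x⁻¹) * t.1⁻¹).trans ?_).trans t.2
      rw [hx]
    rw [hF y _ t ⟨t.1 * x, e⟩ rfl, hF' y f ⟨t.1 * x, e⟩ t (by simp)]
    simp

/-- Frobenius reciprocity: an equivariant map from `E` to the fibre of `V` at `x` extends to a
morphism from the induced bundle. -/
theorem exists_hom_ind (V : EqBundle G K) (x : G) (σ : Representation K (Cent x) E)
    (j : E →ₗ[K] V.fibre x) (hj : ∀ c v, j (σ c v) = V.fibreRep x c (j v)) :
    ∃ F : Hom (ind x σ) V, ∀ (y : G) (f : (ind x σ).fibre y) (t : {t : G // t * x * t⁻¹ = y}),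
      F.map y f = V.act t.1 t.2 (j (f.1 t)) := by
  classical
  -- Two elements carrying x to y differ by an element of C_G(x), and equivariance of `f` and `j`
  -- absorbs it; so the value may be defined with a chosen representative.
  have indep : ∀ (y : G) (f : (ind x σ).fibre y) (t t' : {t : G // t * x * t⁻¹ = y}),
      V.act t.1 t.2 (j (f.1 t)) = V.act t'.1 t'.2 (j (f.1 t')) := by
    intro y f t t'
    have hc : t.1⁻¹ * t'.1 ∈ Cent x := by
      rw [Subgroup.mem_centralizer_singleton_iff]
      have h2 : t'.1 * x = t.1 * x * t.1⁻¹ * t'.1 := by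
        rw [t.2]; exact mul_inv_eq_iff_eq_mul.1 t'.2
      rw [mul_assoc, h2]; group
    have hcx : (⟨t.1⁻¹ * t'.1, hc⟩⁻¹ : Cent x).1 * x * (⟨t.1⁻¹ * t'.1, hc⟩⁻¹ : Cent x).1⁻¹ = x :=
      mul_inv_eq_iff_eq_mul.2 (Subgroup.mem_centralizer_singleton_iff.1 (Subtype.prop _))
    rw [f.2 t t' ⟨t.1⁻¹ * t'.1, hc⟩ (by simp), hj]
    change _ = V.act t'.1 t'.2 (V.act _ hcx _)
    rw [← V.act_mul hcx t'.2 (by simpa using t.2)]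
    exact V.act_congr (by simp) _ _ _
  let F : ∀ y, (ind x σ).fibre y →ₗ[K] V.fibre y := fun y =>
    if h : Nonempty {t : G // t * x * t⁻¹ = y} then
      { toFun := fun f => V.act h.some.1 h.some.2 (j (f.1 h.some))
        map_add' := fun f f' => by
          change V.act _ _ (j (f.1 _ + f'.1 _)) = _
          rw [map_add, map_add]
        map_smul' := fun k f => by
          change V.act _ _ (j (k • f.1 _)) = _
          rw [map_smul, map_smul]; rfl }
    else 0
  have hF : ∀ (y : G) (f : (ind x σ).fibre y) (t : {t : G // t * x * t⁻¹ = y}),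
      F y f = V.act t.1 t.2 (j (f.1 t)) := by
    intro y f t
    have h : Nonempty {t : G // t * x * t⁻¹ = y} := ⟨t⟩
    simp only [F, dif_pos h]
    exact indep y f _ _
  refine ⟨⟨F, ?_⟩, hF⟩
  intro g y y' hy f
  by_cases h : Nonempty {t : G // t * x * t⁻¹ = y}
  · obtain ⟨t⟩ := h
    have ht : g * t.1 * x * (g * t.1)⁻¹ = y' := by
      rw [← hy]
      refine (by group : _ = g * (t.1 * x * t.1⁻¹) * g⁻¹).trans ?_
      rw [t.2]
    rw [hF y f t, hF y' _ ⟨g * t.1, ht⟩, ← V.act_mul t.2 hy ht]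
    congr 2
    refine congrArg f.1 (Subtype.ext ?_)
    simp
  · have hf : f = 0 := Subtype.ext (funext fun t => absurd ⟨t⟩ h)
    rw [hf, map_zero, map_zero, map_zero, map_zero]

theorem injective_of_hom_ind {V : EqBundle G K} {x : G} {σ : Representation K (Cent x) E}
    {j : E →ₗ[K] V.fibre x} (hj : Function.Injective j) {F : Hom (ind x σ) V}
    (hF : ∀ (y : G) (f : (ind x σ).fibre y) (t : {t : G // t * x * t⁻¹ = y}),
      F.map y f = V.act t.1 t.2 (j (f.1 t))) (y : G) : Function.Injective (F.map y) := by
  rw [injective_iff_map_eq_zero]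
  intro f hf
  refine Subtype.ext (funext fun t => hj ?_)
  rw [hF y f t] at hf
  have h' : t.1⁻¹ * y * t.1⁻¹⁻¹ = x := by
    refine (congrArg (fun z => t.1⁻¹ * z * t.1⁻¹⁻¹) t.2.symm).trans ?_
    group
  have := V.act_inv_act t.2 h' (j (f.1 t))
  rw [hf, map_zero] at this
  rw [← this]
  exact (map_zero j).symm

end Ind

/-! ### Classes of simple bundles as additive generators. -/

section Cls

variable [Fintype G]

/-- The isomorphism class of a bundle. -/
def isoCls (V : EqBundle G K) : IsoClass G K := Quotient.mk _ V

theorem cls_def (V : EqBundle G K) :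
    V.cls = Ideal.Quotient.mk (exactRelations G K) (FreeAbelianGroup.of V.isoCls) := rfl

theorem cls_eq_of_iso {V W : EqBundle G K} (h : Iso V W) : V.cls = W.cls := by
  rw [cls_def, cls_def, show V.isoCls = W.isoCls from Quotient.sound h]

theorem cls_shortExact {V' V V'' : EqBundle G K} (h : ShortExact V' V V'') :
    V.cls = V'.cls + V''.cls := by
  have : Ideal.Quotient.mk (exactRelations G K) (FreeAbelianGroup.of V.isoCls -
      FreeAbelianGroup.of V'.isoCls - FreeAbelianGroup.of V''.isoCls) = 0 :=
    Ideal.Quotient.eq_zero_iff_mem.2 (Ideal.subset_span ⟨V', V, V'', h, rfl⟩)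
  rw [map_sub, map_sub, sub_sub, sub_eq_zero] at this
  exact this

/-- When all fibres vanish, 0 → V → V → V → 0 is exact, so the class equals twice itself. -/
theorem cls_eq_zero {V : EqBundle G K} (h : ∀ x, Subsingleton (V.fibre x)) : V.cls = 0 := by
  have : ShortExact V V V := ⟨⟨fun x => 0, fun _ _ _ _ _ => Subsingleton.elim _ _⟩,
    ⟨fun x => 0, fun _ _ _ _ _ => Subsingleton.elim _ _⟩, fun x =>
    ⟨fun a b _ => Subsingleton.elim _ _, fun a => ⟨0, Subsingleton.elim _ _⟩,
      Submodule.ext fun a => by simp [Subsingleton.elim a 0]⟩⟩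
  simpa using cls_shortExact this

theorem kgg_induction {P : KGG G K → Prop} (cls : ∀ V : EqBundle G K, P V.cls) (zero : P 0)
    (add : ∀ a b, P a → P b → P (a + b)) (neg : ∀ a, P a → P (-a)) (a : KGG G K) : P a := by
  obtain ⟨a, rfl⟩ := Ideal.Quotient.mk_surjective a
  induction a using FreeAbelianGroup.induction_on with
  | zero => rw [map_zero]; exact zero
  | of V =>
    obtain ⟨V⟩ := V
    exact cls V
  | neg V hV => rw [map_neg]; exact neg _ hV
  | add a b ha hb => rw [map_add]; exact add _ _ ha hb

/-- The rank of a bundle. -/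
def rank (V : EqBundle G K) : ℕ := ∑ x, Module.finrank K (V.fibre x)

/-- By Maschke a nonzero module over the group algebra is semisimple, hence contains a simple
submodule, which is then put in coordinates. -/
theorem exists_irreducible_embedding [CharZero K] {H : Type*} [Group H] [Finite H] {V : Type*}
    [AddCommGroup V] [Module K V] [FiniteDimensional K V] [Nontrivial V]
    (ρ : Representation K H V) :
    ∃ (n : ℕ) (σ : Representation K H (Fin n → K)) (j : (Fin n → K) →ₗ[K] V),
      σ.IsIrreducible ∧ Function.Injective j ∧ ∀ c v, j (σ c v) = ρ c (j v) := by
  have : NeZero (Nat.card H : K) := ⟨by exact_mod_cast Nat.card_pos.ne'⟩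
  have : Nontrivial ρ.asModule := inferInstanceAs (Nontrivial V)
  obtain ⟨S, hS⟩ := IsSemisimpleModule.exists_simple_submodule (MonoidAlgebra K H) ρ.asModule
  have hirr := Representation.IsIrreducible.ofModule' S hS
  have : FiniteDimensional K ρ.asModule := inferInstanceAs (FiniteDimensional K V)
  have : FiniteDimensional K S :=
    FiniteDimensional.finiteDimensional_submodule (S.restrictScalars K)
  obtain ⟨n, σ, ⟨e⟩⟩ := Representation.exists_equiv_fin (Representation.ofModule' (k := K) (G := H) S)
  refine ⟨n, σ, ρ.asModuleEquiv.toLinearMap ∘ₗ (S.restrictScalars K).subtype ∘ₗ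
    e.symm.toLinearMap, hirr.of_equiv e, ?_, ?_⟩
  · exact ρ.asModuleEquiv.injective.comp
      (Subtype.val_injective.comp e.symm.toLinearEquiv.injective)
  · intro c v
    have h1 := Representation.IntertwiningMap.isIntertwining _ _ e.symm.toIntertwiningMap c v
    have h2 := Representation.asAlgebraHom_ofModule' (K := K) (H := H) S (MonoidAlgebra.single c 1)
      (e.symm v)
    rw [Representation.asAlgebraHom_single_one] at h2
    have h3 : e.symm (σ c v) = MonoidAlgebra.single c (1 : K) • e.symm v := h1.trans h2
    change ρ.asModuleEquiv (e.symm (σ c v) : S) = _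
    rw [h3]
    change ρ.asAlgebraHom (MonoidAlgebra.single c 1) _ = _
    rw [Representation.asAlgebraHom_single_one]
    rfl

/-- The classes of the simple bundles generate the Grothendieck ring. -/
theorem cls_mem_closure [CharZero K] (V : EqBundle G K) :
    V.cls ∈ AddSubgroup.closure {a : KGG G K | ∃ (h : G) (n : ℕ)
      (ρ : Representation K (Cent h) (Fin n → K)), ρ.IsIrreducible ∧ a = (ind h ρ).cls} := by
  -- Induction on the total rank: an irreducible constituent of a nonzero fibre extends by Frobenius
  -- reciprocity to an embedded induced bundle, and the quotient has smaller rank.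
  induction hr : V.rank using Nat.strong_induction_on generalizing V with
  | _ r ih =>
    subst hr
    by_cases h : ∀ x, Subsingleton (V.fibre x)
    · rw [cls_eq_zero h]; exact zero_mem _
    · push Not at h
      obtain ⟨x, hx⟩ := h
      obtain ⟨n, σ, j, hσ, hj, hc⟩ := exists_irreducible_embedding (V.fibreRep x)
      obtain ⟨F, hF⟩ := exists_hom_ind V x σ j hc
      have hinj := injective_of_hom_ind hj hF
      rw [cls_shortExact (shortExact_quot F hinj)]
      refine add_mem (AddSubgroup.subset_closure ⟨x, n, σ, hσ, rfl⟩) (ih _ ?_ _ rfl)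
      refine Finset.sum_lt_sum (fun y _ => Submodule.finrank_quotient_le _) ⟨x, Finset.mem_univ _, ?_⟩
      have h1 := Submodule.finrank_quotient_add_finrank (LinearMap.range (F.map x))
      have h2 : Module.finrank K (LinearMap.range (F.map x)) = n := by
        rw [LinearMap.finrank_range_of_inj (hinj x),
          LinearEquiv.finrank_eq (indEval x σ 1 (by group))]
        simp
      have h3 : n ≠ 0 := by simpa using hσ.finrank_ne_zero
      change Module.finrank K (V.fibre x ⧸ LinearMap.range (F.map x)) < _
      omega

end Cls

end EqBundle

open MonoidAlgebra

/-! ### Ring homomorphisms from the Grothendieck ring to group algebras -/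

section Phi

variable {G : Type u} {K : Type v} [Group G] [Fintype G] [Field K]

instance centFintype (g : G) : Fintype (Cent g) := Fintype.ofFinite _

theorem mem_cent_iff_conj_eq {g x : G} : x ∈ Cent g ↔ g * x * g⁻¹ = x := by
  rw [Subgroup.mem_centralizer_singleton_iff, mul_inv_eq_iff_eq_mul, eq_comm]

theorem mem_cent_comm {g x : G} : x ∈ Cent g ↔ g ∈ Cent x := by
  rw [Subgroup.mem_centralizer_singleton_iff, Subgroup.mem_centralizer_singleton_iff, eq_comm]

/-- The multiplicative map `V ↦ ∑_{x ∈ C_G(g)} Tr(g | V_x) x` on isomorphism classes. -/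
def phiIso (K : Type v) [Field K] (g : G) :
    EqBundle.IsoClass G K →* MonoidAlgebra K (Cent g) where
  toFun := Quotient.lift (fun V : EqBundle G K => ofFun fun x : Cent g => V.tr g x)
    fun V W h => by
      congr 1
      exact funext fun x => EqBundle.tr_iso h g x
  map_one' := by
    classical
    change (ofFun fun x : Cent g => (EqBundle.unit G K).tr g x) = 1
    ext x
    rw [coeff_ofFun, EqBundle.tr_unit, one_def, coeff_single, Finsupp.single_apply]
    simp only [eq_comm (a := (1 : Cent g)), OneMemClass.coe_eq_one]
  map_mul' := by
    rintro ⟨V⟩ ⟨W⟩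
    change (ofFun fun x : Cent g => (EqBundle.conv V W).tr g x) =
      (ofFun fun x : Cent g => V.tr g x) * (ofFun fun x : Cent g => W.tr g x)
    classical
    ext z
    rw [coeff_mul_eq_sum, coeff_ofFun, EqBundle.tr_conv]
    simp only [coeff_ofFun, Subgroup.coe_mul, Subgroup.coe_inv]
    -- The sum of `tr_conv` runs over G, but its terms outside C_G(g) vanish; what is left is the
    -- product in the group algebra of C_G(g).
    refine (Finset.sum_subset (Finset.subset_univ (Finset.univ.filter (· ∈ Cent g)))
      fun x _ hx => ?_).symm.trans
      (Finset.sum_subtype _ (by simp) (fun x => V.tr g x * W.tr g (x⁻¹ * z)))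
    rw [EqBundle.tr_eq_zero V (fun h => hx ?_), zero_mul]
    simpa [mem_cent_iff_conj_eq] using h

/-- The ring homomorphism `V ↦ ∑_{x ∈ C_G(g)} Tr(g | V_x) x`. -/
def phi (K : Type v) [Field K] (g : G) : KGG G K →+* MonoidAlgebra K (Cent g) :=
  Ideal.Quotient.lift _ (FreeAbelianGroup.liftMonoid (phiIso K g)) <| by
    intro a ha
    have : exactRelations G K ≤ RingHom.ker (FreeAbelianGroup.liftMonoid (phiIso K g)) := by
      refine Ideal.span_le.2 ?_
      rintro _ ⟨V', V, V'', h, rfl⟩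
      change FreeAbelianGroup.liftMonoid (phiIso K g) (FreeAbelianGroup.of V.isoCls -
        FreeAbelianGroup.of V'.isoCls - FreeAbelianGroup.of V''.isoCls) = 0
      rw [map_sub, map_sub, FreeAbelianGroup.liftMonoid_coe, FreeAbelianGroup.lift_apply_of,
        FreeAbelianGroup.lift_apply_of, FreeAbelianGroup.lift_apply_of]
      ext x
      change V.tr g x - V'.tr g x - V''.tr g x = 0
      rw [EqBundle.tr_shortExact h]; ring
    exact RingHom.mem_ker.1 (this ha)

theorem phi_cls (g : G) (V : EqBundle G K) :
    phi K g V.cls = ofFun fun x : Cent g => V.tr g x := by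
  rw [EqBundle.cls_def, phi, Ideal.Quotient.lift_mk, FreeAbelianGroup.liftMonoid_coe,
    FreeAbelianGroup.lift_apply_of]
  rfl

theorem conj_mem_cent {x g c g' : G} (hx : x * g * x⁻¹ = g') (hc : c ∈ Cent g) :
    x * c * x⁻¹ ∈ Cent g' := (conjCent x hx ⟨c, hc⟩).2

/-- Traces are unchanged when g and the base point are conjugated together. For x in C_G(g) this
gives the centrality of the image; in general it identifies the images at conjugate elements. -/
theorem coeff_phi_conj (x : G) {g g' : G} (hx : x * g * x⁻¹ = g') (a : KGG G K) (c : Cent g) :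
    (phi K g' a).coeff (conjCent x hx c) = (phi K g a).coeff c := by
  induction a using EqBundle.kgg_induction with
  | cls V =>
    rw [phi_cls, phi_cls, coeff_ofFun, coeff_ofFun, ← V.tr_conj x g c, hx]
    rfl
  | zero => simp
  | add a b ha hb => simp [ha, hb]
  | neg a ha => simp [ha]

/-- `phi` as a homomorphism of `ℤ`-algebras. -/
def phiInt (K : Type v) [Field K] (g : G) : KGG G K →ₐ[ℤ] MonoidAlgebra K (Cent g) where
  toRingHom := phi K g
  commutes' n := by simp

theorem commute_ofId_phiInt (g : G) (x : K) (a : KGG G K) :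
    Commute (Algebra.ofId K (MonoidAlgebra K (Cent g)) x) (phiInt K g a) :=
  Algebra.commute_algebraMap_left x _

/-- The `K`-algebra homomorphism `K ⊗ K_G(G) → K C_G(g)` extending `phi`. -/
def phiK (K : Type v) [Field K] (g : G) : K ⊗[ℤ] KGG G K →ₐ[K] MonoidAlgebra K (Cent g) :=
  Algebra.TensorProduct.lift (Algebra.ofId K _) (phiInt K g) (commute_ofId_phiInt g)

theorem phiK_tmul (g : G) (c : K) (a : KGG G K) : phiK K g (c ⊗ₜ a) = c • phi K g a := by
  rw [phiK, Algebra.TensorProduct.lift_tmul, Algebra.smul_def]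
  rfl

theorem coeff_phiK_conj (x : G) {g g' : G} (hx : x * g * x⁻¹ = g') (a : K ⊗[ℤ] KGG G K)
    (c : Cent g) : (phiK K g' a).coeff (conjCent x hx c) = (phiK K g a).coeff c := by
  induction a using TensorProduct.induction_on with
  | zero => simp
  | tmul k a => simp [phiK_tmul, coeff_phi_conj]
  | add a b ha hb => simp [ha, hb]

theorem phiK_mem_center (g : G) (a : K ⊗[ℤ] KGG G K) :
    phiK K g a ∈ Subring.center (MonoidAlgebra K (Cent g)) := by
  refine mem_center_iff.2 fun h x => ?_
  have hx : (h : G) * g * (h : G)⁻¹ = g :=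
    mul_inv_eq_iff_eq_mul.2 (Subgroup.mem_centralizer_singleton_iff.1 h.2)
  have e : h * x * h⁻¹ = conjCent (h : G) hx x := Subtype.ext rfl
  rw [e, coeff_phiK_conj]

end Phi

/-! ### The simple bundles -/

section Irr

variable {G : Type u} {K : Type v} [Group G] [Field K]

theorem conjCent_surjective (x : G) {g g' : G} (h : x * g * x⁻¹ = g') :
    Function.Surjective (conjCent x h) := fun c => by
  have h' : x⁻¹ * g' * x⁻¹⁻¹ = g := by rw [← h]; group
  exact ⟨conjCent x⁻¹ h' c, by ext; simp [conjCent, mul_assoc]⟩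

theorem Representation.IsIrreducible.comp_surjective {H H' V : Type*} [Group H] [Group H']
    [AddCommGroup V] [Module K V] {ρ : Representation K H V} (hρ : ρ.IsIrreducible) {f : H' →* H}
    (hf : Function.Surjective f) : Representation.IsIrreducible (MonoidHom.comp ρ f) := by
  refine (OrderIso.isSimpleOrder_iff (α := Subrepresentation ρ) ?_).1 hρ
  exact
    { toFun := fun S => ⟨S.toSubmodule, fun g v hv => S.apply_mem_toSubmodule (f g) hv⟩
      invFun := fun S => ⟨S.toSubmodule, fun g v hv => by
        obtain ⟨g, rfl⟩ := hf g
        exact S.apply_mem_toSubmodule g hv⟩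
      left_inv := fun S => rfl
      right_inv := fun S => rfl
      map_rel_iff' := Iff.rfl }

theorem IsIrrChar.comp_surjective {H H' : Type*} [Group H] [Group H'] {γ : H → K}
    (h : IsIrrChar γ) {f : H' →* H} (hf : Function.Surjective f) : IsIrrChar (γ ∘ f) := by
  obtain ⟨n, ρ, hρ, rfl⟩ := h
  exact ⟨n, MonoidHom.comp ρ f, hρ.comp_surjective hf, rfl⟩

namespace IrrPair

theorem orbit_eq_iff {P Q : IrrPair G K} : P.orbit = Q.orbit ↔
    ∃ (x : G) (h : x * P.g * x⁻¹ = Q.g), ∀ c, Q.γ (conjCent x h c) = P.γ c :=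
  Quotient.eq (r := IrrPair.conjSetoid G K)

/-- The dimension of the representation chosen for a pair. -/
def dim (Q : IrrPair G K) : ℕ := Q.irr.choose

/-- A representation affording the character of a pair. -/
def rep (Q : IrrPair G K) : Representation K (Cent Q.g) (Fin Q.dim → K) := Q.irr.choose_spec.choose

theorem rep_irreducible (Q : IrrPair G K) : Q.rep.IsIrreducible := Q.irr.choose_spec.choose_spec.1

theorem rep_character (Q : IrrPair G K) : Q.rep.character = Q.γ := Q.irr.choose_spec.choose_spec.2

/-- The pair `(x g x⁻¹, γ^x)`. -/
def conj (Q : IrrPair G K) (x : G) : IrrPair G K where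
  g := x * Q.g * x⁻¹
  γ := Q.γ ∘ conjCent x⁻¹ (by group : x⁻¹ * (x * Q.g * x⁻¹) * x⁻¹⁻¹ = Q.g)
  irr := Q.irr.comp_surjective (conjCent_surjective _ _)

theorem conj_orbit (Q : IrrPair G K) (x : G) : (Q.conj x).orbit = Q.orbit := by
  refine (orbit_eq_iff.2 ⟨x, rfl, fun c => ?_⟩).symm
  refine congrArg Q.γ (Subtype.ext ?_)
  simp [conjCent, mul_assoc]

end IrrPair

variable [Fintype G]

/-- The simple bundle attached to a pair. -/
def IrrPair.bundle (Q : IrrPair G K) : EqBundle G K := EqBundle.ind Q.g Q.rep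

theorem cls_ind_eq [CharZero K] {h : G} {n : ℕ} {ρ : Representation K (Cent h) (Fin n → K)}
    (hρ : ρ.IsIrreducible) (Q : IrrPair G K)
    (hQ : (IrrPair.mk h ρ.character ⟨n, ρ, hρ, rfl⟩).orbit = Q.orbit) :
    (EqBundle.ind h ρ).cls = Q.bundle.cls := by
  obtain ⟨x, hx, H⟩ := IrrPair.orbit_eq_iff.1 hQ
  obtain ⟨e⟩ := nonempty_equiv_of_character_eq (σ := MonoidHom.comp Q.rep (conjCent x hx)) hρ
    (Q.rep_irreducible.comp_surjective (conjCent_surjective x hx)) (by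
      funext c
      refine ((H c).symm.trans ?_)
      rw [← Q.rep_character]
      rfl)
  refine EqBundle.cls_eq_of_iso (EqBundle.ind_iso x hx ρ Q.rep e.toLinearEquiv fun c v => ?_)
  exact Representation.IntertwiningMap.isIntertwining _ _ e.toIntertwiningMap c v

theorem finite_irrPair [CharZero K] (hsplit : ∀ H : Subgroup G, IsSplitGroupAlgebra K H) :
    Finite (IrrPair G K) := by
  have : ∀ g : G, Finite (IrrChar K (Cent g)) := fun g => finite_irrChar (hsplit _)
  refine Finite.of_injective (β := Σ g : G, IrrChar K (Cent g)) (fun Q => ⟨Q.g, Q.γ, Q.irr⟩) ?_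
  rintro ⟨g, γ, h⟩ ⟨g', γ', h'⟩ e
  simp only [Sigma.mk.injEq] at e
  obtain ⟨rfl, e⟩ := e
  have := congrArg Subtype.val (eq_of_heq e)
  simp only at this
  subst this
  rfl

theorem finite_mSet [CharZero K] (hsplit : ∀ H : Subgroup G, IsSplitGroupAlgebra K H) :
    Finite (MSet G K) := by
  have := finite_irrPair hsplit
  exact Quotient.finite _

/-- The multiplicity functional `a ↦ |C_G(g)|⁻¹ ∑_{c ∈ C_G(g)} Tr(c | a_g) γ(c⁻¹)`. -/
def multFun (Q : IrrPair G K) : KGG G K →+ K where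
  toFun a := (Nat.card (Cent Q.g) : K)⁻¹ * ∑ c : Cent Q.g,
    (phi K (c : G) a).coeff ⟨Q.g, mem_cent_comm.1 c.2⟩ * Q.γ c⁻¹
  map_zero' := by simp
  map_add' a b := by simp [add_mul, Finset.sum_add_distrib, mul_add]

/-- Exchanging the roles of g and c, the coefficients at g of the elements `phi K c`, for c in
C_G(g), form the character of C_G(g) on the fibre at g. The functional is thus an inner product of
characters, and first orthogonality applies; these functionals are dual to the simple bundles. -/
theorem multFun_bundle [CharZero K] (hsplit : ∀ H : Subgroup G, IsSplitGroupAlgebra K H)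
    (P Q : IrrPair G K) [Decidable (P.orbit = Q.orbit)] :
    multFun Q P.bundle.cls = if P.orbit = Q.orbit then 1 else 0 := by
  classical
  by_cases hconj : ∃ x, x * P.g * x⁻¹ = Q.g
  · obtain ⟨x, hx⟩ := hconj
    obtain ⟨g, γ, hγ⟩ := Q
    simp only at hx
    subst hx
    obtain ⟨γ', hγ'⟩ : ∃ γ' : Cent (x * P.g * x⁻¹) → K, γ' = (P.conj x).γ := ⟨_, rfl⟩
    have hirr : IsIrrChar γ' := hγ' ▸ (P.conj x).irr
    have h1 : multFun ⟨x * P.g * x⁻¹, γ, hγ⟩ P.bundle.cls =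
        (Nat.card (Cent (x * P.g * x⁻¹)) : K)⁻¹ * ∑ c, γ' c * γ c⁻¹ := by
      change (Nat.card (Cent (x * P.g * x⁻¹)) : K)⁻¹ * _ = _
      congr 1
      refine Finset.sum_congr rfl fun c _ => ?_
      congr 1
      rw [phi_cls, coeff_ofFun, hγ']
      change P.bundle.tr c (x * P.g * x⁻¹) = _
      rw [IrrPair.bundle, EqBundle.tr_ind, P.rep_character, extZero]
      have hc := (conjCent x⁻¹ (by group : x⁻¹ * (x * P.g * x⁻¹) * x⁻¹⁻¹ = P.g) c).2
      have hc' : x⁻¹ * c * x ∈ Cent P.g := by simpa [conjCent] using hc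
      rw [dif_pos hc']
      refine congrArg P.γ (Subtype.ext ?_)
      simp [conjCent]
    rw [h1, char_inner_eq_ite (hsplit _) hirr hγ]
    refine if_congr ⟨fun h => ?_, fun h => ?_⟩ rfl rfl
    · rw [← P.conj_orbit x]
      subst h hγ'
      rfl
    · rw [← P.conj_orbit x] at h
      obtain ⟨y, hy, H⟩ := IrrPair.orbit_eq_iff.1 h
      rw [hγ']
      funext c
      rw [← H c]
      have hy' : y ∈ Cent (x * P.g * x⁻¹) := by
        rw [Subgroup.mem_centralizer_singleton_iff]; exact mul_inv_eq_iff_eq_mul.1 hy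
      exact hγ.conj ⟨y, hy'⟩ c
  · rw [if_neg]
    · change (Nat.card (Cent Q.g) : K)⁻¹ * _ = _
      rw [Finset.sum_eq_zero, mul_zero]
      intro c _
      rw [phi_cls, coeff_ofFun, IrrPair.bundle, EqBundle.tr_ind_of_not_isConj _ _ _ _ hconj,
        zero_mul]
    · intro h
      obtain ⟨x, hx, -⟩ := IrrPair.orbit_eq_iff.1 h
      exact hconj ⟨x, hx⟩

/-- A representative of an orbit. -/
def MSet.rep (q : MSet G K) : IrrPair G K := Quotient.out q

theorem MSet.rep_orbit (q : MSet G K) : q.rep.orbit = q := Quotient.out_eq q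

/-- The classes of the simple bundles form a basis of the Grothendieck ring. -/
def kggBasis [CharZero K] (hsplit : ∀ H : Subgroup G, IsSplitGroupAlgebra K H) :
    Module.Basis (MSet G K) ℤ (KGG G K) :=
  Module.Basis.mk (v := fun q => q.rep.bundle.cls)
    (by
      classical
      rw [linearIndependent_iff']
      intro s c hc q hq
      have := congrArg (multFun q.rep) hc
      rw [map_sum, map_zero, Finset.sum_eq_single q] at this
      · rw [map_zsmul, multFun_bundle hsplit, if_pos rfl] at this
        simpa using this
      · intro q' _ hne
        rw [map_zsmul, multFun_bundle hsplit, if_neg, smul_zero]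
        rwa [q'.rep_orbit, q.rep_orbit]
      · exact fun h => absurd hq h)
    (by
      intro a _
      induction a using EqBundle.kgg_induction with
      | cls V =>
        have := EqBundle.cls_mem_closure V
        refine (AddSubgroup.closure_le
          (K := (Submodule.span ℤ (Set.range fun q : MSet G K => q.rep.bundle.cls)).toAddSubgroup)).2
          ?_ this
        rintro _ ⟨h, n, ρ, hρ, rfl⟩
        refine Submodule.subset_span ⟨(IrrPair.mk h ρ.character ⟨n, ρ, hρ, rfl⟩).orbit, ?_⟩
        exact (cls_ind_eq hρ _ (MSet.rep_orbit _).symm).symm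
      | zero => exact zero_mem _
      | add a b ha hb => exact add_mem (ha trivial) (hb trivial)
      | neg a ha => exact neg_mem (ha trivial))

theorem kggBasis_apply [CharZero K] (hsplit : ∀ H : Subgroup G, IsSplitGroupAlgebra K H)
    (q : MSet G K) : kggBasis hsplit q = q.rep.bundle.cls := Module.Basis.mk_apply _ _ q

/-- Coordinates in the basis of simple bundles are thereby computed from the maps `phi`, which makes
these maps jointly injective. -/
theorem multFun_eq_repr [CharZero K] (hsplit : ∀ H : Subgroup G, IsSplitGroupAlgebra K H)
    (q : MSet G K) (a : KGG G K) : multFun q.rep a = (kggBasis hsplit).repr a q := by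
  classical
  have : (multFun q.rep).toIntLinearMap =
      (Algebra.linearMap ℤ K) ∘ₗ ((kggBasis hsplit).coord q) := by
    refine (kggBasis hsplit).ext fun q' => ?_
    change multFun q.rep (kggBasis hsplit q') =
      algebraMap ℤ K ((kggBasis hsplit).repr (kggBasis hsplit q') q)
    rw [Module.Basis.repr_self, Finsupp.single_apply, kggBasis_apply, multFun_bundle hsplit,
      q'.rep_orbit, q.rep_orbit]
    split_ifs <;> simp
  exact LinearMap.congr_fun this a

end Irr

/-! ### The characters of the Grothendieck algebra -/

section Psi

/-- Every nonempty fibre of y ↦ y h y⁻¹ has |C_G(h)| elements; this converts sums over a class into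
the sums over G of the Fourier coefficients. -/
theorem sum_conj_eq {G : Type*} [Group G] [Fintype G] {K : Type*} [Field K] (h : G) {f : G → K}
    (hf : ∀ z, (¬ ∃ y, y * h * y⁻¹ = z) → f z = 0) :
    ∑ y, f (y * h * y⁻¹) = Nat.card (Cent h) * ∑ z, f z := by
  classical
  rw [← Finset.sum_fiberwise_of_maps_to (g := fun y => y * h * y⁻¹)
    (fun y _ => Finset.mem_univ _), Finset.mul_sum]
  refine Finset.sum_congr rfl fun z _ => ?_
  by_cases hz : ∃ y, y * h * y⁻¹ = z
  · obtain ⟨c, hc⟩ := hz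
    rw [← card_filter_conj_eq hc, ← nsmul_eq_mul]
    refine Finset.sum_eq_card_nsmul fun y hy => ?_
    rw [(Finset.mem_filter.1 hy).2]
  · rw [hf z hz, mul_zero]
    refine Finset.sum_eq_zero fun y hy => ?_
    exact absurd ⟨y, (Finset.mem_filter.1 hy).2⟩ hz

variable {G : Type u} {K : Type v} [Group G] [Fintype G] [Field K] [CharZero K]

theorem cent_inv (h : G) : Cent h⁻¹ = Cent h := by
  ext x
  rw [mem_cent_comm, inv_mem_iff, mem_cent_comm]

theorem sum_cent_eq_sum {g : G} (f : G → K) (γ : Cent g → K) :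
    ∑ x : Cent g, f x * γ x = ∑ x, f x * extZero γ x := by
  classical
  refine Eq.trans ?_ (Finset.sum_subset
    (Finset.subset_univ (Finset.univ.filter (· ∈ Cent g))) fun x _ hx => ?_)
  · rw [Finset.sum_subtype (p := (· ∈ Cent g)) _ (by simp)]
    refine Finset.sum_congr rfl fun x _ => ?_
    rw [extZero, dif_pos x.2]
  · rw [extZero, dif_neg (by simpa using hx), mul_zero]

variable (hsplit : ∀ H : Subgroup G, IsSplitGroupAlgebra K H)

/-- The `K`-algebra morphism `K ⊗ K_G(G) → K` attached to a pair. -/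
def psi (Q : IrrPair G K) : K ⊗[ℤ] KGG G K →ₐ[K] K :=
  AlgHom.ofLinearMap
    { toFun := fun a => centralChar Q.γ (phiK K Q.g a)
      map_add' := fun a b => by rw [map_add, centralChar_add]
      map_smul' := fun c a => by rw [map_smul, centralChar_smul]; rfl }
    (by
      change centralChar Q.γ (phiK K Q.g 1) = 1
      rw [map_one, centralChar_one Q.irr])
    (fun a b => by
      change centralChar Q.γ (phiK K Q.g (a * b)) = _
      rw [map_mul, centralChar_mul (hsplit _) Q.irr (phiK_mem_center _ _) (phiK_mem_center _ _)]
      rfl)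

theorem psi_apply (Q : IrrPair G K) (a : K ⊗[ℤ] KGG G K) :
    psi hsplit Q a = centralChar Q.γ (phiK K Q.g a) := rfl

/-- The trace on the induced bundle is supported on the class of h, so the sum defining the central
character can be parametrized by y ↦ y h y⁻¹; `tr_ind` then gives the value of the character of ρ at
y⁻¹ g y. The inverse of h in `IsPsi` cancels the one built into `lusztigFourier`. -/
theorem isPsi_psi (Q : IrrPair G K) : IsPsi Q (psi hsplit Q) := by
  classical
  intro h n ρ _
  have hcard : ∀ x : G, (Nat.card (Cent x) : K) ≠ 0 := fun x => by
    exact_mod_cast Nat.card_pos.ne'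
  rw [psi_apply, phiK_tmul, one_smul, phi_cls, centralChar]
  simp only [coeff_ofFun]
  rw [sum_cent_eq_sum (fun x => (EqBundle.ind h ρ).tr Q.g x)]
  have h1 := sum_conj_eq h (f := fun x => (EqBundle.ind h ρ).tr Q.g x * extZero Q.γ x)
    (fun z hz => by rw [EqBundle.tr_ind_of_not_isConj _ _ _ _ hz, zero_mul])
  have h2 : ∑ y, (EqBundle.ind h ρ).tr Q.g (y * h * y⁻¹) * extZero Q.γ (y * h * y⁻¹) =
      ∑ x : G, if x * Q.g * x⁻¹ ∈ Cent h⁻¹ then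
        extZero ρ.character (x * Q.g * x⁻¹) * extZero Q.γ (x⁻¹ * h⁻¹⁻¹ * x) else 0 := by
    refine Fintype.sum_equiv (Equiv.inv G) _ _ fun y => ?_
    -- The summation variables of the two sums correspond by x = y⁻¹.
    rw [EqBundle.tr_ind, cent_inv]
    simp only [Equiv.inv_apply, inv_inv]
    split_ifs with hy
    · rfl
    · rw [extZero, dif_neg hy, zero_mul]
  have h3 : ∀ η : G → K, lusztigFourier h⁻¹ η Q.g (extZero Q.γ) =
      ((Nat.card (Cent h) : K) * (Nat.card (Cent Q.g) : K))⁻¹ *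
      ∑ x : G, if x * Q.g * x⁻¹ ∈ Cent h⁻¹ then
        η (x * Q.g * x⁻¹) * extZero Q.γ (x⁻¹ * h⁻¹⁻¹ * x) else 0 := by
    intro η
    rw [lusztigFourier, cent_inv]
  have hγ := Q.irr.one_ne_zero
  have := hcard h
  have := hcard Q.g
  have h4 : lusztigFourier h⁻¹ (extZero ρ.character) Q.g (extZero Q.γ) =
      ((Nat.card (Cent h) : K) * (Nat.card (Cent Q.g) : K))⁻¹ *
        ((Nat.card (Cent h) : K) * ∑ z, (EqBundle.ind h ρ).tr Q.g z * extZero Q.γ z) := by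
    rw [← h1, h2]
    exact h3 _
  rw [h4]
  field_simp

/-- The basis of `R ⊗ K_G(G)` formed by the simple bundles. -/
def tensorBasis (R : Type*) [CommRing R] : Module.Basis (MSet G K) R (R ⊗[ℤ] KGG G K) :=
  Algebra.TensorProduct.basis R (kggBasis hsplit)

theorem isPsi_iff {Q : IrrPair G K} {Ψ : K ⊗[ℤ] KGG G K →ₐ[K] K} :
    IsPsi Q Ψ ↔ Ψ = psi hsplit Q := by
  constructor
  · intro h
    have : Ψ.toLinearMap = (psi hsplit Q).toLinearMap := by
      refine (tensorBasis hsplit K).ext fun q => ?_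
      rw [tensorBasis, Algebra.TensorProduct.basis_apply, kggBasis_apply]
      exact (h _ _ _ q.rep.rep_irreducible).trans (isPsi_psi hsplit Q _ _ _ q.rep.rep_irreducible).symm
    exact AlgHom.toLinearMap_injective this
  · rintro rfl
    exact isPsi_psi hsplit Q

theorem tensorBasis_repr_eq (q : MSet G K) (a : K ⊗[ℤ] KGG G K) :
    (tensorBasis hsplit K).repr a q = (Nat.card (Cent q.rep.g) : K)⁻¹ * ∑ c : Cent q.rep.g,
      (phiK K (c : G) a).coeff ⟨q.rep.g, mem_cent_comm.1 c.2⟩ * q.rep.γ c⁻¹ := by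
  induction a using TensorProduct.induction_on with
  | zero => simp
  | tmul k a =>
    rw [tensorBasis, Algebra.TensorProduct.basis_repr_tmul]
    simp only [phiK_tmul, Finsupp.smul_apply, coeff_smul, smul_eq_mul, mul_assoc]
    rw [← Finset.mul_sum, mul_left_comm]
    congr 1
    exact (multFun_eq_repr hsplit q a).symm
  | add a b ha hb =>
    simp only [map_add, Finsupp.add_apply, ha, hb, coeff_add, add_mul, Finset.sum_add_distrib,
      mul_add]

theorem eq_zero_of_forall_phiK (hsplit : ∀ H : Subgroup G, IsSplitGroupAlgebra K H) {a : K ⊗[ℤ] KGG G K}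
    (h : ∀ g, phiK K g a = 0) : a = 0 := by
  refine (tensorBasis hsplit K).ext_elem fun q => ?_
  rw [tensorBasis_repr_eq, map_zero]
  simp [h]

theorem phiK_eq_zero_of_forall_psi {a : K ⊗[ℤ] KGG G K} {g : G}
    (h : ∀ Q : IrrPair G K, Q.g = g → psi hsplit Q a = 0) : phiK K g a = 0 :=
  eq_zero_of_forall_centralChar (hsplit _) (phiK_mem_center _ _) fun γ hγ => h ⟨g, γ, hγ⟩ rfl

theorem eq_zero_of_forall_psi {a : K ⊗[ℤ] KGG G K} (h : ∀ Q, psi hsplit Q a = 0) : a = 0 :=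
  eq_zero_of_forall_phiK hsplit fun _ => phiK_eq_zero_of_forall_psi hsplit fun Q _ => h Q

theorem psi_eq_of_orbit_eq {P Q : IrrPair G K} (h : P.orbit = Q.orbit) :
    psi hsplit P = psi hsplit Q := by
  obtain ⟨x, hx, H⟩ := IrrPair.orbit_eq_iff.1 h
  refine AlgHom.ext fun a => ?_
  have h1 : Q.γ 1 = P.γ 1 := by rw [← H 1, map_one]
  have hinj : Function.Injective (conjCent x hx) := fun c d hcd => by
    have := congrArg Subtype.val hcd
    simpa [conjCent] using this
  rw [psi_apply, psi_apply, centralChar, centralChar, h1]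
  congr 1
  refine Fintype.sum_bijective _ ⟨hinj, conjCent_surjective x hx⟩ _ _ fun c => ?_
  rw [H, coeff_phiK_conj]

/-- The primitive idempotents of `K ⊗ K_G(G)`. -/
theorem exists_psi_eq_ite (q : MSet G K) :
    ∃ d : K ⊗[ℤ] KGG G K, psi hsplit q.rep d = 1 ∧ ∀ q', q' ≠ q → psi hsplit q'.rep d = 0 := by
  classical
  have := finite_mSet hsplit
  have := Fintype.ofFinite (MSet G K)
  -- Evaluation at all orbits is injective between spaces of the same dimension, since the simple
  -- bundles are indexed by the same set ℳ(G); so it is surjective, and `d` is a preimage of a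
  -- coordinate vector.
  let L : K ⊗[ℤ] KGG G K →ₗ[K] (MSet G K → K) := LinearMap.pi fun q => (psi hsplit q.rep).toLinearMap
  have hL : Function.Injective L := by
    rw [injective_iff_map_eq_zero]
    intro a ha
    refine eq_zero_of_forall_psi hsplit fun Q => ?_
    rw [psi_eq_of_orbit_eq hsplit (Q.orbit.rep_orbit).symm]
    exact congrFun ha Q.orbit
  have : FiniteDimensional K (K ⊗[ℤ] KGG G K) := (tensorBasis hsplit K).finiteDimensional_of_finite
  have hfr : Module.finrank K (K ⊗[ℤ] KGG G K) = Module.finrank K (MSet G K → K) := by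
    rw [Module.finrank_eq_card_basis (tensorBasis hsplit K), Module.finrank_fintype_fun_eq_card]
  obtain ⟨d, hd⟩ := (LinearMap.injective_iff_surjective_of_finrank_eq_finrank hfr).1 hL
    (Pi.single q 1)
  refine ⟨d, ?_, fun q' hq' => ?_⟩
  · exact (congrFun hd q).trans (Pi.single_eq_same q 1)
  · exact (congrFun hd q').trans (Pi.single_eq_of_ne hq' 1)

theorem psi_eq_iff {P Q : IrrPair G K} : psi hsplit P = psi hsplit Q ↔ P.orbit = Q.orbit := by
  refine ⟨fun h => ?_, psi_eq_of_orbit_eq hsplit⟩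
  obtain ⟨d, hd, hd'⟩ := exists_psi_eq_ite hsplit Q.orbit
  rw [← psi_eq_of_orbit_eq hsplit (Q.orbit.rep_orbit).symm, ← h,
    psi_eq_of_orbit_eq hsplit (P.orbit.rep_orbit).symm] at hd
  by_contra hne
  exact one_ne_zero (hd.symm.trans (hd' _ hne))

/-- The elements `d q` sum to 1, so Ψ is nonzero on one of them. Since a d_q is the multiple of d_q
by the value of `psi` at q, applying Ψ and cancelling Ψ(d_q) gives Ψ = `psi`. -/
theorem exists_eq_psi (Ψ : K ⊗[ℤ] KGG G K →ₐ[K] K) : ∃ Q, Ψ = psi hsplit Q := by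
  classical
  have := finite_mSet hsplit
  have := Fintype.ofFinite (MSet G K)
  choose d hd hd' using exists_psi_eq_ite (K := K) hsplit
  have hext : ∀ {a b : K ⊗[ℤ] KGG G K},
      (∀ q : MSet G K, psi hsplit q.rep a = psi hsplit q.rep b) → a = b := by
    intro a b h
    refine sub_eq_zero.1 (eq_zero_of_forall_psi hsplit fun Q => ?_)
    rw [psi_eq_of_orbit_eq hsplit (Q.orbit.rep_orbit).symm, map_sub, h, sub_self]
  have hsum : ∑ q, d q = 1 := hext fun q => by
    rw [map_sum, map_one, Finset.sum_eq_single q, hd]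
    · intro q' _ hq'
      exact hd' q' q (Ne.symm hq')
    · exact fun h => absurd (Finset.mem_univ _) h
  obtain ⟨q, hq⟩ : ∃ q, Ψ (d q) ≠ 0 := by
    by_contra! h
    have := congrArg Ψ hsum
    rw [map_sum, Finset.sum_eq_zero (fun q _ => h q), map_one] at this
    exact zero_ne_one this
  refine ⟨q.rep, AlgHom.ext fun a => mul_right_cancel₀ hq ?_⟩
  have h1 : a * d q = psi hsplit q.rep a • d q := hext fun q' => by
    rw [map_mul, map_smul, smul_eq_mul]
    by_cases h : q' = q
    · rw [h]
    · rw [hd' q q' h, mul_zero, mul_zero]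
  rw [← map_mul, h1, map_smul, smul_eq_mul]

end Psi

/-! ### Integrality of traces of operators of finite order -/

section Trace

/-- The operator is killed by X (Xⁿ - 1), which is separable in characteristic zero, so it is
diagonalizable; S is the multiset of its eigenvalues. The hypothesis `f ^ (n + 1) = f`, rather than
`f ^ n = 1`, admits products of finite-order operators with commuting projectors. -/
theorem exists_multiset_trace_pow {L V : Type*} [Field L] [IsAlgClosed L] [CharZero L]
    [AddCommGroup V] [Module L V] [FiniteDimensional L V] {f : Module.End L V} {n : ℕ} (hn : n ≠ 0)
    (hf : f ^ (n + 1) = f) : ∃ S : Multiset L, (∀ μ ∈ S, μ ^ (n + 1) = μ) ∧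
      ∀ k, LinearMap.trace L V (f ^ k) = (S.map (· ^ k)).sum := by
  classical
  have hs : f.IsSemisimple := by
    refine Module.End.isSemisimple_of_squarefree_aeval_eq_zero
      (p := (Polynomial.X * (Polynomial.X ^ n - 1) : Polynomial L)) ?_ ?_
    · refine Polynomial.Separable.squarefree (Polynomial.Separable.mul Polynomial.separable_X
        (Polynomial.separable_X_pow_sub_C (1 : L) (by exact_mod_cast hn) one_ne_zero) ?_)
      -- Bézout relation: Xⁿ⁻¹ · X - (Xⁿ - 1) = 1.
      refine ⟨Polynomial.X ^ (n - 1), -1, ?_⟩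
      rw [← pow_succ, Nat.sub_add_cancel (Nat.one_le_iff_ne_zero.2 hn)]
      ring
    · rw [mul_sub, mul_one, ← pow_succ']
      simp [hf]
  have hi : DirectSum.IsInternal f.eigenspace :=
    DirectSum.isInternal_submodule_of_iSupIndep_of_iSup_eq_top f.eigenspaces_iSupIndep
      hs.iSup_eigenspace_eq_top
  have hfin : {μ | f.eigenspace μ ≠ ⊥}.Finite :=
    WellFoundedGT.finite_ne_bot_of_iSupIndep f.eigenspaces_iSupIndep
  have hpow : ∀ (k : ℕ) (μ : L) (x : V), x ∈ f.eigenspace μ → (f ^ k) x = μ ^ k • x := by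
    intro k μ x hx
    induction k with
    | zero => simp
    | succ k ih =>
      rw [pow_succ', Module.End.mul_apply, ih, map_smul, Module.End.mem_eigenspace_iff.1 hx,
        smul_smul, ← pow_succ]
  refine ⟨∑ μ ∈ hfin.toFinset, Multiset.replicate (Module.finrank L (f.eigenspace μ)) μ,
    fun μ hμ => ?_, fun k => ?_⟩
  · obtain ⟨ν, hν, h⟩ := Multiset.mem_sum.1 hμ
    obtain rfl := Multiset.eq_of_mem_replicate h
    obtain ⟨x, hx, hx0⟩ := Submodule.exists_mem_ne_zero_of_ne_bot ((Set.Finite.mem_toFinset _).1 hν)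
    have h1 := hpow (n + 1) μ x hx
    rw [hf, Module.End.mem_eigenspace_iff.1 hx] at h1
    exact (smul_left_injective L hx0 h1).symm
  · have hmaps : ∀ μ, Set.MapsTo (f ^ k) (f.eigenspace μ) (f.eigenspace μ) := fun μ x hx => by
      rw [SetLike.mem_coe, hpow k μ x hx]
      exact Submodule.smul_mem _ _ hx
    rw [LinearMap.trace_eq_sum_trace_restrict' hi hfin hmaps]
    have hS : ∀ T : Finset L, ((∑ μ ∈ T, Multiset.replicate (Module.finrank L (f.eigenspace μ)) μ).map
        (· ^ k)).sum = ∑ μ ∈ T, Module.finrank L (f.eigenspace μ) • μ ^ k := by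
      intro T
      induction T using Finset.induction_on with
      | empty => simp
      | insert a s ha ih =>
        rw [Finset.sum_insert ha, Finset.sum_insert ha, Multiset.map_add, Multiset.sum_add, ih,
          Multiset.map_replicate, Multiset.sum_replicate]
    rw [hS]
    refine Finset.sum_congr rfl fun μ _ => ?_
    have : (f ^ k).restrict (hmaps μ) = μ ^ k • LinearMap.id :=
      LinearMap.ext fun x => Subtype.ext (hpow k μ x x.2)
    rw [this, map_smul, LinearMap.trace_id, nsmul_eq_mul, smul_eq_mul, mul_comm]

theorem isIntegral_of_pow_succ_eq {L : Type*} [CommRing L] {n : ℕ} (hn : n ≠ 0) {μ : L}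
    (h : μ ^ (n + 1) = μ) : IsIntegral ℤ μ := by
  refine ⟨Polynomial.X ^ (n + 1) - Polynomial.X, ?_, by simp [h]⟩
  exact Polynomial.monic_X_pow_sub (by
    rw [Polynomial.degree_X]; exact_mod_cast Nat.lt_succ_of_le (Nat.one_le_iff_ne_zero.2 hn))

/-- The binomial congruence modulo p, carried out in the integral closure of ℤ so that the remainder
is p times an integral element. -/
theorem exists_sum_pow_prime_pow_eq {L : Type*} [CommRing L] {p : ℕ} (hp : p.Prime) (N : ℕ)
    (S : Multiset L) (hS : ∀ μ ∈ S, IsIntegral ℤ μ) :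
    ∃ y, IsIntegral ℤ y ∧ S.sum ^ p ^ N = (S.map (· ^ p ^ N)).sum + p * y := by
  induction S using Multiset.induction_on with
  | empty => exact ⟨0, isIntegral_zero, by simp [hp.pos.ne']⟩
  | cons a S ih =>
    obtain ⟨y, hy, h⟩ := ih fun μ hμ => hS μ (Multiset.mem_cons_of_mem hμ)
    have ha := hS a (Multiset.mem_cons_self _ _)
    have hsum : IsIntegral ℤ S.sum :=
      IsIntegral.multiset_sum fun μ hμ => hS μ (Multiset.mem_cons_of_mem hμ)
    obtain ⟨r, hr⟩ := exists_add_pow_prime_pow_eq hp (⟨a, ha⟩ : integralClosure ℤ L) ⟨_, hsum⟩ N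
    have hr' := congrArg (algebraMap (integralClosure ℤ L) L) hr
    simp only [map_add, map_mul, map_pow, map_natCast] at hr'
    change (a + S.sum) ^ p ^ N = a ^ p ^ N + S.sum ^ p ^ N + p * a * S.sum * r at hr'
    refine ⟨y + a * S.sum * r, hy.add ((ha.mul hsum).mul r.2), ?_⟩
    rw [Multiset.sum_cons, hr', h, Multiset.map_cons, Multiset.sum_cons]
    ring

variable {K V : Type*} [Field K] [CharZero K] [AddCommGroup V] [Module K V] [FiniteDimensional K V]

theorem exists_multiset_trace_pow_baseChange (L : Type*) [Field L] [IsAlgClosed L] [Algebra K L]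
    {f : Module.End K V} {n : ℕ} (hn : n ≠ 0) (hf : f ^ (n + 1) = f) :
    ∃ S : Multiset L, (∀ μ ∈ S, IsIntegral ℤ μ) ∧
      ∀ k, algebraMap K L (LinearMap.trace K V (f ^ k)) = (S.map (· ^ k)).sum := by
  have : CharZero L := charZero_of_injective_algebraMap (algebraMap K L).injective
  have hf' : (f.baseChange L : Module.End L (L ⊗[K] V)) ^ (n + 1) = f.baseChange L := by
    rw [← LinearMap.baseChange_pow, hf]
  obtain ⟨S, hS, h⟩ := exists_multiset_trace_pow hn hf'
  refine ⟨S, fun μ hμ => isIntegral_of_pow_succ_eq hn (hS μ hμ), fun k => ?_⟩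
  rw [← LinearMap.trace_baseChange, LinearMap.baseChange_pow, h]

theorem LinearMap.isIntegral_trace_of_pow_succ_eq {f : Module.End K V} {n : ℕ} (hn : n ≠ 0)
    (hf : f ^ (n + 1) = f) : IsIntegral ℤ (LinearMap.trace K V f) := by
  have key : ∀ (L : Type _) [Field L] [IsAlgClosed L] [Algebra K L],
      IsIntegral ℤ (LinearMap.trace K V f) := by
    intro L _ _ _
    obtain ⟨S, hS, h⟩ := exists_multiset_trace_pow_baseChange L hn hf
    refine (isIntegral_algebraMap_iff (algebraMap K L).injective).1 ?_
    rw [← pow_one f, h 1]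
    simpa using IsIntegral.multiset_sum hS
  exact key (AlgebraicClosure K)

theorem LinearMap.exists_trace_pow_prime_pow_eq {f : Module.End K V} {n : ℕ} (hn : n ≠ 0)
    (hf : f ^ (n + 1) = f) {p : ℕ} (hp : p.Prime) (N : ℕ) : ∃ y : K, IsIntegral ℤ y ∧
      LinearMap.trace K V f ^ p ^ N = LinearMap.trace K V (f ^ p ^ N) + p * y := by
  have key : ∀ (L : Type _) [Field L] [IsAlgClosed L] [Algebra K L], ∃ y : K, IsIntegral ℤ y ∧
      LinearMap.trace K V f ^ p ^ N = LinearMap.trace K V (f ^ p ^ N) + p * y := by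
    intro L _ _ _
    have : CharZero L := charZero_of_injective_algebraMap (algebraMap K L).injective
    obtain ⟨S, hS, h⟩ := exists_multiset_trace_pow_baseChange L hn hf
    obtain ⟨y, hy, e⟩ := exists_sum_pow_prime_pow_eq hp N S hS
    have hp0 : (p : K) ≠ 0 := by exact_mod_cast hp.ne_zero
    have hpL : (p : L) ≠ 0 := by exact_mod_cast hp.ne_zero
    have e1 : algebraMap K L (LinearMap.trace K V f) = S.sum := by
      rw [← pow_one f, h 1]; simp
    -- The quotient by p is formed in K; its integrality is checked in L, where it becomes the
    -- integral element `y` found for the eigenvalues.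
    refine ⟨(LinearMap.trace K V f ^ p ^ N - LinearMap.trace K V (f ^ p ^ N)) / p, ?_, ?_⟩
    · refine (isIntegral_algebraMap_iff (algebraMap K L).injective).1 ?_
      rwa [map_div₀, map_sub, map_pow, e1, h, map_natCast, e, add_sub_cancel_left,
        mul_div_cancel_left₀ _ hpL]
    · rw [mul_div_cancel₀ _ hp0]
      ring
  exact key (AlgebraicClosure K)

end Trace

/-! ### Character values modulo `p` -/

section CharacterValues

variable {K : Type*} [Field K] [CharZero K] {H V : Type*} [Group H] [Finite H] [AddCommGroup V]
  [Module K V] [FiniteDimensional K V]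

theorem Representation.pow_orderOf_succ (ρ : Representation K H V) (h : H) :
    ρ h ^ (orderOf h + 1) = ρ h := by
  rw [← map_pow, pow_succ, pow_orderOf_eq_one, one_mul]

theorem Representation.isIntegral_character (ρ : Representation K H V) (h : H) :
    IsIntegral ℤ (ρ.character h) :=
  LinearMap.isIntegral_trace_of_pow_succ_eq (orderOf_pos h).ne' (ρ.pow_orderOf_succ h)

/-- The average π of P is a projector commuting with ρ(s), and the quantity is the trace of ρ(s) π,
an operator whose nonzero eigenvalues are roots of unity. -/
theorem Representation.isIntegral_sum_character_div (ρ : Representation K H V) (s : H)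
    (P : Subgroup H) [Fintype P] (hs : ∀ u ∈ P, Commute s u) :
    IsIntegral ℤ ((∑ u : P, ρ.character (s * u)) / (Fintype.card P : K)) := by
  have hP : (Fintype.card P : K) ≠ 0 := by exact_mod_cast Fintype.card_ne_zero
  set π : Module.End K V := (Fintype.card P : K)⁻¹ • ∑ u : P, ρ u with hπ
  have h1 : ∀ u : P, ρ u * π = π := by
    intro u
    rw [hπ, mul_smul_comm, Finset.mul_sum]
    congr 1
    refine Fintype.sum_equiv (Equiv.mulLeft u) _ _ fun w => ?_
    rw [← map_mul]; rfl
  have h2 : π * π = π := by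
    conv_lhs => enter [1]; rw [hπ]
    rw [smul_mul_assoc, Finset.sum_mul, Finset.sum_congr rfl fun u _ => h1 u, Finset.sum_const,
      Finset.card_univ, ← Nat.cast_smul_eq_nsmul K, smul_smul, inv_mul_cancel₀ hP, one_smul]
  have h3 : Commute (ρ s) π := by
    rw [hπ]
    refine (Commute.sum_right _ _ _ fun u _ => ?_).smul_right _
    exact (hs u u.2).map ρ
  have h4 : (ρ s * π) ^ (orderOf s + 1) = ρ s * π := by
    rw [h3.mul_pow, ρ.pow_orderOf_succ, IsIdempotentElem.pow_succ_eq _ h2]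
  convert LinearMap.isIntegral_trace_of_pow_succ_eq (orderOf_pos s).ne' h4 using 1
  rw [hπ, mul_smul_comm, map_smul, Finset.mul_sum, map_sum, smul_eq_mul, div_eq_inv_mul]
  simp only [← map_mul]
  rfl

variable {p : ℕ} [Fact p.Prime] {O : Type*} [CommRing O] [Algebra ℤ_[p] O] [Module.Finite ℤ_[p] O]
  (𝔭 : Ideal O) [h𝔭 : 𝔭.IsMaximal]

variable (p) in
-- By integrality, 𝔭 contracts to a maximal ideal of the local ring ℤ_p, hence to the one generated
-- by p.
theorem natCast_prime_mem : (p : O) ∈ 𝔭 := by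
  have hm : (𝔭.comap (algebraMap ℤ_[p] O)).IsMaximal := Ideal.isMaximal_comap_of_isIntegral_of_isMaximal 𝔭
  have : (p : ℤ_[p]) ∈ 𝔭.comap (algebraMap ℤ_[p] O) := by
    rw [IsLocalRing.eq_maximalIdeal hm, PadicInt.maximalIdeal_eq_span_p]
    exact Ideal.mem_span_singleton_self _
  simpa using this

variable (p) in
theorem charP_residue : CharP (O ⧸ 𝔭) p := by
  have hp : ((p : ℕ) : O ⧸ 𝔭) = 0 := by
    rw [← map_natCast (Ideal.Quotient.mk 𝔭), Ideal.Quotient.eq_zero_iff_mem]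
    exact natCast_prime_mem p 𝔭
  have : Nontrivial (O ⧸ 𝔭) := Ideal.Quotient.nontrivial_iff.2 h𝔭.ne_top
  exact (CharP.charP_iff_prime_eq_zero (Fact.out : p.Prime)).2 hp

theorem natCast_notMem {n : ℕ} (hn : n.Coprime p) : (n : O) ∉ 𝔭 := by
  have := charP_residue p 𝔭
  rw [← Ideal.Quotient.eq_zero_iff_mem, map_natCast, CharP.cast_eq_zero_iff (O ⧸ 𝔭) p]
  intro h
  exact (Fact.out : p.Prime).one_lt.ne' (Nat.eq_one_of_dvd_coprimes hn h dvd_rfl)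

variable [Algebra O K] [Algebra ℤ_[p] K] [IsIntegralClosure O ℤ_[p] K]

include p in
variable (p O) in
theorem exists_algebraMap_eq_of_isIntegral {x : K} (hx : IsIntegral ℤ x) :
    ∃ y : O, algebraMap O K y = x :=
  IsIntegralClosure.isIntegral_iff (A := O) (R := ℤ_[p]).1 hx.tower_top

variable (p) in
-- Raising u s to a power p^N that kills u leaves the same power of s. As Tr(f)^(p^N) and
-- Tr(f^(p^N)) agree modulo p, the two character values have congruent p^N-th powers, and Frobenius
-- is injective on the residue field.
theorem character_mul_sub_mem (ρ : Representation K H V) {u s : H} (hus : Commute u s)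
    (hu : IsPElement p u) {a b : O} (ha : algebraMap O K a = ρ.character (u * s))
    (hb : algebraMap O K b = ρ.character s) : a - b ∈ 𝔭 := by
  obtain ⟨N, hN⟩ := hu
  have hp : p.Prime := Fact.out
  have := charP_residue p 𝔭
  have inj : Function.Injective (algebraMap O K) :=
    IsIntegralClosure.algebraMap_injective O ℤ_[p] K
  obtain ⟨y, hy, ey⟩ := LinearMap.exists_trace_pow_prime_pow_eq (orderOf_pos (u * s)).ne'
    (ρ.pow_orderOf_succ (u * s)) hp N
  obtain ⟨z, hz, ez⟩ := LinearMap.exists_trace_pow_prime_pow_eq (orderOf_pos s).ne'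
    (ρ.pow_orderOf_succ s) hp N
  obtain ⟨y, rfl⟩ := exists_algebraMap_eq_of_isIntegral p O hy
  obtain ⟨z, rfl⟩ := exists_algebraMap_eq_of_isIntegral p O hz
  have e : a ^ p ^ N - b ^ p ^ N = p * (y - z) := by
    apply inj
    simp only [map_sub, map_mul, map_pow, map_natCast, ha, hb]
    change LinearMap.trace K V (ρ (u * s)) ^ p ^ N - LinearMap.trace K V (ρ s) ^ p ^ N = _
    rw [ey, ez, ← map_pow, ← map_pow, hus.mul_pow, ← hN, pow_orderOf_eq_one, one_mul]
    ring
  have h : (Ideal.Quotient.mk 𝔭 (a - b)) ^ p ^ N = 0 := by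
    rw [map_sub, sub_pow_char_pow, ← map_pow, ← map_pow, ← map_sub, e,
      Ideal.Quotient.eq_zero_iff_mem]
    exact Ideal.mul_mem_right _ _ (natCast_prime_mem p 𝔭)
  exact Ideal.Quotient.eq_zero_iff_mem.1 ((pow_eq_zero_iff (pow_ne_zero _ hp.ne_zero)).1 h)

end CharacterValues

/-! ### Lifting idempotents -/

section Lifting

variable {p : ℕ} [Fact p.Prime] {A : Type*} [CommRing A] [Algebra ℤ_[p] A] [Module.Finite ℤ_[p] A]

theorem IsAdicComplete.of_linearEquiv {R M N : Type*} [CommRing R] (I : Ideal R)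
    [AddCommGroup M] [Module R M] [AddCommGroup N] [Module R N] (e : M ≃ₗ[R] N)
    [IsAdicComplete I M] : IsAdicComplete I N := by
  have hmap : ∀ n, ((I ^ n • ⊤ : Submodule R M).map (e : M →ₗ[R] N)) = I ^ n • ⊤ := fun n => by
    rw [Submodule.map_smul'', Submodule.map_top, LinearEquiv.range]
  have hiff : ∀ n x y, x ≡ y [SMOD (I ^ n • ⊤ : Submodule R M)] ↔
      e x ≡ e y [SMOD (I ^ n • ⊤ : Submodule R N)] := fun n x y => by
    rw [SModEq.sub_mem, SModEq.sub_mem, ← hmap, ← map_sub]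
    exact ((Submodule.mem_map_equiv (e := e) _).trans (by simp)).symm
  refine { haus' := fun x hx => ?_, prec' := fun f hf => ?_ }
  · rw [← e.apply_symm_apply x, IsHausdorff.haus (I := I) inferInstance (e.symm x) fun n => ?_, map_zero]
    rw [hiff, e.apply_symm_apply, map_zero]
    exact hx n
  · obtain ⟨y, hy⟩ := IsPrecomplete.prec (I := I) (M := M) inferInstance (f := fun n => e.symm (f n))
      fun {m n} hmn => (hiff _ _ _).2 (by simpa using hf hmn)
    exact ⟨e y, fun n => by simpa using (hiff _ _ _).1 (hy n)⟩

/-- Over a Noetherian ring, the completion of a finite module is its tensor product with the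
completion of the ring, which here is the ring itself. -/
theorem IsAdicComplete.of_finite_aux {R M : Type u} [CommRing R] [IsNoetherianRing R] (I : Ideal R)
    [IsAdicComplete I R] [AddCommGroup M] [Module R M] [Module.Finite R M] : IsAdicComplete I M := by
  rw [← AdicCompletion.of_bijective_iff]
  let e : M ≃ₗ[R] AdicCompletion I R ⊗[R] M := (TensorProduct.lid R M).symm ≪≫ₗ
    TensorProduct.congr (LinearEquiv.ofBijective (AdicCompletion.of I R)
      (AdicCompletion.of_bijective_iff.2 inferInstance)) (LinearEquiv.refl R M)
  have h := (AdicCompletion.ofTensorProduct_bijective_of_finite_of_isNoetherian I M).comp e.bijective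
  convert h using 1
  ext x n
  simp only [e, Function.comp_apply, LinearEquiv.trans_apply, TensorProduct.lid_symm_apply,
    TensorProduct.congr_tmul, AdicCompletion.ofTensorProduct_tmul]
  simp only [LinearEquiv.ofBijective_apply, LinearEquiv.refl_apply, AdicCompletion.of_apply,
    AdicCompletion.smul_eval, AdicCompletion.of_apply]
  exact (one_smul R (Submodule.Quotient.mk x)).symm

/-- A finite module is isomorphic to a quotient of Rⁿ, which lives in the universe of R; this
removes the universe restriction of the previous lemma. -/
theorem IsAdicComplete.of_finite {R : Type u} {M : Type*} [CommRing R] [IsNoetherianRing R]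
    (I : Ideal R) [IsAdicComplete I R] [AddCommGroup M] [Module R M] [Module.Finite R M] :
    IsAdicComplete I M := by
  obtain ⟨n, f, hf⟩ := Module.Finite.exists_fin' R M
  have := IsAdicComplete.of_finite_aux (M := (Fin n → R) ⧸ LinearMap.ker f) I
  exact IsAdicComplete.of_linearEquiv I (f.quotKerEquivOfSurjective hf)

theorem isAdicComplete_span_prime : IsAdicComplete (Ideal.span {(p : A)}) A := by
  have := IsAdicComplete.of_finite (M := A) (IsLocalRing.maximalIdeal ℤ_[p])
  rw [← IsAdicComplete.map_algebraMap_iff (S := A), PadicInt.maximalIdeal_eq_span_p,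
    Ideal.map_span] at this
  simpa using this

/-- Modulo p, the coordinates with respect to finitely many generators over ℤ_p may be replaced by
digits between 0 and p - 1. -/
theorem finite_quotient_span_prime : Finite (A ⧸ Ideal.span {(p : A)}) := by
  obtain ⟨n, f, hf⟩ := Module.Finite.exists_fin' ℤ_[p] A
  let F : (Fin n → Fin p) → A ⧸ Ideal.span {(p : A)} :=
    fun c => Ideal.Quotient.mk _ (f fun i => ((c i : ℕ) : ℤ_[p]))
  refine Finite.of_surjective F fun x => ?_
  obtain ⟨x, rfl⟩ := Ideal.Quotient.mk_surjective x
  obtain ⟨r, rfl⟩ := hf x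
  refine ⟨fun i => ⟨(r i).zmodRepr, PadicInt.zmodRepr_lt_p _⟩, ?_⟩
  have h : ∀ i, ∃ t, r i - (r i).zmodRepr = p * t := fun i => by
    have := PadicInt.sub_zmodRepr_mem (r i)
    rw [PadicInt.maximalIdeal_eq_span_p] at this
    obtain ⟨t, ht⟩ := Ideal.mem_span_singleton'.1 this
    exact ⟨t, by rw [← ht, mul_comm]⟩
  choose t ht using h
  refine (Ideal.Quotient.eq.2 ?_).symm
  rw [← map_sub]
  have e : (r - fun i => (((r i).zmodRepr : ℕ) : ℤ_[p])) = (p : ℤ_[p]) • t := funext fun i => ht i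
  change f (r - fun i => (((r i).zmodRepr : ℕ) : ℤ_[p])) ∈ _
  rw [e, map_smul, Algebra.smul_def, map_natCast]
  exact Ideal.mul_mem_right _ _ (Ideal.mem_span_singleton_self _)

theorem exists_isIdempotentElem_pow {M : Type*} [Monoid M] [Finite M] (x : M) :
    ∃ m : ℕ, m ≠ 0 ∧ IsIdempotentElem (x ^ m) := by
  obtain ⟨i, j, hij, h⟩ := Finite.exists_ne_map_eq_of_infinite (fun n : ℕ => x ^ n)
  wlog hlt : i < j generalizing i j
  · exact this j i hij.symm h.symm (lt_of_le_of_ne (not_lt.1 hlt) hij.symm)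
  obtain ⟨d, rfl⟩ := Nat.exists_eq_add_of_lt hlt
  have h1 : ∀ k, x ^ (i + k) = x ^ (i + k + (d + 1)) := fun k => by
    have h' : x ^ i = x ^ (i + d + 1) := h
    rw [pow_add, h', ← pow_add]; congr 1; omega
  have h2 : ∀ c k, x ^ (i + k) = x ^ (i + k + c * (d + 1)) := fun c => by
    induction c with
    | zero => simp
    | succ c ih =>
      intro k
      rw [ih k, add_assoc i, h1]; congr 1; ring
  -- The powers of x have period d + 1 from the exponent i on; this exponent is a nonzero multiple
  -- of the period and at least i, so doubling it changes nothing.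
  refine ⟨(i + 1) * (d + 1), by positivity, ?_⟩
  have h3 : (i + 1) * (d + 1) = i + (i * d + d + 1) := by ring
  rw [IsIdempotentElem, ← pow_add]
  conv_rhs => rw [h3, h2 (i + 1)]
  rw [← h3]

variable (p) in
-- A power of x is idempotent in the finite ring A / pA, and Hensel's lemma for X² - X lifts it, A
-- being p-adically complete.
theorem exists_isIdempotentElem_sub_pow_mem (x : A) : ∃ m : ℕ, m ≠ 0 ∧ ∃ e : A,
    IsIdempotentElem e ∧ e - x ^ m ∈ Ideal.span {(p : A)} := by
  have := finite_quotient_span_prime (p := p) (A := A)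
  have := isAdicComplete_span_prime (p := p) (A := A)
  obtain ⟨m, hm, h⟩ := exists_isIdempotentElem_pow (Ideal.Quotient.mk (Ideal.span {(p : A)}) x)
  have hx : x ^ m * x ^ m - x ^ m ∈ Ideal.span {(p : A)} := by
    rw [← Ideal.Quotient.eq_zero_iff_mem]
    simpa [sub_eq_zero] using h.eq
  obtain ⟨e, he, hex⟩ := HenselianRing.is_henselian (I := Ideal.span {(p : A)})
    (Polynomial.X ^ 2 - Polynomial.X) (Polynomial.monic_X_pow_sub
      (Polynomial.degree_X_le.trans_lt (by norm_num)))
    (x ^ m) (by simpa [pow_two] using hx) (by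
      -- At an idempotent the derivative 2X - 1 is its own inverse: (2x - 1)² - 1 = 4 (x² - x).
      refine IsUnit.of_mul_eq_one (Ideal.Quotient.mk (Ideal.span {(p : A)}) (2 * x ^ m - 1)) ?_
      rw [← map_mul, ← map_one (Ideal.Quotient.mk _), Ideal.Quotient.eq]
      have : Polynomial.eval (x ^ m) (Polynomial.derivative (Polynomial.X ^ 2 - Polynomial.X)) *
        (2 * x ^ m - 1) - 1 = 4 * (x ^ m * x ^ m - x ^ m) := by
        simp; ring
      rw [this]
      exact Ideal.mul_mem_left _ _ hx)
  refine ⟨m, hm, e, ?_, hex⟩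
  have : e ^ 2 - e = 0 := by simpa using he
  rw [IsIdempotentElem, ← pow_two]
  exact sub_eq_zero.1 this

end Lifting

/-! ### The `p'`-part of an element -/

section PPrimePart

variable {p : ℕ} {G : Type u} [Group G]

/-- The Chinese remainder theorem gives an exponent that is 0 modulo the order of u and 1 modulo the
order of s. In particular C_G(g) is contained in C_G(s). -/
theorem IsPPrimePart.exists_pow_eq [Fact p.Prime] {g s : G} (h : IsPPrimePart p g s) :
    ∃ m : ℕ, g ^ m = s := by
  obtain ⟨u, h1, h2, ⟨n, hn⟩, hs⟩ := h
  have hc : Commute u s := h1.symm.trans h2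
  have hcop : (orderOf u).Coprime (orderOf s) := by
    rw [hn]; exact (Nat.Coprime.pow_right n hs).symm
  obtain ⟨k, hk0, hk1⟩ := Nat.chineseRemainder hcop 0 1
  refine ⟨k, ?_⟩
  rw [h1, hc.mul_pow, (pow_eq_pow_iff_modEq (n := k) (m := 0)).2 hk0,
    (pow_eq_pow_iff_modEq (n := k) (m := 1)).2 hk1, pow_zero, one_mul, pow_one]

theorem IsPPrimePart.mem_cent [Fact p.Prime] {g s c : G} (h : IsPPrimePart p g s)
    (hc : c ∈ Cent g) : c ∈ Cent s := by
  obtain ⟨m, rfl⟩ := h.exists_pow_eq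
  rw [Subgroup.mem_centralizer_singleton_iff] at hc ⊢
  exact (Commute.pow_right (show Commute c g from hc) m).eq

theorem IsPPrimePart.isPPrimeElement {g s : G} (h : IsPPrimePart p g s) : IsPPrimeElement p s := by
  obtain ⟨u, h1, h2, h3, h4⟩ := h
  exact h4

theorem IsPPrimePart.conj {g s : G} (h : IsPPrimePart p g s) (x : G) :
    IsPPrimePart p (x * g * x⁻¹) (x * s * x⁻¹) := by
  obtain ⟨u, h1, h2, ⟨n, hn⟩, h4⟩ := h
  have ho : ∀ y : G, orderOf (x * y * x⁻¹) = orderOf y := fun y => by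
    rw [← MulAut.conj_apply]; exact MulEquiv.orderOf_eq _ _
  refine ⟨x * u * x⁻¹, ?_, ?_, ⟨n, (ho u).trans hn⟩, ?_⟩
  · rw [h1]; group
  · rw [h2]; group
  · rw [IsPPrimeElement, ho]; exact h4

/-- Both candidates are powers of g, so everything commutes; s t⁻¹ equals a quotient of the two
p-parts, and its order is both prime to p and a power of p. -/
theorem IsPPrimePart.unique [Fact p.Prime] {g s t : G} (hs : IsPPrimePart p g s)
    (ht : IsPPrimePart p g t) : s = t := by
  obtain ⟨k, hk⟩ := hs.exists_pow_eq
  obtain ⟨l, hl⟩ := ht.exists_pow_eq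
  have hst : Commute s t := by rw [← hk, ← hl]; exact Commute.pow_pow_self g k l
  have hgs : Commute g s := by rw [← hk]; exact Commute.self_pow g k
  have hgt : Commute g t := by rw [← hl]; exact Commute.self_pow g l
  obtain ⟨u, h1, h2, ⟨n, hn⟩, h4⟩ := hs
  obtain ⟨w, h1', h2', ⟨n', hn'⟩, h4'⟩ := ht
  have hu : u = g * s⁻¹ := by rw [h1]; group
  have hw : w = g * t⁻¹ := by rw [h1']; group
  have huw : Commute w u := by
    rw [hu, hw]
    exact ((Commute.refl g).mul_right hgs.inv_right).mul_left
      (hgt.symm.inv_left.mul_right (hst.symm.inv_inv))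
  have e : s * t⁻¹ = w * u⁻¹ := by
    rw [hu, hw, mul_inv_rev, inv_inv]
    have : t⁻¹ * (s * g⁻¹) = s * t⁻¹ * g⁻¹ := by
      rw [← mul_assoc, hst.inv_right.symm.eq]
    rw [mul_assoc, this, ← mul_assoc, (hgs.mul_right hgt.inv_right).eq, mul_inv_cancel_right]
  have o1 : orderOf (s * t⁻¹) ∣ orderOf s * orderOf t := by
    refine (hst.inv_right.orderOf_mul_dvd_mul_orderOf).trans ?_
    rw [orderOf_inv]
  have o2 : orderOf (w * u⁻¹) ∣ p ^ n' * p ^ n := by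
    refine (huw.inv_right.orderOf_mul_dvd_mul_orderOf).trans ?_
    rw [orderOf_inv, hn, hn']
  rw [← e, ← pow_add] at o2
  have : orderOf (s * t⁻¹) = 1 :=
    Nat.eq_one_of_dvd_coprimes ((Nat.Coprime.mul_left h4 h4').pow_right (n' + n)) o1 o2
  exact mul_inv_eq_one.1 (orderOf_eq_one_iff.1 this)

theorem exists_isPPrimePart [Finite G] [Fact p.Prime] (g : G) : ∃ s, IsPPrimePart p g s := by
  have hp : p.Prime := Fact.out
  have h0 : orderOf g ≠ 0 := (orderOf_pos g).ne'
  obtain ⟨n, m, hm, he⟩ := Nat.exists_eq_pow_mul_and_not_dvd h0 p hp.ne_one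
  have hcop : (p ^ n).Coprime m := ((Nat.Prime.coprime_iff_not_dvd hp).2 hm).pow_left n
  have hm0 : m ≠ 0 := by rintro rfl; simp at hm
  -- The order of g is p^n m with m prime to p; g^k will be the p'-part and g^l the p-part.
  obtain ⟨k, hk0, hk1⟩ := Nat.chineseRemainder hcop 0 1
  obtain ⟨l, hl0, hl1⟩ := Nat.chineseRemainder hcop 1 0
  have hkl : g ^ l * g ^ k = g := by
    rw [← pow_add]
    conv_rhs => rw [← pow_one g]
    rw [pow_eq_pow_iff_modEq, he]
    exact (Nat.modEq_and_modEq_iff_modEq_mul hcop).1 ⟨hl0.add hk0, hl1.add hk1⟩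
  refine ⟨g ^ k, g ^ l, hkl.symm, ?_, ?_, ?_⟩
  · rw [← pow_add, add_comm, pow_add, hkl]
  · have : orderOf (g ^ l) ∣ p ^ n := by
      rw [orderOf_dvd_iff_pow_eq_one, ← pow_mul, ← orderOf_dvd_iff_pow_eq_one, he, mul_comm l]
      exact mul_dvd_mul_left _ ((Nat.modEq_zero_iff_dvd).1 hl1)
    obtain ⟨i, -, hi⟩ := (Nat.dvd_prime_pow hp).1 this
    exact ⟨i, hi⟩
  · have : orderOf (g ^ k) ∣ m := by
      rw [orderOf_dvd_iff_pow_eq_one, ← pow_mul, ← orderOf_dvd_iff_pow_eq_one, he]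
      exact mul_dvd_mul_right ((Nat.modEq_zero_iff_dvd).1 hk0) m
    exact Nat.Coprime.coprime_dvd_left this ((Nat.Prime.coprime_iff_not_dvd hp).2 hm).symm

theorem IsPPrimeElement.isPPrimePart {s : G} (h : IsPPrimeElement p s) : IsPPrimePart p s s :=
  ⟨1, (one_mul s).symm, (mul_one s).symm, ⟨0, by simp⟩, h⟩

end PPrimePart

/-! ### The integral form of the homomorphisms to group algebras -/

section Integral

variable {p : ℕ} [Fact p.Prime] {G : Type u} [Group G] [Fintype G] {K : Type v} [Field K]
  [CharZero K] {O : Type v} [CommRing O] [Algebra ℤ_[p] O] [Module.Finite ℤ_[p] O] [Algebra O K]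
  [Algebra ℤ_[p] K] [IsIntegralClosure O ℤ_[p] K]

/-- The extension of scalars `O ⊗ K_G(G) → K ⊗ K_G(G)`. -/
def extendScalars (O : Type v) [CommRing O] (G : Type u) [Group G] [Fintype G] (K : Type v)
    [Field K] [Algebra O K] : O ⊗[ℤ] KGG G K →ₐ[ℤ] K ⊗[ℤ] KGG G K :=
  Algebra.TensorProduct.map ((algebraMap O K).toIntAlgHom) (AlgHom.id ℤ (KGG G K))

theorem extendScalars_tmul (r : O) (x : KGG G K) :
    extendScalars O G K (r ⊗ₜ x) = algebraMap O K r ⊗ₜ x := rfl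

include p in
variable (p) in
theorem algebraMap_injective_of_isIntegralClosure : Function.Injective (algebraMap O K) :=
  IsIntegralClosure.algebraMap_injective O ℤ_[p] K

theorem repr_extendScalars (hsplit : ∀ H : Subgroup G, IsSplitGroupAlgebra K H)
    (a : O ⊗[ℤ] KGG G K) (q : MSet G K) :
    (tensorBasis hsplit K).repr (extendScalars O G K a) q =
      algebraMap O K ((tensorBasis hsplit O).repr a q) := by
  induction a using TensorProduct.induction_on with
  | zero => simp
  | tmul r x =>
    rw [extendScalars_tmul, tensorBasis, tensorBasis, Algebra.TensorProduct.basis_repr_tmul,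
      Algebra.TensorProduct.basis_repr_tmul]
    simp [Algebra.smul_def]
  | add a b ha hb => simp [ha, hb]

include p in
variable (p) in
theorem extendScalars_injective (hsplit : ∀ H : Subgroup G, IsSplitGroupAlgebra K H) :
    Function.Injective (extendScalars O G K) := by
  refine (injective_iff_map_eq_zero _).2 fun a ha => ?_
  refine (tensorBasis hsplit O).ext_elem fun q => ?_
  apply algebraMap_injective_of_isIntegralClosure p (O := O) (K := K)
  rw [← repr_extendScalars, ha]
  simp

theorem EqBundle.tr_eq_character (V : EqBundle G K) {g x : G} (h : g ∈ Cent x) :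
    V.tr g x = (V.fibreRep x).character ⟨g, h⟩ :=
  V.tr_eq (mul_inv_eq_iff_eq_mul.2 (Subgroup.mem_centralizer_singleton_iff.1 h))

/-- Extension of scalars on group algebras. -/
abbrev groupAlgebraMap (O : Type v) [CommRing O] (K : Type v) [Field K] [Algebra O K] (H : Type*)
    [Group H] : MonoidAlgebra O H →+* MonoidAlgebra K H := mapRingHom H (algebraMap O K)

include p in
variable (p) in
theorem groupAlgebraMap_injective (H : Type*) [Group H] :
    Function.Injective (groupAlgebraMap O K H) := by
  intro a b h
  ext x
  apply algebraMap_injective_of_isIntegralClosure p (O := O) (K := K)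
  simpa using congrArg (fun z => z.coeff x) h

include p in
-- The coefficients on a bundle are character values of centralizers on its fibres, hence integral
-- over ℤ and so in O.
theorem phiK_extendScalars_mem_range (g : G) (a : O ⊗[ℤ] KGG G K) :
    phiK K g (extendScalars O G K a) ∈ (groupAlgebraMap O K (Cent g)).range := by
  induction a using TensorProduct.induction_on with
  | zero => rw [map_zero, map_zero]; exact zero_mem _
  | add a b ha hb => rw [map_add, map_add]; exact add_mem ha hb
  | tmul r x =>
    rw [extendScalars_tmul, phiK_tmul]
    have h1 : phi K g x ∈ (groupAlgebraMap O K (Cent g)).range := by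
      induction x using EqBundle.kgg_induction with
      | zero => rw [map_zero]; exact zero_mem _
      | add a b ha hb => rw [map_add]; exact add_mem ha hb
      | neg a ha => rw [map_neg]; exact neg_mem ha
      | cls V =>
        have : ∀ x : Cent g, ∃ y : O, algebraMap O K y = V.tr g x := fun x => by
          rw [V.tr_eq_character (mem_cent_comm.1 x.2)]
          exact exists_algebraMap_eq_of_isIntegral p O (Representation.isIntegral_character _ _)
        choose y hy using this
        refine ⟨ofFun y, ?_⟩
        rw [phi_cls]
        ext x
        simp [hy]
    obtain ⟨y, hy⟩ := h1
    refine ⟨r • y, ?_⟩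
    rw [← hy]
    ext x
    simp [Algebra.smul_def]

/-- The ring homomorphism `O ⊗ K_G(G) → O C_G(g)`, `V ↦ ∑_{x ∈ C_G(g)} Tr(g | V_x) x`. -/
def phiO (p : ℕ) [Fact p.Prime] {G : Type u} [Group G] [Fintype G] (K : Type v) [Field K]
    [CharZero K] (O : Type v) [CommRing O] [Algebra ℤ_[p] O] [Module.Finite ℤ_[p] O] [Algebra O K]
    [Algebra ℤ_[p] K] [IsIntegralClosure O ℤ_[p] K] (g : G) :
    O ⊗[ℤ] KGG G K →+* MonoidAlgebra O (Cent g) :=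
  ((RingEquiv.ofBijective (groupAlgebraMap O K (Cent g)).rangeRestrict
    ⟨fun _ _ h => groupAlgebraMap_injective p _ (congrArg Subtype.val h),
      (groupAlgebraMap O K (Cent g)).rangeRestrict_surjective⟩).symm.toRingHom).comp
    (((phiK K g).toRingHom.comp (extendScalars O G K).toRingHom).codRestrict
      (groupAlgebraMap O K (Cent g)).range (phiK_extendScalars_mem_range (p := p) g))

theorem groupAlgebraMap_phiO (g : G) (a : O ⊗[ℤ] KGG G K) :
    groupAlgebraMap O K (Cent g) (phiO p K O g a) = phiK K g (extendScalars O G K a) :=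
  congrArg Subtype.val (RingEquiv.apply_symm_apply (RingEquiv.ofBijective
    (groupAlgebraMap O K (Cent g)).rangeRestrict
    ⟨fun _ _ h => groupAlgebraMap_injective p _ (congrArg Subtype.val h),
      (groupAlgebraMap O K (Cent g)).rangeRestrict_surjective⟩)
    ⟨phiK K g (extendScalars O G K a), phiK_extendScalars_mem_range (p := p) g a⟩)

theorem algebraMap_coeff_phiO (g : G) (a : O ⊗[ℤ] KGG G K) (c : Cent g) :
    algebraMap O K ((phiO p K O g a).coeff c) = (phiK K g (extendScalars O G K a)).coeff c := by
  rw [← groupAlgebraMap_phiO (p := p)]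
  simp

theorem phiO_mem_center (g : G) (a : O ⊗[ℤ] KGG G K) :
    phiO p K O g a ∈ Subring.center (MonoidAlgebra O (Cent g)) := by
  refine mem_center_iff.2 fun h x => ?_
  apply algebraMap_injective_of_isIntegralClosure p (O := O) (K := K)
  rw [algebraMap_coeff_phiO, algebraMap_coeff_phiO]
  exact mem_center_iff.1 (phiK_mem_center g _) h x

theorem conjCent_injective (x : G) {g g' : G} (hx : x * g * x⁻¹ = g') :
    Function.Injective (conjCent x hx) := fun a b h => by
  have := congrArg (Subtype.val) h
  exact Subtype.ext (by simpa [conjCent] using this)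

theorem mapDomain_conjCent_phiO (x : G) {g g' : G} (hx : x * g * x⁻¹ = g') (a : O ⊗[ℤ] KGG G K) :
    mapDomainRingHom O (conjCent x hx) (phiO p K O g a) = phiO p K O g' a := by
  ext c
  obtain ⟨c, rfl⟩ := conjCent_surjective x hx c
  apply algebraMap_injective_of_isIntegralClosure p (O := O) (K := K)
  rw [algebraMap_coeff_phiO, coeff_phiK_conj, ← algebraMap_coeff_phiO (p := p)]
  congr 1
  exact Finsupp.mapDomain_apply (conjCent_injective x hx) _ _

theorem eq_of_forall_phiO (hsplit : ∀ H : Subgroup G, IsSplitGroupAlgebra K H)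
    {a b : O ⊗[ℤ] KGG G K} (h : ∀ g, phiO p K O g a = phiO p K O g b) : a = b := by
  apply extendScalars_injective p hsplit
  rw [← sub_eq_zero]
  refine eq_zero_of_forall_phiK hsplit fun g => ?_
  rw [map_sub, ← groupAlgebraMap_phiO (p := p), ← groupAlgebraMap_phiO (p := p), h, sub_self]

theorem phiO_tmul (g : G) (r : O) (x : KGG G K) :
    phiO p K O g (r ⊗ₜ x) = r • phiO p K O g (1 ⊗ₜ x) := by
  ext c
  apply algebraMap_injective_of_isIntegralClosure p (O := O) (K := K)
  simp [algebraMap_coeff_phiO, extendScalars_tmul, phiK_tmul, Algebra.smul_def]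

variable (𝔭 : Ideal O) [𝔭.IsMaximal]

/-- For fixed c, the elements g and s and their quotient, a p-element, all lie in C_G(c) and act on
the fibre at c; the congruence is the one for the character of that representation. -/
theorem coeff_phiO_sub_mem {g s : G} (h : IsPPrimePart p g s) (a : O ⊗[ℤ] KGG G K) {c : G}
    (hg : c ∈ Cent g) (hs : c ∈ Cent s) :
    (phiO p K O g a).coeff ⟨c, hg⟩ - (phiO p K O s a).coeff ⟨c, hs⟩ ∈ 𝔭 := by
  induction a using TensorProduct.induction_on with
  | zero => simp
  | add a b ha hb =>
    rw [map_add, map_add, coeff_add, coeff_add, Finsupp.add_apply, Finsupp.add_apply,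
      add_sub_add_comm]
    exact add_mem ha hb
  | tmul r x =>
    rw [phiO_tmul g, phiO_tmul s, coeff_smul, coeff_smul, Finsupp.smul_apply, Finsupp.smul_apply,
      ← smul_sub]
    refine Ideal.mul_mem_left _ _ ?_
    induction x using EqBundle.kgg_induction with
    | zero => simp
    | add a b ha hb =>
      rw [TensorProduct.tmul_add, map_add, map_add, coeff_add, coeff_add, Finsupp.add_apply,
        Finsupp.add_apply, add_sub_add_comm]
      exact add_mem ha hb
    | neg a ha =>
      rw [TensorProduct.tmul_neg, map_neg, map_neg, coeff_neg, coeff_neg, Finsupp.neg_apply,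
        Finsupp.neg_apply, ← neg_sub', neg_mem_iff]
      exact ha
    | cls V =>
      obtain ⟨u, h1, h2, hu, hs'⟩ := h
      have hus : u * s = s * u := h1.symm.trans h2
      have hsc : s ∈ Cent c := mem_cent_comm.1 hs
      have hgc : g ∈ Cent c := mem_cent_comm.1 hg
      have huc : u ∈ Cent c := by
        have : u = g * s⁻¹ := by rw [h1]; group
        rw [this]; exact mul_mem hgc (inv_mem hsc)
      have hu' : IsPElement p (⟨u, huc⟩ : Cent c) := by
        obtain ⟨n, hn⟩ := hu
        exact ⟨n, by rw [Subgroup.orderOf_mk, hn]⟩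
      refine character_mul_sub_mem p 𝔭 (V.fibreRep c) (u := ⟨u, huc⟩) (s := ⟨s, hsc⟩)
        (Subtype.ext hus) hu' ?_ ?_
      · rw [algebraMap_coeff_phiO, extendScalars_tmul, phiK_tmul, map_one, one_smul, phi_cls,
          coeff_ofFun, V.tr_eq_character hgc]
        congr 1
        exact Subtype.ext h1
      · rw [algebraMap_coeff_phiO, extendScalars_tmul, phiK_tmul, map_one, one_smul, phi_cls,
          coeff_ofFun, V.tr_eq_character hsc]

theorem coeff_brauerMap {Λ : Type v} [CommRing Λ] {s g : G} (a : MonoidAlgebra Λ (Cent s)) {c : G}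
    (hg : c ∈ Cent g) (hs : c ∈ Cent s) :
    (brauerMap Λ s g a).coeff ⟨c, hg⟩ = a.coeff ⟨c, hs⟩ := by
  classical
  rw [brauerMap, Finsupp.sum, coeff_sum, Finsupp.finsetSum_apply, Finset.sum_eq_single ⟨c, hs⟩]
  · rw [dif_pos hg, coeff_single, Finsupp.single_eq_same]
  · intro d _ hd
    by_cases hdg : (d : G) ∈ Cent g
    · rw [dif_pos hdg, coeff_single, Finsupp.single_eq_of_ne]
      intro h
      exact hd (Subtype.ext (congrArg Subtype.val h).symm)
    · simp [dif_neg hdg]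
  · intro h
    simp [Finsupp.notMem_support_iff.1 h]

theorem coeff_reduction {H : Type u} [Group H] (a : MonoidAlgebra O H) (x : H) :
    (reduction 𝔭 H a).coeff x = Ideal.Quotient.mk 𝔭 (a.coeff x) := by
  simp [reduction]

/-- The origin of the Brauer map: replacing g by its p'-part does not change the coefficients modulo
𝔭, and all that remains is to restrict them from C_G(s) to C_G(g). -/
theorem reduction_phiO {g s : G} (h : IsPPrimePart p g s) (a : O ⊗[ℤ] KGG G K) :
    reduction 𝔭 (Cent g) (phiO p K O g a) =
      brauerMap (O ⧸ 𝔭) s g (reduction 𝔭 (Cent s) (phiO p K O s a)) := by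
  ext ⟨c, hg⟩
  rw [coeff_brauerMap _ hg (h.mem_cent hg), coeff_reduction, coeff_reduction, Ideal.Quotient.eq]
  exact coeff_phiO_sub_mem 𝔭 h a hg _

end Integral

/-! ### Approximating elements of centers of group algebras -/

section Approximation

theorem isPElement_of_isPGroup {p : ℕ} {H : Type*} [Group H] {P : Subgroup H} (hP : IsPGroup p P)
    {u : H} (hu : u ∈ P) [Fact p.Prime] : IsPElement p u := by
  obtain ⟨k, hk⟩ := (IsPGroup.iff_orderOf.1 hP) ⟨u, hu⟩
  exact ⟨k, by rw [← hk, Subgroup.orderOf_mk]⟩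

variable {p : ℕ} [Fact p.Prime] {K : Type v} [Field K]
  [CharZero K] {O : Type v} [CommRing O] [Algebra ℤ_[p] O] [Module.Finite ℤ_[p] O] [Algebra O K]
  [Algebra ℤ_[p] K] [IsIntegralClosure O ℤ_[p] K]

/-- Being conjugate to t, the product u s is a p'-element, so it is its own p'-part; but its p'-part
is s. -/
theorem IsPPrimeElement.eq_of_isConj_mul {H : Type*} [Group H] {s t u : H}
    (hs : IsPPrimeElement p s) (ht : IsPPrimeElement p t) (hu : IsPElement p u) (hus : Commute u s)
    (h : IsConj (u * s) t) : u = 1 := by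
  have h1 : IsPPrimeElement p (u * s) := by
    rw [isConj_iff] at h
    obtain ⟨c, hc⟩ := h
    rw [IsPPrimeElement, ← hc, ← MulAut.conj_apply, MulEquiv.orderOf_eq] at ht
    exact ht
  have h2 : IsPPrimePart p (u * s) s := ⟨u, rfl, hus.eq, hu, hs⟩
  have := h2.unique h1.isPPrimePart
  simpa using this.symm

/-- Column orthogonality with the coefficients η(s⁻¹) isolates the class of s, but with value
|C_H(s)|, possibly divisible by p. Averaging the coefficients η(s⁻¹ u) over a Sylow p-subgroup P of
C_H(s) keeps them in O and divides this value by |P|. The terms with u ≠ 1 live on the classes of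
the u⁻¹ s, which contain no p'-element. The value left is the index of P, prime to p. -/
theorem exists_integral_combination (O : Type v) [CommRing O] [Algebra ℤ_[p] O]
    [Module.Finite ℤ_[p] O] [Algebra O K] [IsIntegralClosure O ℤ_[p] K]
    {H : Type*} [Group H] [Fintype H] (hs : IsSplitGroupAlgebra K H)
    [Fintype (IrrChar K H)] {s : H} (hsp : IsPPrimeElement p s) :
    ∃ (θ : IrrChar K H → O) (n : ℕ), n.Coprime p ∧ ∀ t, IsPPrimeElement p t →
      (IsConj s t → ∑ η, algebraMap O K (θ η) * η.1 t = n) ∧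
      (¬ IsConj s t → ∑ η, algebraMap O K (θ η) * η.1 t = 0) := by
  classical
  let S : Sylow p (Subgroup.centralizer {s}) := default
  let P : Subgroup H := (S : Subgroup (Subgroup.centralizer {s})).map (Subgroup.subtype _)
  have hPp : IsPGroup p P := S.isPGroup'.map _
  have hPs : ∀ u ∈ P, Commute u s := by
    rintro _ ⟨u, -, rfl⟩
    exact Subgroup.mem_centralizer_singleton_iff.1 u.2
  have hcard : Nat.card P = Nat.card S := Subgroup.card_map_of_injective (Subgroup.subtype_injective _)
  have hP0 : (Nat.card P : K) ≠ 0 := by exact_mod_cast Nat.card_pos.ne'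
  have hθ_integral : ∀ η : IrrChar K H, ∃ y : O, algebraMap O K y =
      (∑ u : P, η.1 (s⁻¹ * u)) / (Fintype.card P : K) := by
    rintro ⟨_, n, ρ, hρ, rfl⟩
    exact exists_algebraMap_eq_of_isIntegral p O
      (ρ.isIntegral_sum_character_div s⁻¹ P fun u hu => (hPs u hu).symm.inv_left)
  choose θ hθ using hθ_integral
  have key : ∀ t, IsPPrimeElement p t → ∑ η, algebraMap O K (θ η) * η.1 t =
      (if IsConj s t then (Nat.card (Subgroup.centralizer {s}) : K) else 0) / Nat.card P := by
    intro t ht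
    simp only [hθ, ← Nat.card_eq_fintype_card (α := P), div_mul_eq_mul_div, ← Finset.sum_div]
    congr 1
    simp only [Finset.sum_mul]
    rw [Finset.sum_comm, Finset.sum_eq_single (1 : P)]
    · simpa using sum_irrChar_mul hs s t
    · intro u _ hu
      have := sum_irrChar_mul hs ((u : H)⁻¹ * s) t
      rw [mul_inv_rev, inv_inv] at this
      rw [this, if_neg]
      intro hc
      have hu' : IsPElement p (u : H)⁻¹ := isPElement_of_isPGroup hPp (inv_mem u.2)
      have := hsp.eq_of_isConj_mul ht hu' (hPs u u.2).inv_left hc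
      exact hu (Subtype.ext (by simpa using this))
    · simp
  refine ⟨θ, (S : Subgroup (Subgroup.centralizer {s})).index, ?_, fun t ht => ⟨fun h => ?_, fun h => ?_⟩⟩
  · exact ((Nat.Prime.coprime_iff_not_dvd Fact.out).2 S.not_dvd_index).symm
  · rw [key t ht, if_pos h, div_eq_iff hP0, hcard,
      ← Subgroup.card_mul_index (S : Subgroup (Subgroup.centralizer {s}))]
    push_cast
    exact mul_comm _ _
  · rw [key t ht, if_neg h, zero_div]

variable {G : Type u} [Group G] [Fintype G] (hsplit : ∀ H : Subgroup G, IsSplitGroupAlgebra K H)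
  (𝔭 : Ideal O) [h𝔭 : 𝔭.IsMaximal]

include hsplit in
-- Bundles supported on the class of c, weighted by the preceding combination for s in C_G(c), give
-- modulo 𝔭 the indicator function of the G-orbit of the commuting pair (s, c), among pairs whose
-- first entry is a p'-element.
theorem exists_coeff_phiO_sub_ite_mem {s c : G} (hs : IsPPrimeElement p s) (hc : c ∈ Cent s) :
    ∃ a : O ⊗[ℤ] KGG G K, ∀ t, IsPPrimeElement p t → ∀ y : Cent t,
      ((∃ x : G, x * s * x⁻¹ = t ∧ x * c * x⁻¹ = y) → (phiO p K O t a).coeff y - 1 ∈ 𝔭) ∧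
      ((¬ ∃ x : G, x * s * x⁻¹ = t ∧ x * c * x⁻¹ = y) → (phiO p K O t a).coeff y ∈ 𝔭) := by
  classical
  have := finite_irrChar (hsplit (Cent c))
  let _ := Fintype.ofFinite (IrrChar K (Cent c))
  have hsc : s ∈ Cent c := mem_cent_comm.1 hc
  have hs' : IsPPrimeElement p (⟨s, hsc⟩ : Cent c) := by
    rw [IsPPrimeElement, Subgroup.orderOf_mk]; exact hs
  obtain ⟨θ, n, hn, hθ⟩ := exists_integral_combination O (hsplit (Cent c)) hs'
  -- `m` inverts the index `n` modulo 𝔭 and normalizes the value to 1.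
  obtain ⟨m, hm⟩ : ∃ m : O, m * n - 1 ∈ 𝔭 := by
    obtain ⟨m, i, hi, h⟩ := (Ideal.IsMaximal.exists_inv h𝔭 (natCast_notMem (p := p) 𝔭 hn))
    exact ⟨m, by rw [← h]; simpa using hi⟩
  let Q : IrrChar K (Cent c) → IrrPair G K := fun η => ⟨c, η.1, η.2⟩
  let a : O ⊗[ℤ] KGG G K := ∑ η, (m * θ η) ⊗ₜ[ℤ] (Q η).bundle.cls
  have ha : ∀ t (y : Cent t), algebraMap O K ((phiO p K O t a).coeff y) =
      algebraMap O K m * ∑ η, algebraMap O K (θ η) * (Q η).bundle.tr t y := by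
    intro t y
    rw [algebraMap_coeff_phiO]
    simp only [a, map_sum, extendScalars_tmul, phiK_tmul, phi_cls, coeff_sum,
      Finsupp.finsetSum_apply, coeff_smul, Finsupp.smul_apply, coeff_ofFun, smul_eq_mul, map_mul,
      Finset.mul_sum, mul_assoc]
  have inj := algebraMap_injective_of_isIntegralClosure p (O := O) (K := K)
  refine ⟨a, fun t ht y => ?_⟩
  by_cases hy : ∃ x, x * c * x⁻¹ = (y : G)
  · obtain ⟨x, hx⟩ := hy
    have htc : x⁻¹ * t * x ∈ Cent c := by
      have h1 : t ∈ Cent (y : G) := mem_cent_comm.1 y.2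
      have := conj_mem_cent (x := x⁻¹) (g' := c) (by rw [← hx]; group) h1
      simpa using this
    have ht' : IsPPrimeElement p (⟨x⁻¹ * t * x, htc⟩ : Cent c) := by
      rw [IsPPrimeElement, Subgroup.orderOf_mk]
      have := MulEquiv.orderOf_eq (MulAut.conj x⁻¹) t
      rw [MulAut.conj_apply, inv_inv] at this
      rw [this]; exact ht
    have htr : ∀ η, (Q η).bundle.tr t y = η.1 ⟨x⁻¹ * t * x, htc⟩ := by
      intro η
      rw [← hx, IrrPair.bundle, EqBundle.tr_ind, IrrPair.rep_character, extZero, dif_pos htc]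
    -- Conjugacy inside C_G(c), after moving y back to c, is simultaneous conjugacy of the pairs (s,
    -- c) and (t, y).
    have hiff : IsConj (⟨s, hsc⟩ : Cent c) ⟨x⁻¹ * t * x, htc⟩ ↔
        ∃ x : G, x * s * x⁻¹ = t ∧ x * c * x⁻¹ = y := by
      rw [isConj_iff]
      constructor
      · rintro ⟨h, hh⟩
        have hh' : (h : G) * s * (h : G)⁻¹ = x⁻¹ * t * x := congrArg Subtype.val hh
        refine ⟨x * h, ?_, ?_⟩
        · calc x * h * s * (x * h)⁻¹ = x * (h * s * (h : G)⁻¹) * x⁻¹ := by group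
            _ = t := by rw [hh']; group
        · have hhc := Subgroup.mem_centralizer_singleton_iff.1 h.2
          calc x * h * c * (x * h)⁻¹ = x * (h * c * (h : G)⁻¹) * x⁻¹ := by group
            _ = y := by rw [hhc, mul_inv_cancel_right, hx]
      · rintro ⟨z, hz, hzc⟩
        refine ⟨⟨x⁻¹ * z, ?_⟩, Subtype.ext ?_⟩
        · rw [Subgroup.mem_centralizer_singleton_iff]
          have : z * c = x * c * x⁻¹ * z := by rw [hx, ← hzc]; group
          rw [mul_assoc, this]; group
        · change x⁻¹ * z * s * (x⁻¹ * z)⁻¹ = x⁻¹ * t * x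
          rw [← hz]; group
    constructor
    · intro h
      have e : (phiO p K O t a).coeff y = m * n := by
        apply inj
        rw [ha, map_mul, map_natCast]
        simp only [htr]
        rw [(hθ _ ht').1 (hiff.2 h)]
      rwa [e]
    · intro h
      have e : (phiO p K O t a).coeff y = 0 := by
        apply inj
        rw [ha, map_zero]
        simp only [htr]
        rw [(hθ _ ht').2 (fun h' => h (hiff.1 h')), mul_zero]
      rw [e]; exact zero_mem _
  · refine ⟨fun ⟨x, _, h⟩ => absurd ⟨x, h⟩ hy, fun _ => ?_⟩
    have e : (phiO p K O t a).coeff y = 0 := by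
      apply inj
      rw [ha, map_zero, Finset.sum_eq_zero, mul_zero]
      intro η _
      rw [IrrPair.bundle, EqBundle.tr_ind_of_not_isConj _ _ _ _ hy, mul_zero]
    rw [e]; exact zero_mem _

include hsplit in
-- For fixed s, the orbit of (s, c) cuts out the C_G(s)-class of c; so the previous lemma produces
-- the class sums modulo 𝔭, and `z` is a combination of class sums. At a p'-element not conjugate to
-- s all these indicators vanish.
theorem exists_reduction_phiO_eq {s : G} (hs : IsPPrimeElement p s) {z : MonoidAlgebra O (Cent s)}
    (hz : z ∈ Subring.center (MonoidAlgebra O (Cent s))) :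
    ∃ a : O ⊗[ℤ] KGG G K, reduction 𝔭 _ (phiO p K O s a) = reduction 𝔭 _ z ∧
      ∀ t, IsPPrimeElement p t → ¬ IsConj s t → reduction 𝔭 _ (phiO p K O t a) = 0 := by
  classical
  have hex := fun κ : ConjClasses (Cent s) =>
    exists_coeff_phiO_sub_ite_mem hsplit 𝔭 hs (Quotient.out κ).2
  choose b hb using hex
  let _ := Fintype.ofFinite (ConjClasses (Cent s))
  let r : ConjClasses (Cent s) → O := fun κ => z.coeff (Quotient.out κ)
  have hcoeff : ∀ t (y : Cent t), (phiO p K O t (∑ κ, (r κ ⊗ₜ[ℤ] 1) * b κ)).coeff y =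
      ∑ κ, r κ * (phiO p K O t (b κ)).coeff y := by
    intro t y
    rw [map_sum, coeff_sum, Finsupp.finsetSum_apply]
    refine Finset.sum_congr rfl fun κ _ => ?_
    rw [map_mul, phiO_tmul, ← Algebra.TensorProduct.one_def, map_one, smul_one_mul, coeff_smul,
      Finsupp.smul_apply, smul_eq_mul]
  refine ⟨∑ κ, (r κ ⊗ₜ[ℤ] 1) * b κ, ?_, fun t ht hst => ?_⟩
  · ext y
    rw [coeff_reduction, coeff_reduction, hcoeff, map_sum,
      Finset.sum_eq_single (ConjClasses.mk y), map_mul]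
    · have hy : IsConj (Quotient.out (ConjClasses.mk y)) y :=
        ConjClasses.mk_eq_mk_iff_isConj.1 (Quotient.out_eq (ConjClasses.mk y))
      obtain ⟨x, hx⟩ := isConj_iff.1 hy
      have h1 := (hb (ConjClasses.mk y) s hs y).1 ⟨x, mul_inv_eq_iff_eq_mul.2
        (Subgroup.mem_centralizer_singleton_iff.1 x.2), congrArg Subtype.val hx⟩
      rw [← Ideal.Quotient.eq, map_one] at h1
      rw [h1, mul_one]
      congr 1
      conv_rhs => rw [← hx]
      exact (mem_center_iff.1 hz _ _).symm
    · intro κ _ hκ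
      rw [Ideal.Quotient.eq_zero_iff_mem]
      refine Ideal.mul_mem_left _ _ ((hb κ s hs y).2 ?_)
      rintro ⟨x, hx, hxy⟩
      apply hκ
      rw [← Quotient.out_eq κ]
      refine ConjClasses.mk_eq_mk_iff_isConj.2 (isConj_iff.2 ⟨⟨x, ?_⟩, Subtype.ext hxy⟩)
      exact Subgroup.mem_centralizer_singleton_iff.2 (mul_inv_eq_iff_eq_mul.1 hx)
    · simp
  · ext y
    rw [coeff_reduction, hcoeff, coeff_zero, Finsupp.zero_apply, Ideal.Quotient.eq_zero_iff_mem]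
    refine sum_mem fun κ _ => Ideal.mul_mem_left _ _ ((hb κ t ht y).2 ?_)
    rintro ⟨x, hx, -⟩
    exact hst (isConj_iff.2 ⟨x, hx⟩)

end Approximation

/-! ### Block idempotents -/

section Idempotents

theorem IsIdempotentElem.sub_of_mul_eq {A : Type*} [Ring A] {e f : A} (he : IsIdempotentElem e)
    (hf : IsIdempotentElem f) (h : e * f = f) (h' : f * e = f) : IsIdempotentElem (e - f) := by
  rw [IsIdempotentElem, sub_mul, mul_sub, mul_sub, he.eq, hf.eq, h, h', sub_self, sub_zero]

/-- In a ring with finitely many central idempotents, a property of central idempotents that does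
not hold for zero and passes to one of the summands in each decomposition holds for a block
idempotent. -/
theorem exists_isBlockIdempotent {A : Type*} [Ring A]
    (hfin : {f : A | f ∈ Subring.center A ∧ IsIdempotentElem f}.Finite) {q : A → Prop} (h0 : ¬ q 0)
    (hq : ∀ e f : A, e ∈ Subring.center A → IsIdempotentElem e → f ∈ Subring.center A →
      IsIdempotentElem f → e * f = f → q e → q f ∨ q (e - f))
    {e : A} (hec : e ∈ Subring.center A) (he : IsIdempotentElem e) (hqe : q e) :
    ∃ f, IsBlockIdempotent f ∧ e * f = f ∧ q f := by
  let S : A → Set A := fun e => {f | f ∈ Subring.center A ∧ IsIdempotentElem f ∧ e * f = f}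
  have hS : ∀ e, (S e).Finite := fun e => hfin.subset fun f hf => ⟨hf.1, hf.2.1⟩
  -- The induction is on the number of central idempotents below e; the count drops strictly because
  -- e itself is not below a proper summand.
  have hlt : ∀ e f, e ∈ S e → f ∈ S e → f ≠ e → (S f).ncard < (S e).ncard := by
    intro e f he hf hne
    refine Set.ncard_lt_ncard ⟨fun x hx => ⟨hx.1, hx.2.1, ?_⟩, fun h => ?_⟩ (hS e)
    · rw [← hx.2.2, ← mul_assoc, hf.2.2]
    · refine hne ?_
      rw [← (h he).2.2, Subring.mem_center_iff.1 he.1, hf.2.2]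
  induction hn : (S e).ncard using Nat.strong_induction_on generalizing e with
  | _ n ih =>
    by_cases hb : IsBlockIdempotent e
    · exact ⟨e, hb, he, hqe⟩
    · have hne : e ≠ 0 := fun h => h0 (h ▸ hqe)
      simp only [IsBlockIdempotent, not_and, not_forall, not_or] at hb
      obtain ⟨f, hfc, hf, hef, hf0, hfe⟩ := hb hec he hne
      have hfe' : f * e = f := by rw [← Subring.mem_center_iff.1 hfc, hef]
      have key : ∀ f, f ∈ S e → f ≠ e → q f → ∃ f, IsBlockIdempotent f ∧ e * f = f ∧ q f := by
        intro f hf hne hqf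
        obtain ⟨f', h1, h2, h3⟩ := ih _ (hn ▸ hlt e f ⟨hec, he, he⟩ hf hne) hf.1 hf.2.1 hqf rfl
        exact ⟨f', h1, by rw [← h2, ← mul_assoc, hf.2.2], h3⟩
      rcases hq e f hec he hfc hf hef hqe with h | h
      · exact key f ⟨hfc, hf, hef⟩ hfe h
      · refine key (e - f) ⟨sub_mem hec hfc, he.sub_of_mul_eq hf hef hfe', ?_⟩ ?_ h
        · rw [mul_sub, he.eq, hef]
        · simpa using hf0

theorem IsBlockIdempotent.mul_eq_zero {A : Type*} [Ring A] {e f : A} (he : IsBlockIdempotent e)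
    (hf : IsBlockIdempotent f) (h : e ≠ f) : e * f = 0 := by
  have hc := Subring.mem_center_iff.1 hf.1 e
  have hi : IsIdempotentElem (e * f) := IsIdempotentElem.mul_of_commute hc he.2.1 hf.2.1
  have hm := mul_mem he.1 hf.1
  rcases he.2.2.2 _ hm hi (by rw [← mul_assoc, he.2.1.eq]) with h1 | h1
  · exact h1
  · rcases hf.2.2.2 _ hm hi (by rw [hc, ← mul_assoc, hf.2.1.eq]) with h2 | h2
    · exact h2
    · exact absurd (h1.symm.trans h2) h

/-- A central idempotent is the sum of the block idempotents it dominates. -/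
theorem finsum_isBlockIdempotent_eq {A : Type*} [Ring A]
    (hfin : {f : A | f ∈ Subring.center A ∧ IsIdempotentElem f}.Finite) {e : A}
    (hec : e ∈ Subring.center A) (he : IsIdempotentElem e) :
    ∑ᶠ f ∈ {f : A | IsBlockIdempotent f ∧ e * f = f}, f = e := by
  classical
  have hS : {f : A | IsBlockIdempotent f ∧ e * f = f}.Finite :=
    hfin.subset fun f hf => ⟨hf.1.1, hf.1.2.1⟩
  rw [finsum_mem_eq_finite_toFinset_sum _ hS]
  set T := hS.toFinset
  have hT : ∀ f ∈ T, IsBlockIdempotent f ∧ e * f = f := fun f hf => (Set.Finite.mem_toFinset hS).1 hf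
  set b := ∑ f ∈ T, f with hb
  have hbc : b ∈ Subring.center A := sum_mem fun f hf => (hT f hf).1.1
  have hbf : ∀ f ∈ T, b * f = f := by
    intro f hf
    rw [hb, Finset.sum_mul, Finset.sum_eq_single_of_mem f hf, (hT f hf).1.2.1.eq]
    exact fun f' hf' hne => (hT f' hf').1.mul_eq_zero (hT f hf).1 hne
  have hbi : IsIdempotentElem b := by
    rw [IsIdempotentElem]
    conv_lhs => enter [2]; rw [hb]
    rw [Finset.mul_sum, Finset.sum_congr rfl hbf]
  have heb : e * b = b := by
    rw [hb, Finset.mul_sum]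
    exact Finset.sum_congr rfl fun f hf => (hT f hf).2
  -- Otherwise e - b dominates a block idempotent; this one is also below e, so it occurs in the sum
  -- b and is killed by e - b.
  by_contra hne
  obtain ⟨f, hf, hf', -⟩ := exists_isBlockIdempotent hfin (q := fun f => f ≠ 0) (by simp)
    (fun e f _ _ _ _ _ h => by
      by_cases h1 : f = 0
      · exact Or.inr (by simpa [h1] using h)
      · exact Or.inl h1)
    (sub_mem hec hbc) (he.sub_of_mul_eq hbi heb (by rw [← Subring.mem_center_iff.1 hbc, heb]))
    (sub_ne_zero.2 (Ne.symm hne))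
  have hef : e * f = f := by
    rw [← hf', ← mul_assoc, mul_sub, he.eq, heb]
  have hfT : f ∈ T := (Set.Finite.mem_toFinset hS).2 ⟨hf, hef⟩
  rw [sub_mul, hef, hbf f hfT, sub_self] at hf'
  exact hf.2.2.1 hf'.symm

end Idempotents

/-! ### Central idempotents of group algebras over `O` and their reductions. -/

section GroupAlgebra

variable {p : ℕ} [Fact p.Prime] {K : Type v} [Field K]
  [CharZero K] {O : Type v} [CommRing O] [Algebra ℤ_[p] O] [Module.Finite ℤ_[p] O] [Algebra O K]
  [Algebra ℤ_[p] K] [IsIntegralClosure O ℤ_[p] K]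

theorem groupAlgebraMap_mem_center {H : Type*} [Group H] {z : MonoidAlgebra O H}
    (hz : z ∈ Subring.center (MonoidAlgebra O H)) :
    groupAlgebraMap O K H z ∈ Subring.center (MonoidAlgebra K H) :=
  mem_center_iff.2 fun h x => by simp [mem_center_iff.1 hz h x]

theorem centralChar_eq_zero_or_one {H : Type*} [Group H] [Fintype H] (hs : IsSplitGroupAlgebra K H)
    {γ : H → K} (hγ : IsIrrChar γ) {z : MonoidAlgebra O H}
    (hz : z ∈ Subring.center (MonoidAlgebra O H)) (hi : IsIdempotentElem z) :
    centralChar γ (groupAlgebraMap O K H z) = 0 ∨ centralChar γ (groupAlgebraMap O K H z) = 1 := by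
  have hc := groupAlgebraMap_mem_center (K := K) hz
  have h := centralChar_mul hs hγ hc hc
  rw [← map_mul, hi.eq] at h
  exact IsIdempotentElem.iff_eq_zero_or_one.1 h.symm

include p in
variable (p O) in
-- A central idempotent is determined by its values, 0 or 1, under the finitely many central
-- characters.
theorem finite_central_idempotents {H : Type*} [Group H] [Fintype H]
    (hs : IsSplitGroupAlgebra K H) :
    {f : MonoidAlgebra O H | f ∈ Subring.center (MonoidAlgebra O H) ∧ IsIdempotentElem f}.Finite := by
  have := finite_irrChar hs
  refine Set.Finite.of_injOn (f := fun z => fun γ : IrrChar K H =>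
    centralChar γ.1 (groupAlgebraMap O K H z) = 1) (t := Set.univ) (fun _ _ => Set.mem_univ _) ?_
    Set.finite_univ
  intro z hz z' hz' h
  apply groupAlgebraMap_injective p (K := K)
  have hc := groupAlgebraMap_mem_center (K := K) hz.1
  have hc' := groupAlgebraMap_mem_center (K := K) hz'.1
  rw [← sub_eq_zero]
  refine eq_zero_of_forall_centralChar hs (sub_mem hc hc') fun γ hγ => ?_
  have h1 : (centralChar γ (groupAlgebraMap O K H z) = 1) =
    (centralChar γ (groupAlgebraMap O K H z') = 1) := congrFun h ⟨γ, hγ⟩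
  have hsub : centralChar γ (groupAlgebraMap O K H z - groupAlgebraMap O K H z') =
      centralChar γ (groupAlgebraMap O K H z) - centralChar γ (groupAlgebraMap O K H z') := by
    rw [eq_sub_iff_add_eq, ← centralChar_add, sub_add_cancel]
  rw [hsub, sub_eq_zero]
  rcases centralChar_eq_zero_or_one hs hγ hz.1 hz.2 with h2 | h2 <;>
    rcases centralChar_eq_zero_or_one hs hγ hz'.1 hz'.2 with h3 | h3 <;>
    simp [h2, h3] at h1 ⊢

variable (K) (𝔭 : Ideal O) [h𝔭 : 𝔭.IsMaximal]

include p K in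
variable (p) in
-- From f = f² the coefficients lie in every power of 𝔭, and Krull's intersection theorem applies in
-- the Noetherian domain O.
theorem eq_zero_of_reduction_eq_zero {H : Type u} [Group H] [Finite H] {f : MonoidAlgebra O H}
    (hf : IsIdempotentElem f) (h : reduction 𝔭 H f = 0) : f = 0 := by
  let _ := Fintype.ofFinite H
  have hd : IsDomain O :=
    (algebraMap_injective_of_isIntegralClosure p (O := O) (K := K)).isDomain (algebraMap O K)
  have hn : IsNoetherianRing O := IsNoetherianRing.of_finite ℤ_[p] O
  have h1 : ∀ x, f.coeff x ∈ 𝔭 := fun x => by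
    rw [← Ideal.Quotient.eq_zero_iff_mem, ← coeff_reduction, h]; simp
  have h2 : ∀ n : ℕ, ∀ x, f.coeff x ∈ 𝔭 ^ n := by
    intro n
    induction n with
    | zero => simp
    | succ n ih =>
      intro x
      rw [← hf.eq, coeff_mul_eq_sum, pow_succ]
      exact sum_mem fun a _ => Ideal.mul_mem_mul (ih _) (h1 _)
  ext x
  have h3 : f.coeff x ∈ ⨅ n : ℕ, 𝔭 ^ n := (Submodule.mem_iInf _).2 fun n => h2 n x
  rw [Ideal.iInf_pow_eq_bot_of_isDomain 𝔭 h𝔭.ne_top] at h3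
  simpa using h3

include p K in
variable (p) in
-- Both e - e f and f - e f are idempotents with zero reduction. This turns congruences modulo 𝔭
-- between idempotents into equalities.
theorem eq_of_reduction_eq {H : Type u} [Group H] [Finite H] {e f : MonoidAlgebra O H}
    (he : IsIdempotentElem e) (hf : IsIdempotentElem f) (hc : Commute e f)
    (h : reduction 𝔭 H e = reduction 𝔭 H f) : e = f := by
  have hef : IsIdempotentElem (e * f) := IsIdempotentElem.mul_of_commute hc he hf
  have h1 : e - e * f = 0 := by
    refine eq_zero_of_reduction_eq_zero p K 𝔭 (he.sub_of_mul_eq hef ?_ ?_) ?_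
    · rw [← mul_assoc, he.eq]
    · rw [mul_assoc, ← hc.eq, ← mul_assoc, he.eq]
    · rw [map_sub, map_mul, ← h, ← map_mul, he.eq, sub_self]
  have h2 : f - e * f = 0 := by
    refine eq_zero_of_reduction_eq_zero p K 𝔭 (hf.sub_of_mul_eq hef ?_ ?_) ?_
    · rw [hc.eq, ← mul_assoc, hf.eq]
    · rw [mul_assoc, hf.eq]
    · rw [map_sub, map_mul, h, ← map_mul, hf.eq, sub_self]
  rw [sub_eq_zero.1 h1, ← sub_eq_zero.1 h2]

end GroupAlgebra

/-! ### Idempotents of the Grothendieck ring attached to blocks -/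

section Lifts

variable {p : ℕ} [Fact p.Prime] {G : Type u} [Group G] [Fintype G] {K : Type v} [Field K]
  [CharZero K] {O : Type v} [CommRing O] [Algebra ℤ_[p] O] [Module.Finite ℤ_[p] O] [Algebra O K]
  [Algebra ℤ_[p] K] [IsIntegralClosure O ℤ_[p] K]
  (hsplit : ∀ H : Subgroup G, IsSplitGroupAlgebra K H) (𝔭 : Ideal O) [h𝔭 : 𝔭.IsMaximal]

theorem finite_tensor_kgg (hsplit : ∀ H : Subgroup G, IsSplitGroupAlgebra K H) :
    Module.Finite ℤ_[p] (O ⊗[ℤ] KGG G K) := by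
  have := finite_mSet hsplit
  have : Module.Finite O (O ⊗[ℤ] KGG G K) := Module.Finite.of_basis (tensorBasis hsplit O)
  exact Module.Finite.trans O _

theorem phiO_isIdempotentElem {b : O ⊗[ℤ] KGG G K} (hb : IsIdempotentElem b) (g : G) :
    IsIdempotentElem (phiO p K O g b) := hb.map _

theorem commute_phiO (g : G) (a : O ⊗[ℤ] KGG G K) (z : MonoidAlgebra O (Cent g)) :
    Commute (phiO p K O g a) z := (Subring.mem_center_iff.1 (phiO_mem_center g a) z).symm

include 𝔭 in
-- The reduction at g is the Brauer image of the reduction at s, and commuting idempotents with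
-- equal reductions coincide. So idempotents are detected on p'-elements alone.
theorem phiO_eq_of_isPPrimePart {g s : G} (h : IsPPrimePart p g s) {a b : O ⊗[ℤ] KGG G K}
    (ha : IsIdempotentElem a) (hb : IsIdempotentElem b) (hab : phiO p K O s a = phiO p K O s b) :
    phiO p K O g a = phiO p K O g b := by
  refine eq_of_reduction_eq p K 𝔭 (phiO_isIdempotentElem ha g) (phiO_isIdempotentElem hb g)
    (commute_phiO g a _) ?_
  rw [reduction_phiO 𝔭 h, reduction_phiO 𝔭 h, hab]

include hsplit 𝔭 in
theorem eq_of_forall_phiO_isPPrimeElement {a b : O ⊗[ℤ] KGG G K} (ha : IsIdempotentElem a)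
    (hb : IsIdempotentElem b)
    (h : ∀ s, IsPPrimeElement p s → phiO p K O s a = phiO p K O s b) : a = b := by
  refine eq_of_forall_phiO (p := p) hsplit fun g => ?_
  obtain ⟨s, hs⟩ := exists_isPPrimePart (p := p) g
  exact phiO_eq_of_isPPrimePart 𝔭 hs ha hb (h s hs.isPPrimeElement)

include hsplit 𝔭 in
-- Take `a` with the right images modulo 𝔭 and an idempotent b congruent to a power of `a` modulo p.
-- Its reductions are powers of an idempotent and of zero, with nonzero exponent, so they are
-- unchanged; rigidity of idempotents upgrades them to the exact values.
theorem exists_isIdempotentElem_phiO_eq {s : G} (hs : IsPPrimeElement p s)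
    {e : MonoidAlgebra O (Cent s)} (hec : e ∈ Subring.center (MonoidAlgebra O (Cent s)))
    (he : IsIdempotentElem e) : ∃ b : O ⊗[ℤ] KGG G K, IsIdempotentElem b ∧ phiO p K O s b = e ∧
      ∀ t, IsPPrimeElement p t → ¬ IsConj s t → phiO p K O t b = 0 := by
  obtain ⟨a, has, hat⟩ := exists_reduction_phiO_eq hsplit 𝔭 hs hec
  have := finite_tensor_kgg (p := p) (O := O) hsplit
  obtain ⟨m, hm, b, hb, hba⟩ := exists_isIdempotentElem_sub_pow_mem p a
  have hred : ∀ t, reduction 𝔭 _ (phiO p K O t b) = reduction 𝔭 _ (phiO p K O t a) ^ m := by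
    intro t
    obtain ⟨y, hy⟩ := Ideal.mem_span_singleton'.1 hba
    rw [← sub_eq_zero, ← map_pow, ← map_pow, ← map_sub, ← map_sub, ← hy, map_mul, map_mul,
      map_natCast, map_natCast]
    have : ((p : ℕ) : MonoidAlgebra (O ⧸ 𝔭) (Cent t)) = 0 := by
      have h0 : ((p : ℕ) : O ⧸ 𝔭) = 0 := by
        have := charP_residue p 𝔭
        exact CharP.cast_eq_zero _ p
      rw [← map_natCast (algebraMap (O ⧸ 𝔭) _), h0, map_zero]
    rw [this, mul_zero]
  refine ⟨b, hb, ?_, fun t ht hst => ?_⟩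
  · refine eq_of_reduction_eq p K 𝔭 (phiO_isIdempotentElem hb s) he (commute_phiO s b _) ?_
    rw [hred, has, ← map_pow, he.pow_eq hm]
  · refine eq_zero_of_reduction_eq_zero p K 𝔭 (phiO_isIdempotentElem hb t) ?_
    rw [hred, hat t ht hst, zero_pow hm]

/-- The idempotent `b` of `O ⊗ K_G(G)` is the one attached to the pair `(s, e)`: its image in
`O C_G(s)` is `e`, and its image in `O C_G(t)` is zero for every `p'`-element `t` that is not
conjugate to `s`. -/
structure BlPair.IsLift (K : Type v) [Field K] [CharZero K] [Algebra O K] [Algebra ℤ_[p] K]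
    [IsIntegralClosure O ℤ_[p] K] (P : BlPair p O G) (b : O ⊗[ℤ] KGG G K) : Prop where
  isIdempotentElem : IsIdempotentElem b
  phiO_s : phiO p K O P.s b = P.e
  phiO_eq_zero : ∀ t, IsPPrimeElement p t → ¬ IsConj P.s t → phiO p K O t b = 0

include hsplit 𝔭 in
theorem BlPair.exists_isLift (P : BlPair p O G) : ∃ b, P.IsLift K b := by
  obtain ⟨b, h1, h2, h3⟩ := exists_isIdempotentElem_phiO_eq hsplit 𝔭 P.isPPrime P.isBlock.1
    P.isBlock.2.1
  exact ⟨b, h1, h2, h3⟩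

theorem BlPair.IsLift.of_conj {P P' : BlPair p O G} (h : P ≈ P') {b : O ⊗[ℤ] KGG G K}
    (hb : P.IsLift K b) : P'.IsLift K b := by
  obtain ⟨x, hx, he⟩ := h
  refine ⟨hb.1, ?_, fun t ht hst => hb.3 t ht fun h => hst (IsConj.trans (IsConj.symm ?_) h)⟩
  · rw [← mapDomain_conjCent_phiO x hx, hb.2, he]
  · exact isConj_iff.2 ⟨x, hx⟩

/-- The image of b at P'.s is a block idempotent, hence nonzero, which forces P'.s to be conjugate
to P.s; equivariance of `phiO` then matches the idempotents. -/
theorem BlPair.IsLift.conj {P P' : BlPair p O G} {b : O ⊗[ℤ] KGG G K} (hb : P.IsLift K b)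
    (hb' : P'.IsLift K b) : P ≈ P' := by
  have hc : IsConj P.s P'.s := by
    by_contra h
    exact P'.isBlock.2.2.1 (by rw [← hb'.2, hb.3 _ P'.isPPrime h])
  obtain ⟨x, hx⟩ := isConj_iff.1 hc
  exact ⟨x, hx, by rw [← hb.2, mapDomain_conjCent_phiO, hb'.2]⟩

theorem BlPair.IsLift.ne_zero {P : BlPair p O G} {b : O ⊗[ℤ] KGG G K} (hb : P.IsLift K b) :
    b ≠ 0 := by
  rintro rfl
  exact P.isBlock.2.2.1 (by rw [← hb.2, map_zero])

include hsplit 𝔭 in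
theorem eq_of_phiO_eq {s : G} {a b : O ⊗[ℤ] KGG G K} (ha : IsIdempotentElem a)
    (hb : IsIdempotentElem b) (h : phiO p K O s a = phiO p K O s b)
    (ha' : ∀ t, IsPPrimeElement p t → ¬ IsConj s t → phiO p K O t a = 0)
    (hb' : ∀ t, IsPPrimeElement p t → ¬ IsConj s t → phiO p K O t b = 0) : a = b := by
  refine eq_of_forall_phiO_isPPrimeElement (p := p) hsplit 𝔭 ha hb fun t ht => ?_
  by_cases hst : IsConj s t
  · obtain ⟨x, hx⟩ := isConj_iff.1 hst
    rw [← mapDomain_conjCent_phiO x hx a, ← mapDomain_conjCent_phiO x hx b, h]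
  · rw [ha' t ht hst, hb' t ht hst]

include hsplit 𝔭 in
-- An idempotent below b also vanishes at the other p'-classes, and its image at s is a central
-- idempotent below the block idempotent e, so 0 or e. Detection on p'-elements leaves only 0 and b.
theorem BlPair.IsLift.isBlockIdempotent {P : BlPair p O G} {b : O ⊗[ℤ] KGG G K}
    (hb : P.IsLift K b) : IsBlockIdempotent b := by
  refine ⟨Subring.mem_center_iff.2 fun a => mul_comm _ _, hb.1, hb.ne_zero, fun f _ hf hbf => ?_⟩
  have hft : ∀ t, IsPPrimeElement p t → ¬ IsConj P.s t → phiO p K O t f = 0 := fun t ht hst => by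
    rw [← hbf, map_mul, hb.3 t ht hst, zero_mul]
  rcases P.isBlock.2.2.2 _ (phiO_mem_center P.s f) (phiO_isIdempotentElem hf P.s)
    (by rw [← hb.2, ← map_mul, hbf]) with h | h
  · left
    exact eq_of_phiO_eq hsplit 𝔭 (s := P.s) hf IsIdempotentElem.zero (by rw [h, map_zero]) hft
      (fun _ _ _ => map_zero _)
  · right
    exact eq_of_phiO_eq hsplit 𝔭 (s := P.s) hf hb.1 (by rw [h, hb.2]) hft hb.3

/-- The set of orbits of pairs at which `b` takes the value `1`. -/
def psiSupport (hsplit : ∀ H : Subgroup G, IsSplitGroupAlgebra K H) (b : O ⊗[ℤ] KGG G K) :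
    Set (MSet G K) :=
  {q | ∃ Q : IrrPair G K, Q.orbit = q ∧ psi hsplit Q (extendScalars O G K b) = 1}

theorem orbit_mem_psiSupport {Q : IrrPair G K} {b : O ⊗[ℤ] KGG G K} :
    Q.orbit ∈ psiSupport hsplit b ↔ psi hsplit Q (extendScalars O G K b) = 1 := by
  refine ⟨?_, fun h => ⟨Q, rfl, h⟩⟩
  rintro ⟨Q', h, hQ'⟩
  rw [← hQ', psi_eq_of_orbit_eq hsplit h]

theorem psi_eq_centralChar (Q : IrrPair G K) (b : O ⊗[ℤ] KGG G K) :
    psi hsplit Q (extendScalars O G K b) =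
      centralChar Q.γ (groupAlgebraMap O K (Cent Q.g) (phiO p K O Q.g b)) := by
  rw [psi_apply, groupAlgebraMap_phiO]

theorem psi_eq_zero_or_one (Q : IrrPair G K) {b : O ⊗[ℤ] KGG G K} (hb : IsIdempotentElem b) :
    psi hsplit Q (extendScalars O G K b) = 0 ∨ psi hsplit Q (extendScalars O G K b) = 1 :=
  IsIdempotentElem.iff_eq_zero_or_one.1 ((hb.map (extendScalars O G K)).map (psi hsplit Q))

include p in
variable (p) in
theorem exists_psi_eq_one {b : O ⊗[ℤ] KGG G K} (hb : IsIdempotentElem b) (h0 : b ≠ 0) :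
    ∃ Q, psi hsplit Q (extendScalars O G K b) = 1 := by
  by_contra h
  push Not at h
  refine h0 (extendScalars_injective p hsplit ?_)
  rw [map_zero]
  exact eq_zero_of_forall_psi hsplit fun Q => (psi_eq_zero_or_one hsplit Q hb).resolve_right (h Q)

include hsplit in
-- By `reduction_phiO` the Brauer image of ē is the reduction of the idempotent `phiO p K O g b`,
-- and whether this idempotent dominates f can be tested modulo 𝔭. Hence `betaIdem` sums the blocks
-- below `phiO p K O g b`, which recovers it.
theorem betaIdem_eq {P : BlPair p O G} {b : O ⊗[ℤ] KGG G K} (hb : P.IsLift K b) {g : G}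
    (hg : IsPPrimePart p g P.s) : betaIdem 𝔭 P.s g P.e = phiO p K O g b := by
  -- A `finsum` over an infinite set is 0 by convention; this finiteness makes the sum genuine.
  have hfin := finite_central_idempotents p O (hsplit (Cent g))
  have hsum := finsum_isBlockIdempotent_eq hfin (phiO_mem_center (p := p) (K := K) g b)
    (phiO_isIdempotentElem hb.1 g)
  rw [betaIdem, ← hb.2, ← reduction_phiO 𝔭 hg]
  have : {f : MonoidAlgebra O (Cent g) | IsBlockIdempotent f ∧
      reduction 𝔭 (Cent g) (phiO p K O g b) * reduction 𝔭 (Cent g) f = reduction 𝔭 (Cent g) f} =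
      {f | IsBlockIdempotent f ∧ phiO p K O g b * f = f} := by
    ext f
    refine and_congr_right fun hf => ⟨fun h => ?_, fun h => by rw [← map_mul, h]⟩
    have hc := commute_phiO (p := p) g b f
    refine eq_of_reduction_eq p K 𝔭 (IsIdempotentElem.mul_of_commute hc
      (phiO_isIdempotentElem hb.1 g) hf.2.1) hf.2.1 (hc.mul_left (Commute.refl f)) ?_
    rw [map_mul, h]
  rw [this, hsum]

theorem asAlgebraHom_eq_one_iff {H : Type*} [Group H] [Fintype H] (hs : IsSplitGroupAlgebra K H)
    {n : ℕ} {ρ : Representation K H (Fin n → K)} (hρ : ρ.IsIrreducible) {z : MonoidAlgebra K H}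
    (hz : z ∈ Subring.center (MonoidAlgebra K H)) :
    ρ.asAlgebraHom z = 1 ↔ centralChar ρ.character z = 1 := by
  rw [asAlgebraHom_of_mem_center hs hρ hz]
  have hn : n ≠ 0 := by simpa using hρ.finrank_ne_zero
  have : NeZero n := ⟨hn⟩
  have : Nontrivial (Fin n → K) := inferInstance
  constructor
  · intro h
    exact smul_left_injective K (one_ne_zero (α := Module.End K (Fin n → K)))
      (h.trans (one_smul K _).symm)
  · intro h
    rw [h, one_smul]

theorem isIrrCharOf_phiO_iff (Q : IrrPair G K) (b : O ⊗[ℤ] KGG G K) :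
    IsIrrCharOf K (phiO p K O Q.g b) Q.γ ↔ psi hsplit Q (extendScalars O G K b) = 1 := by
  have hz := groupAlgebraMap_mem_center (K := K) (phiO_mem_center (p := p) Q.g b)
  rw [psi_eq_centralChar (p := p)]
  constructor
  · rintro ⟨n, ρ, hρ, hγ, h⟩
    rw [← hγ]
    exact (asAlgebraHom_eq_one_iff (hsplit _) hρ hz).1 h
  · intro h
    refine ⟨_, Q.rep, Q.rep_irreducible, Q.rep_character, ?_⟩
    refine (asAlgebraHom_eq_one_iff (hsplit _) Q.rep_irreducible hz).2 ?_
    rw [Q.rep_character, h]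

/-- Once β_g(e) is known to be the image of b at g, only conjugacy remains: if b takes the value 1
at Q, its image at the p'-part of Q.g cannot vanish, so this p'-part is conjugate to s and Q can be
moved within its orbit. -/
theorem blockOfPair_eq {P : BlPair p O G} {b : O ⊗[ℤ] KGG G K} (hb : P.IsLift K b) :
    blockOfPair p 𝔭 K P = psiSupport hsplit b := by
  ext q
  constructor
  · rintro ⟨Q, hq, hQ, h⟩
    rw [betaIdem_eq hsplit 𝔭 hb hQ, isIrrCharOf_phiO_iff hsplit] at h
    exact ⟨Q, hq, h⟩
  · rintro ⟨Q, hq, h⟩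
    obtain ⟨t, ht⟩ := exists_isPPrimePart (p := p) Q.g
    have hc : IsConj t P.s := by
      by_contra hst
      have h0 : phiO p K O t b = 0 := hb.3 t ht.isPPrimeElement fun h => hst h.symm
      have : phiO p K O Q.g b = phiO p K O Q.g 0 :=
        phiO_eq_of_isPPrimePart 𝔭 ht hb.1 IsIdempotentElem.zero (by rw [h0, map_zero])
      rw [psi_eq_centralChar (p := p), this, ← psi_eq_centralChar hsplit, map_zero, map_zero] at h
      exact zero_ne_one h
    obtain ⟨x, hx⟩ := isConj_iff.1 hc
    have hQ : IsPPrimePart p (Q.conj x).g P.s := hx ▸ ht.conj x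
    refine ⟨Q.conj x, (Q.conj_orbit x).trans hq, hQ, ?_⟩
    rw [betaIdem_eq hsplit 𝔭 hb hQ, isIrrCharOf_phiO_iff hsplit,
      psi_eq_of_orbit_eq hsplit (Q.conj_orbit x), h]

theorem mem_pBlocks_iff {B : Set (MSet G K)} :
    B ∈ pBlocks O G K ↔ ∃ b : O ⊗[ℤ] KGG G K, IsBlockIdempotent b ∧ B = psiSupport hsplit b := by
  have : ∀ b : O ⊗[ℤ] KGG G K, {q | ∃ (Q : IrrPair G K) (Ψ : K ⊗[ℤ] KGG G K →ₐ[K] K),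
      Q.orbit = q ∧ IsPsi Q Ψ ∧ Ψ (extendScalars O G K b) = 1} = psiSupport hsplit b := by
    intro b
    ext q
    constructor
    · rintro ⟨Q, Ψ, hq, hΨ, h⟩
      rw [isPsi_iff hsplit] at hΨ
      subst hΨ
      exact ⟨Q, hq, h⟩
    · rintro ⟨Q, hq, h⟩
      exact ⟨Q, _, hq, isPsi_psi hsplit Q, h⟩
  constructor
  · rintro ⟨b, hb, h⟩
    exact ⟨b, hb, h.trans (this b)⟩
  · rintro ⟨b, hb, h⟩
    exact ⟨b, hb, h.trans (this b).symm⟩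

/-- Distinct block idempotents are orthogonal, so no character takes the value 1 on both. -/
theorem IsBlockIdempotent.eq_of_psi_eq_one {a b : O ⊗[ℤ] KGG G K} (ha : IsBlockIdempotent a)
    (hb : IsBlockIdempotent b) {Q : IrrPair G K} (hQa : psi hsplit Q (extendScalars O G K a) = 1)
    (hQb : psi hsplit Q (extendScalars O G K b) = 1) : a = b := by
  by_contra h
  have := ha.mul_eq_zero hb h
  have h1 : psi hsplit Q (extendScalars O G K (a * b)) = 1 := by
    rw [map_mul, map_mul, hQa, hQb, mul_one]
  rw [this, map_zero, map_zero] at h1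
  exact zero_ne_one h1

include 𝔭 in
-- Decompose 1 in the centre of O C_G(s), where s is the p'-part of Q.g: at each splitting of an
-- idempotent, the character of Q takes the value 1 on a lift of one of the summands, and this
-- descends to a block idempotent.
theorem exists_isLift_psi_eq_one (Q : IrrPair G K) :
    ∃ (P : BlPair p O G) (b : O ⊗[ℤ] KGG G K), P.IsLift K b ∧
      psi hsplit Q (extendScalars O G K b) = 1 := by
  obtain ⟨s, hs⟩ := exists_isPPrimePart (p := p) Q.g
  have hfin := finite_central_idempotents p O (hsplit (Cent s))
  -- The lift `a` need not vanish at other p'-classes: only its image at s affects the value at Q,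
  -- by `phiO_eq_of_isPPrimePart`.
  let q : MonoidAlgebra O (Cent s) → Prop := fun e => ∃ a : O ⊗[ℤ] KGG G K,
    IsIdempotentElem a ∧ phiO p K O s a = e ∧ psi hsplit Q (extendScalars O G K a) = 1
  have h0 : ¬ q 0 := by
    rintro ⟨a, ha, hae, hQ⟩
    have := phiO_eq_of_isPPrimePart 𝔭 hs ha IsIdempotentElem.zero (by rw [hae, map_zero])
    rw [psi_eq_centralChar (p := p), this, ← psi_eq_centralChar hsplit, map_zero, map_zero] at hQ
    exact zero_ne_one hQ
  have hq : ∀ e f : MonoidAlgebra O (Cent s), e ∈ Subring.center _ → IsIdempotentElem e →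
      f ∈ Subring.center _ → IsIdempotentElem f → e * f = f → q e → q f ∨ q (e - f) := by
    rintro e f hec he hfc hf hef ⟨a, ha, hae, hQ⟩
    obtain ⟨c, hc, hcf, -⟩ := exists_isIdempotentElem_phiO_eq (K := K) hsplit 𝔭 hs.isPPrimeElement
      hfc hf
    rcases psi_eq_zero_or_one hsplit Q (ha.mul hc) with h | h
    · right
      refine ⟨a - a * c, ha.sub_of_mul_eq (ha.mul hc) ?_ ?_, ?_, ?_⟩
      · rw [← mul_assoc, ha.eq]
      · rw [mul_comm, ← mul_assoc, ha.eq]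
      · rw [map_sub, map_mul, hae, hcf, hef]
      · rw [map_sub, map_sub, h, hQ, sub_zero]
    · left
      exact ⟨a * c, ha.mul hc, by rw [map_mul, hae, hcf, hef], h⟩
  obtain ⟨e, he, -, a, ha, hae, hQ⟩ := exists_isBlockIdempotent hfin h0 hq (one_mem _)
    IsIdempotentElem.one ⟨1, IsIdempotentElem.one, map_one _, by rw [map_one, map_one]⟩
  let P : BlPair p O G := ⟨s, e, hs.isPPrimeElement, he⟩
  obtain ⟨b, hb⟩ := P.exists_isLift hsplit 𝔭
  refine ⟨P, b, hb, ?_⟩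
  rw [psi_eq_centralChar (p := p), ← phiO_eq_of_isPPrimePart 𝔭 hs ha hb.1 (hae.trans hb.2.symm),
    ← psi_eq_centralChar hsplit, hQ]

include hsplit in
-- Supports of block idempotents are nonempty and pairwise disjoint. Equal supports therefore force
-- equal idempotents and conjugate pairs, and a given block idempotent equals the lift that shares
-- with it a character of value 1.
theorem exists_bijOn_pBlocks : ∃ F : MpSet p O G → Set (MSet G K),
    (∀ P : BlPair p O G, F P.orbit = blockOfPair p 𝔭 K P) ∧
      Set.BijOn F Set.univ (pBlocks O G K) := by
  choose b hb using fun P : BlPair p O G => P.exists_isLift hsplit 𝔭 (K := K)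
  have hwd : ∀ P P' : BlPair p O G, P ≈ P' → blockOfPair p 𝔭 K P = blockOfPair p 𝔭 K P' := by
    intro P P' h
    rw [blockOfPair_eq hsplit 𝔭 (hb P), blockOfPair_eq hsplit 𝔭 ((hb P).of_conj h)]
  refine ⟨Quotient.lift (blockOfPair p 𝔭 K) hwd, fun P => rfl, ?_, ?_, ?_⟩
  · rintro ⟨P⟩ -
    exact (mem_pBlocks_iff hsplit).2
      ⟨b P, (hb P).isBlockIdempotent hsplit 𝔭, blockOfPair_eq hsplit 𝔭 (hb P)⟩
  · rintro ⟨P⟩ - ⟨P'⟩ - h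
    change blockOfPair p 𝔭 K P = blockOfPair p 𝔭 K P' at h
    rw [blockOfPair_eq hsplit 𝔭 (hb P), blockOfPair_eq hsplit 𝔭 (hb P')] at h
    obtain ⟨Q, hQ⟩ := exists_psi_eq_one p hsplit (hb P).1 (hb P).ne_zero
    have hQ' := (orbit_mem_psiSupport hsplit).1 (h ▸ (orbit_mem_psiSupport hsplit).2 hQ)
    have e := ((hb P).isBlockIdempotent hsplit 𝔭).eq_of_psi_eq_one hsplit
      ((hb P').isBlockIdempotent hsplit 𝔭) hQ hQ'
    exact Quotient.sound ((hb P).conj (e ▸ hb P'))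
  · intro B hB
    obtain ⟨c, hc, rfl⟩ := (mem_pBlocks_iff hsplit).1 hB
    obtain ⟨Q, hQ⟩ := exists_psi_eq_one p hsplit hc.2.1 hc.2.2.1
    obtain ⟨P, d, hd, hQd⟩ := exists_isLift_psi_eq_one (p := p) hsplit 𝔭 Q
    have e := hc.eq_of_psi_eq_one hsplit (hd.isBlockIdempotent hsplit 𝔭) hQ hQd
    exact ⟨P.orbit, Set.mem_univ _, e ▸ blockOfPair_eq hsplit 𝔭 hd⟩

end Lifts

end

/-! ### The main theorem. -/

theorem mainTheorem1 (p : ℕ) [Fact p.Prime] {G : Type u} [Group G] [Fintype G]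
    {K : Type v} [Field K] [Algebra ℚ_[p] K] [FiniteDimensional ℚ_[p] K]
    [Algebra ℤ_[p] K] [IsScalarTower ℤ_[p] ℚ_[p] K]
    (hsplit : ∀ H : Subgroup G, IsSplitGroupAlgebra K H)
    (𝔭 : Ideal (integralClosure ℤ_[p] K)) (h𝔭 : 𝔭.IsMaximal) :
    ((∀ Q : IrrPair G K, ∃! Ψ : K ⊗[ℤ] KGG G K →ₐ[K] K, IsPsi Q Ψ) ∧
      (∀ Ψ : K ⊗[ℤ] KGG G K →ₐ[K] K, ∃ q : MSet G K, ∀ Q : IrrPair G K,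
        IsPsi Q Ψ ↔ Q.orbit = q)) ∧
    ∃ F : MpSet p (integralClosure ℤ_[p] K) G → Set (MSet G K),
      (∀ P : BlPair p (integralClosure ℤ_[p] K) G, F P.orbit = blockOfPair p 𝔭 K P) ∧
      Set.BijOn F Set.univ (pBlocks (integralClosure ℤ_[p] K) G K) := by
  have hchar : CharZero K := charZero_of_injective_algebraMap (algebraMap ℚ_[p] K).injective
  have hfin : Module.Finite ℤ_[p] (integralClosure ℤ_[p] K) :=
    IsIntegralClosure.finite ℤ_[p] ℚ_[p] K (integralClosure ℤ_[p] K)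
  refine ⟨⟨fun Q => ⟨psi hsplit Q, isPsi_psi hsplit Q, fun Ψ h => (isPsi_iff hsplit).1 h⟩,
    fun Ψ => ?_⟩, exists_bijOn_pBlocks hsplit 𝔭⟩
  obtain ⟨Q', rfl⟩ := exists_eq_psi hsplit Ψ
  refine ⟨Q'.orbit, fun Q => ?_⟩
  rw [isPsi_iff hsplit, psi_eq_iff hsplit, eq_comm]
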